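/- Work with first-order theories in the language of set theory (relation symbols $\in$ and $=$), over intuitionistic first-order logic with equality. $\mathbf{CZF}$ is constructive Zermelo–Fraenkel set theory, with the axioms extensionality, pairing, union, infinity, set induction, bounded ($\Delta_0$) separation, strong collection and subset collection; $\mathbb{N}$ is the set $\omega$ of von Neumann natural numbers and $\underline{n}$ denotes the $n$-th von Neumann numeral. $\mathbf{LLPO}_\infty$ is the following statement: let $(\,,):\mathbb{N}\times\mathbb{N}\to\mathbb{N}$ be a bijective pairing function and let $\alpha:\mathbb{N}\to 2$ be such that $\alpha(i)=1$ for at most one $i$; then there is $k\in\mathbb{N}$ such that $\alpha((k,n))=0$ for all $n\in\mathbb{N}$. A theory $T$ is recursively axiomatisable if it has the same theorems as some recursive set of axioms, and it has the numerical existence property if, whenever $T\vdash(\exists x\in\mathbb{N})\,\phi(x)$ for a formula $\phi(x)$ with at most the variable $x$ free, there is a natural number $n$ such that $T\vdash\phi(\underline{n})$. **Theorem.** Let $T$ be a consistent, recursively axiomatisable extension of $\mathbf{CZF}+\mathbf{LLPO}_\infty$. Then $T$ does not have the numerical existence property. -/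

import Mathlib

namespace SetTheory

/-- Formulas of the first-order language of set theory, with the two binary relation symbols
`∈` and `=`, and the intuitionistic connectives (none is defined from the others).
Variables are de Bruijn indices: inside `all φ` and `ex φ` the index `0` is the variable bound
by the quantifier, and the index `n + 1` is the variable that is called `n` outside. -/
inductive Fml : Type
  | mem (i j : ℕ) : Fml
  | eq (i j : ℕ) : Fml
  | bot : Fml
  | and (φ ψ : Fml) : Fml
  | or (φ ψ : Fml) : Fml
  | imp (φ ψ : Fml) : Fml
  | all (φ : Fml) : Fml
  | ex (φ : Fml) : Fml

namespace Fml

def neg (φ : Fml) : Fml := imp φ bot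

def iff (φ ψ : Fml) : Fml := and (imp φ ψ) (imp ψ φ)

/-- A renaming of the free variables, pushed under one quantifier. -/
def liftRen (ρ : ℕ → ℕ) : ℕ → ℕ
  | 0 => 0
  | n + 1 => ρ n + 1

/-- (Capture-avoiding) renaming of the free variables of a formula. As the only terms of the
language are variables, this is also substitution. -/
def rename : (ℕ → ℕ) → Fml → Fml
  | ρ, mem i j => mem (ρ i) (ρ j)
  | ρ, eq i j => eq (ρ i) (ρ j)
  | _, bot => bot
  | ρ, and φ ψ => and (rename ρ φ) (rename ρ ψ)
  | ρ, or φ ψ => or (rename ρ φ) (rename ρ ψ)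
  | ρ, imp φ ψ => imp (rename ρ φ) (rename ρ ψ)
  | ρ, all φ => all (rename (liftRen ρ) φ)
  | ρ, ex φ => ex (rename (liftRen ρ) φ)

/-- Weakening: read a formula in the scope of one more quantifier. -/
def shift (φ : Fml) : Fml := rename Nat.succ φ

/-- `φ.inst t` is the instance `φ(t)` of the matrix `φ` of a quantified formula. -/
def inst (φ : Fml) (t : ℕ) : Fml :=
  rename (fun n => match n with | 0 => t | k + 1 => k) φ

/-- All free variables of the formula have an index smaller than `k`. -/
def FreeBelow : ℕ → Fml → Prop
  | k, mem i j => i < k ∧ j < k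
  | k, eq i j => i < k ∧ j < k
  | _, bot => True
  | k, and φ ψ => FreeBelow k φ ∧ FreeBelow k ψ
  | k, or φ ψ => FreeBelow k φ ∧ FreeBelow k ψ
  | k, imp φ ψ => FreeBelow k φ ∧ FreeBelow k ψ
  | k, all φ => FreeBelow (k + 1) φ
  | k, ex φ => FreeBelow (k + 1) φ

/-- The bounded quantifier `∀ x ∈ a, φ`; in `φ` the variable `x` has index `0`. -/
def ball (a : ℕ) (φ : Fml) : Fml := all (imp (mem 0 (a + 1)) φ)

/-- The bounded quantifier `∃ x ∈ a, φ`; in `φ` the variable `x` has index `0`. -/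
def bex (a : ℕ) (φ : Fml) : Fml := ex (and (mem 0 (a + 1)) φ)

/-- Bounded (that is, `Δ₀`) formulas: all quantifiers are bounded. -/
inductive Bounded : Fml → Prop
  | mem (i j : ℕ) : Bounded (mem i j)
  | eq (i j : ℕ) : Bounded (eq i j)
  | bot : Bounded bot
  | and {φ ψ : Fml} : Bounded φ → Bounded ψ → Bounded (and φ ψ)
  | or {φ ψ : Fml} : Bounded φ → Bounded ψ → Bounded (or φ ψ)
  | imp {φ ψ : Fml} : Bounded φ → Bounded ψ → Bounded (imp φ ψ)
  | ball (a : ℕ) {φ : Fml} : Bounded φ → Bounded (ball a φ)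
  | bex (a : ℕ) {φ : Fml} : Bounded φ → Bounded (bex a φ)

/-- The Gödel number of a formula. -/
def code : Fml → ℕ
  | mem i j => Nat.pair 0 (Nat.pair i j)
  | eq i j => Nat.pair 1 (Nat.pair i j)
  | bot => Nat.pair 2 0
  | and φ ψ => Nat.pair 3 (Nat.pair (code φ) (code ψ))
  | or φ ψ => Nat.pair 4 (Nat.pair (code φ) (code ψ))
  | imp φ ψ => Nat.pair 5 (Nat.pair (code φ) (code ψ))
  | all φ => Nat.pair 6 (code φ)
  | ex φ => Nat.pair 7 (code φ)

theorem code_injective : Function.Injective code := by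
  intro φ
  induction φ with
  | mem i j => intro ψ h; cases ψ <;> simp_all [code]
  | eq i j => intro ψ h; cases ψ <;> simp_all [code]
  | bot => intro ψ h; cases ψ <;> simp_all [code]
  | and φ₁ φ₂ h₁ h₂ =>
    intro ψ h
    cases ψ <;> simp [code] at h
    exact congrArg₂ Fml.and (h₁ h.1) (h₂ h.2)
  | or φ₁ φ₂ h₁ h₂ =>
    intro ψ h
    cases ψ <;> simp [code] at h
    exact congrArg₂ Fml.or (h₁ h.1) (h₂ h.2)
  | imp φ₁ φ₂ h₁ h₂ =>
    intro ψ h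
    cases ψ <;> simp [code] at h
    exact congrArg₂ Fml.imp (h₁ h.1) (h₂ h.2)
  | all φ₁ h₁ =>
    intro ψ h
    cases ψ <;> simp [code] at h
    exact congrArg Fml.all (h₁ h)
  | ex φ₁ h₁ =>
    intro ψ h
    cases ψ <;> simp [code] at h
    exact congrArg Fml.ex (h₁ h)

end Fml

open Fml

/-- Natural deduction for intuitionistic first-order logic with equality: `Deriv T Γ φ` says
that `φ` is derivable from the axioms in `T` and the open assumptions in `Γ`.
Axioms are read universally: a free variable of an axiom (but not one of an assumption) may be
generalised, so an axiom with free variables amounts to its universal closure. -/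
inductive Deriv (T : Set Fml) : List Fml → Fml → Prop
  | ax {Γ : List Fml} {φ : Fml} : φ ∈ T → Deriv T Γ φ
  | hyp {Γ : List Fml} {φ : Fml} : φ ∈ Γ → Deriv T Γ φ
  | botE {Γ : List Fml} {φ : Fml} : Deriv T Γ bot → Deriv T Γ φ
  | andI {Γ : List Fml} {φ ψ : Fml} : Deriv T Γ φ → Deriv T Γ ψ → Deriv T Γ (and φ ψ)
  | andE₁ {Γ : List Fml} {φ ψ : Fml} : Deriv T Γ (and φ ψ) → Deriv T Γ φ
  | andE₂ {Γ : List Fml} {φ ψ : Fml} : Deriv T Γ (and φ ψ) → Deriv T Γ ψ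
  | orI₁ {Γ : List Fml} {φ ψ : Fml} : Deriv T Γ φ → Deriv T Γ (or φ ψ)
  | orI₂ {Γ : List Fml} {φ ψ : Fml} : Deriv T Γ ψ → Deriv T Γ (or φ ψ)
  | orE {Γ : List Fml} {φ ψ χ : Fml} :
      Deriv T Γ (or φ ψ) → Deriv T (φ :: Γ) χ → Deriv T (ψ :: Γ) χ → Deriv T Γ χ
  | impI {Γ : List Fml} {φ ψ : Fml} : Deriv T (φ :: Γ) ψ → Deriv T Γ (imp φ ψ)
  | impE {Γ : List Fml} {φ ψ : Fml} : Deriv T Γ (imp φ ψ) → Deriv T Γ φ → Deriv T Γ ψ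
  | allI {Γ : List Fml} {φ : Fml} : Deriv T (Γ.map shift) φ → Deriv T Γ (all φ)
  | allE {Γ : List Fml} {φ : Fml} (t : ℕ) : Deriv T Γ (all φ) → Deriv T Γ (φ.inst t)
  | exI {Γ : List Fml} {φ : Fml} (t : ℕ) : Deriv T Γ (φ.inst t) → Deriv T Γ (ex φ)
  | exE {Γ : List Fml} {φ ψ : Fml} :
      Deriv T Γ (ex φ) → Deriv T (φ :: Γ.map shift) ψ.shift → Deriv T Γ ψ
  | eqI {Γ : List Fml} (t : ℕ) : Deriv T Γ (eq t t)
  | eqE {Γ : List Fml} {φ : Fml} {s t : ℕ} :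
      Deriv T Γ (eq s t) → Deriv T Γ (φ.inst s) → Deriv T Γ (φ.inst t)

/-- `T ⊢ φ`. -/
def Provable (T : Set Fml) (φ : Fml) : Prop := Deriv T [] φ

def Consistent (T : Set Fml) : Prop := ¬ Provable T bot

/-- Every theorem of `S` is a theorem of `T`. -/
def Extends (T S : Set Fml) : Prop := ∀ φ : Fml, Provable S φ → Provable T φ

/-- `T` has the same theorems as some recursive set `A` of axioms. -/
def RecursivelyAxiomatisable (T : Set Fml) : Prop :=
  ∃ A : Set Fml, ComputablePred (fun n : ℕ => ∃ φ ∈ A, code φ = n) ∧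
    ∀ φ : Fml, Provable T φ ↔ Provable A φ

/-! ### Set-theoretic abbreviations

The arguments are variables (indices) of the surrounding context. -/

/-- `x = ∅`. -/
def isEmpty (x : ℕ) : Fml := all (neg (mem 0 (x + 1)))

/-- `x = y ∪ {y}`. -/
def isSucc (x y : ℕ) : Fml := all (iff (mem 0 (x + 1)) (or (mem 0 (y + 1)) (eq 0 (y + 1))))

/-- `w = ω`, the set of natural numbers: a set belongs to `w` iff it is `∅` or it is
`v ∪ {v}` for some `v ∈ w`. -/
def isOmega (w : ℕ) : Fml :=
  all (iff (mem 0 (w + 1)) (or (isEmpty 0) (bex (w + 1) (isSucc 1 0))))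

/-- `x = n̲`, the `n`-th von Neumann numeral. -/
def isNumeral : ℕ → ℕ → Fml
  | 0, x => isEmpty x
  | n + 1, x => ex (and (isNumeral n 0) (isSucc (x + 1) 0))

/-- `z = {a, b}`. -/
def isUPair (z a b : ℕ) : Fml := all (iff (mem 0 (z + 1)) (or (eq 0 (a + 1)) (eq 0 (b + 1))))

/-- `z = ⟨a, b⟩ = {{a}, {a, b}}`. -/
def isPair (z a b : ℕ) : Fml :=
  all (iff (mem 0 (z + 1)) (or (isUPair 0 (a + 1) (a + 1)) (isUPair 0 (a + 1) (b + 1))))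

/-- `c = a × b`. -/
def isProd (c a b : ℕ) : Fml :=
  all (iff (mem 0 (c + 1)) (bex (a + 1) (bex (b + 2) (isPair 2 1 0))))

/-- `⟨x, y⟩ ∈ f`, that is, `f(x) = y` if `f` is a function. -/
def maps (f x y : ℕ) : Fml := bex f (isPair 0 (x + 1) (y + 1))

/-- `f : a → b` is a function: `f` is a set of pairs `⟨x, y⟩` with `x ∈ a` and `y ∈ b`, and for
every `x ∈ a` there is a unique `y` with `⟨x, y⟩ ∈ f`. -/
def isFunction (f a b : ℕ) : Fml :=
  and (ball f (bex (a + 1) (bex (b + 2) (isPair 2 1 0))))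
    (ball a (bex (b + 1) (and (maps (f + 2) 1 0) (all (imp (maps (f + 3) 2 0) (eq 0 1))))))

/-- `f : a → b` is a bijection. -/
def isBijection (f a b : ℕ) : Fml :=
  and (isFunction f a b)
    (and (ball b (bex (a + 1) (maps (f + 2) 0 1)))
      (ball a (ball (a + 1) (ball (b + 2)
        (imp (and (maps (f + 3) 2 0) (maps (f + 3) 1 0)) (eq 2 1))))))

/-! ### The axioms of `CZF` -/

/-- `∀ a b, (∀ y, y ∈ a ↔ y ∈ b) → a = b`. -/
def extensionality : Fml := all (all (imp (all (iff (mem 0 2) (mem 0 1))) (eq 1 0)))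

/-- `∀ a b, ∃ x, x = {a, b}`. -/
def pairing : Fml := all (all (ex (isUPair 0 2 1)))

/-- `∀ a, ∃ x, ∀ y, y ∈ x ↔ ∃ z ∈ a, y ∈ z`. -/
def union : Fml := all (ex (all (iff (mem 0 1) (bex 2 (mem 1 0)))))

/-- `∃ w, w = ω`. -/
def infinity : Fml := ex (isOmega 0)

/-- `(∀ a, (∀ x ∈ a, φ(x)) → φ(a)) → ∀ a, φ(a)`.
In `φ`, the index `0` is the distinguished variable and the others are parameters. -/
def setInduction (φ : Fml) : Fml :=
  imp (all (imp (ball 0 (φ.rename (fun n => match n with | 0 => 0 | k + 1 => k + 2))) φ)) (all φ)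

/-- `∀ a, ∃ x, ∀ y, y ∈ x ↔ (y ∈ a ∧ φ(y, a))`.
In `φ`, the indices `0, 1` are `y, a` and the others are parameters. -/
def separation (φ : Fml) : Fml :=
  all (ex (all (iff (mem 0 1)
    (and (mem 0 2) (φ.rename (fun n => match n with | 0 => 0 | k + 1 => k + 2))))))

/-- `∀ a, (∀ x ∈ a, ∃ y, φ(x, y, a)) →
  ∃ b, (∀ x ∈ a, ∃ y ∈ b, φ(x, y, a)) ∧ (∀ y ∈ b, ∃ x ∈ a, φ(x, y, a))`.
In `φ`, the indices `0, 1, 2` are `y, x, a` and the others are parameters. -/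
def strongCollection (φ : Fml) : Fml :=
  all (imp (ball 0 (ex φ))
    (ex (and
      (ball 1 (bex 1
        (φ.rename (fun n => match n with | 0 => 0 | 1 => 1 | k + 2 => k + 3))))
      (ball 0 (bex 2
        (φ.rename (fun n => match n with | 0 => 1 | 1 => 0 | k + 2 => k + 3)))))))

/-- `∀ a b, ∃ c, ∀ u, (∀ x ∈ a, ∃ y ∈ b, φ(x, y, u)) →
  ∃ d ∈ c, (∀ x ∈ a, ∃ y ∈ d, φ(x, y, u)) ∧ (∀ y ∈ d, ∃ x ∈ a, φ(x, y, u))`.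
In `φ`, the indices `0, 1, 2` are `y, x, u`, the indices `3, 4` are `b, a`, and the others are
parameters. -/
def subsetCollection (φ : Fml) : Fml :=
  all (all (ex (all (imp
    (ball 3 (bex 3
      (φ.rename (fun n => match n with | 0 => 0 | 1 => 1 | 2 => 2 | k + 3 => k + 4))))
    (bex 1 (and
      (ball 4 (bex 1
        (φ.rename (fun n => match n with | 0 => 0 | 1 => 1 | 2 => 3 | k + 3 => k + 5))))
      (ball 0 (bex 5
        (φ.rename (fun n => match n with | 0 => 1 | 1 => 0 | 2 => 3 | k + 3 => k + 5))))))))))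

/-- The axioms of constructive Zermelo-Fraenkel set theory `CZF`. -/
inductive CZF : Set Fml
  | extensionality : CZF extensionality
  | pairing : CZF pairing
  | union : CZF union
  | infinity : CZF infinity
  | setInduction (φ : Fml) : CZF (setInduction φ)
  | separation (φ : Fml) : Bounded φ → CZF (separation φ)
  | strongCollection (φ : Fml) : CZF (strongCollection φ)
  | subsetCollection (φ : Fml) : CZF (subsetCollection φ)

/-- The axiom `LLPO_∞`: for every bijective pairing function `p : ω × ω → ω` and every
`α : ω → 2` such that `α(i) = 1` for at most one `i ∈ ω`, there is `k ∈ ω` such that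
`α(p(k, n)) = 0` for all `n ∈ ω`.
The five outer quantifiers bind `ω` (index `4`), the numeral `2` (index `3`), the set `ω × ω`
(index `2`), `p` (index `1`) and `α` (index `0`). -/
def LLPOInfty : Fml :=
  all (all (all (all (all
    (imp (isOmega 4) (imp (isNumeral 2 3) (imp (isProd 2 4 4) (imp (isBijection 1 2 4)
      (imp (isFunction 0 4 3)
        (imp
          -- for `i, j ∈ ω` (indices `1, 0`): if `α(i) = 1` and `α(j) = 1`, then `i = j`
          (ball 4 (ball 5
            (imp (and (ex (and (isNumeral 1 0) (maps 3 2 0)))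
                (ex (and (isNumeral 1 0) (maps 3 1 0))))
              (eq 1 0))))
          -- for `k, n` (indices `1, 0`) there are `z = ⟨k, n⟩` and `m = p(z)` with `α(m) = 0`
          (bex 4 (ball 5
            (ex (and (isPair 0 2 1)
              (ex (and (maps 5 1 0)
                (ex (and (isNumeral 0 0) (maps 5 1 0)))))))))))))))))))

/-- `(∃ x ∈ ℕ) φ(x)`, where `x` has index `0` in `φ`. -/
def exNat (φ : Fml) : Fml := ex (and (ex (and (isOmega 0) (mem 1 0))) φ)

/-- `φ(n̲)`, where the argument has index `0` in `φ`. As the language has no constants, `φ(n̲)`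
is the formula `∃ x, x = n̲ ∧ φ(x)`. -/
def atNumeral (φ : Fml) (n : ℕ) : Fml := ex (and (isNumeral n 0) φ)

/-- The numerical existence property: whenever `T ⊢ (∃ x ∈ ℕ) φ(x)`, for a formula `φ(x)` with
at most the variable `x` free, then `T ⊢ φ(n̲)` for some natural number `n`. -/
def NumericalExistenceProperty (T : Set Fml) : Prop :=
  ∀ φ : Fml, FreeBelow 1 φ → Provable T (exNat φ) → ∃ n : ℕ, Provable T (atNumeral φ n)

end SetTheory

/-!
The proof is a diagonal argument. Let `U ⟨e, n⟩` be `k + 1` if the program number `e`, applied to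
`e`, outputs `k` within `n` steps, and `0` if there is no output within `n` steps (`selfEval`). For
a given `e`, the relation "`n` is the first number with `U ⟨e, n⟩ ≠ 0`, and `U ⟨e, n⟩ = k + 1`"
(`firstHit`) is decidable and holds for at most one pair `(k, n)`. So `LLPO_∞`, applied to its
characteristic function, gives a `k` such that the relation fails for all `n`
(`exists_no_firstHit`): some `k` is not the output of the program. Intuitively `LLPO_∞` finds such
a `k` without deciding whether the program halts.

If `T` had the numerical existence property, then for every `e` there would be a numeral `k` for
which `T` proves that it is not the output of the program number `e` on `e`. As the theorems of `T`
are recursively enumerable (`exists_enumeration_provable`), some program `c` computes such a `k`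
from `e` by a search through the derivations. Applied to its own number, `c` halts with an output
`k` of which `T` proves that it is not this output. But `CZF` proves the true computation of `c`
(`firstHit_num`), so `T` is inconsistent (`not_provable_noHitAt`).

The proofs inside `CZF` are not written as formal derivations. By the completeness of Kripke
semantics, in the form of the canonical model of a theory (`provable_of_forces`), it is enough to
see that a sentence is forced at all worlds of a Kripke structure that forces the axioms of `CZF`
(`IsModel`), and there the elementary theory of `ω` can be developed. Functions on `ω` are defined
by recursion through their finite histories. Codes of pairs come from an enumeration of `ω × ω`
which imitates `Nat.unpair` and is definable by recursion without arithmetic; it also provides the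
bijective pairing that `LLPO_∞` asks for. On this basis all primitive recursive functions, among
them `U`, are represented in `CZF` (`exists_represents`).

For the enumeration of the theorems, derivability is described by finitely many rules on Gödel
numbers, including rules that compute substitutions (`rules`). The closure of a recursively
enumerable set under finitely many such rules is recursively enumerable
(`exists_enumeration_closure`).
-/

namespace SetTheory

/-! ### Renaming and free variables -/

namespace Fml

/-- `Occ n φ`: the variable `n` occurs free in `φ`. -/
def Occ : ℕ → Fml → Prop
  | n, mem i j => n = i ∨ n = j
  | n, eq i j => n = i ∨ n = j
  | _, bot => False
  | n, and φ ψ => Occ n φ ∨ Occ n ψ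
  | n, or φ ψ => Occ n φ ∨ Occ n ψ
  | n, imp φ ψ => Occ n φ ∨ Occ n ψ
  | n, all φ => Occ (n + 1) φ
  | n, ex φ => Occ (n + 1) φ

theorem freeBelow_iff_occ (φ : Fml) : ∀ k, FreeBelow k φ ↔ ∀ n, Occ n φ → n < k := by
  have key : ∀ (φ : Fml) (k : ℕ),
      (∀ n, Occ n φ → n < k + 1) ↔ ∀ n, Occ (n + 1) φ → n < k := by
    intro φ k
    constructor
    · intro h n hn
      have := h _ hn
      omega
    · intro h n hn
      cases n with
      | zero => omega
      | succ n => have := h n hn; omega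
  induction φ with
  | mem i j => intro k; simp [FreeBelow, Occ]
  | eq i j => intro k; simp [FreeBelow, Occ]
  | bot => intro k; simp [FreeBelow, Occ]
  | and φ ψ h₁ h₂ => intro k; simp only [FreeBelow, Occ, h₁, h₂, or_imp, forall_and]
  | or φ ψ h₁ h₂ => intro k; simp only [FreeBelow, Occ, h₁, h₂, or_imp, forall_and]
  | imp φ ψ h₁ h₂ => intro k; simp only [FreeBelow, Occ, h₁, h₂, or_imp, forall_and]
  | all φ h => intro k; simp only [FreeBelow, Occ, h, key]
  | ex φ h => intro k; simp only [FreeBelow, Occ, h, key]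

theorem exists_bound_occ (φ : Fml) : ∃ k, ∀ n, Occ n φ → n < k := by
  induction φ with
  | mem i j => exact ⟨i + j + 1, fun n h => by rcases h with h | h <;> omega⟩
  | eq i j => exact ⟨i + j + 1, fun n h => by rcases h with h | h <;> omega⟩
  | bot => exact ⟨0, fun n h => h.elim⟩
  | and φ ψ h₁ h₂ | or φ ψ h₁ h₂ | imp φ ψ h₁ h₂ =>
    obtain ⟨a, ha⟩ := h₁
    obtain ⟨b, hb⟩ := h₂
    exact ⟨a + b, fun n h => by
      rcases h with h | h
      · have := ha n h; omega
      · have := hb n h; omega⟩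
  | all φ h | ex φ h =>
    obtain ⟨a, ha⟩ := h
    exact ⟨a, fun n h => by have := ha _ h; omega⟩

theorem rename_congr {φ : Fml} : ∀ {ρ σ : ℕ → ℕ}, (∀ n, Occ n φ → ρ n = σ n) →
    rename ρ φ = rename σ φ := by
  have key : ∀ {φ : Fml} {ρ σ : ℕ → ℕ}, (∀ n, Occ (n + 1) φ → ρ n = σ n) →
      ∀ n, Occ n φ → liftRen ρ n = liftRen σ n := by
    intro φ ρ σ h n hn
    cases n with
    | zero => rfl
    | succ n => simp [liftRen, h n hn]
  induction φ with
  | mem i j => intro ρ σ h; simp [rename, h i (Or.inl rfl), h j (Or.inr rfl)]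
  | eq i j => intro ρ σ h; simp [rename, h i (Or.inl rfl), h j (Or.inr rfl)]
  | bot => intro ρ σ h; rfl
  | and φ ψ h₁ h₂ | or φ ψ h₁ h₂ | imp φ ψ h₁ h₂ =>
    intro ρ σ h
    simp only [rename, h₁ (fun n hn => h n (Or.inl hn)), h₂ (fun n hn => h n (Or.inr hn))]
  | all φ ih | ex φ ih => intro ρ σ h; simp only [rename, ih (key h)]

theorem liftRen_comp (σ ρ : ℕ → ℕ) : liftRen σ ∘ liftRen ρ = liftRen (σ ∘ ρ) := by
  funext n
  cases n <;> rfl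

theorem liftRen_id : liftRen id = id := by
  funext n
  cases n <;> rfl

theorem rename_rename (φ : Fml) : ∀ σ ρ : ℕ → ℕ,
    rename σ (rename ρ φ) = rename (σ ∘ ρ) φ := by
  induction φ with
  | mem i j | eq i j | bot => intros; rfl
  | and φ ψ h₁ h₂ | or φ ψ h₁ h₂ | imp φ ψ h₁ h₂ => intro σ ρ; simp only [rename, h₁, h₂]
  | all φ h | ex φ h => intro σ ρ; simp only [rename, h, liftRen_comp]

theorem rename_id (φ : Fml) : rename id φ = φ := by
  induction φ with
  | mem i j | eq i j | bot => rfl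
  | and φ ψ h₁ h₂ | or φ ψ h₁ h₂ | imp φ ψ h₁ h₂ => simp only [rename, h₁, h₂]
  | all φ h | ex φ h => simp only [rename, liftRen_id, h]

theorem rename_eq_self {φ : Fml} {ρ : ℕ → ℕ} (h : ∀ n, Occ n φ → ρ n = n) : rename ρ φ = φ :=
  (rename_congr (σ := id) h).trans (rename_id φ)

theorem occ_rename {φ : Fml} : ∀ {ρ : ℕ → ℕ} {m : ℕ},
    Occ m (rename ρ φ) ↔ ∃ n, Occ n φ ∧ ρ n = m := by
  have key : ∀ {φ : Fml} {ρ : ℕ → ℕ} {m : ℕ},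
      (∃ n, Occ n φ ∧ liftRen ρ n = m + 1) ↔ ∃ n, Occ (n + 1) φ ∧ ρ n = m := by
    intro φ ρ m
    constructor
    · rintro ⟨n, hn, h⟩
      cases n with
      | zero => simp [liftRen] at h
      | succ n => exact ⟨n, hn, by simpa [liftRen] using h⟩
    · rintro ⟨n, hn, h⟩
      exact ⟨n + 1, hn, by simp [liftRen, h]⟩
  induction φ with
  | mem i j | eq i j =>
    intro ρ m
    simp only [rename, Occ, or_and_right, exists_or, exists_eq_left]
    constructor <;> (rintro (h | h) <;> simp [h])
  | bot => intro ρ m; simp [rename, Occ]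
  | and φ ψ h₁ h₂ | or φ ψ h₁ h₂ | imp φ ψ h₁ h₂ =>
    intro ρ m
    simp only [rename, Occ, h₁, h₂, or_and_right, exists_or]
  | all φ h | ex φ h => intro ρ m; simp only [rename, Occ, h, key]

/-- The renaming which underlies `inst`. -/
def instRen (t : ℕ) : ℕ → ℕ
  | 0 => t
  | k + 1 => k

theorem inst_eq (φ : Fml) (t : ℕ) : φ.inst t = rename (instRen t) φ := by
  unfold inst
  congr 1

theorem rename_inst (φ : Fml) (ρ : ℕ → ℕ) (t : ℕ) :
    rename ρ (φ.inst t) = (rename (liftRen ρ) φ).inst (ρ t) := by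
  rw [inst_eq, inst_eq, rename_rename, rename_rename]
  congr 1
  funext n
  cases n <;> rfl

theorem rename_shift (φ : Fml) (ρ : ℕ → ℕ) :
    rename (liftRen ρ) φ.shift = (rename ρ φ).shift := by
  rw [shift, shift, rename_rename, rename_rename]
  rfl

theorem occ_inst {φ : Fml} {t m : ℕ} (h : Occ m (φ.inst t)) : m = t ∨ Occ (m + 1) φ := by
  rw [inst_eq, occ_rename] at h
  obtain ⟨n, hn, rfl⟩ := h
  cases n with
  | zero => exact Or.inl rfl
  | succ n => exact Or.inr hn

end Fml

/-! ### Admissible rules of the calculus -/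

open Fml

theorem Deriv.weaken {T : Set Fml} {Γ : List Fml} {φ : Fml} (h : Deriv T Γ φ) :
    ∀ {Δ : List Fml}, Γ ⊆ Δ → Deriv T Δ φ := by
  induction h with
  | ax h => intro Δ _; exact .ax h
  | hyp h => intro Δ hs; exact .hyp (hs h)
  | botE _ ih => intro Δ hs; exact .botE (ih hs)
  | andI _ _ ih₁ ih₂ => intro Δ hs; exact .andI (ih₁ hs) (ih₂ hs)
  | andE₁ _ ih => intro Δ hs; exact .andE₁ (ih hs)
  | andE₂ _ ih => intro Δ hs; exact .andE₂ (ih hs)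
  | orI₁ _ ih => intro Δ hs; exact .orI₁ (ih hs)
  | orI₂ _ ih => intro Δ hs; exact .orI₂ (ih hs)
  | orE _ _ _ ih ih₁ ih₂ =>
    intro Δ hs
    exact .orE (ih hs) (ih₁ (List.cons_subset_cons _ hs)) (ih₂ (List.cons_subset_cons _ hs))
  | impI _ ih => intro Δ hs; exact .impI (ih (List.cons_subset_cons _ hs))
  | impE _ _ ih₁ ih₂ => intro Δ hs; exact .impE (ih₁ hs) (ih₂ hs)
  | allI _ ih => intro Δ hs; exact .allI (ih (List.map_subset _ hs))
  | allE t _ ih => intro Δ hs; exact .allE t (ih hs)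
  | exI t _ ih => intro Δ hs; exact .exI t (ih hs)
  | exE _ _ ih₁ ih₂ =>
    intro Δ hs
    exact .exE (ih₁ hs) (ih₂ (List.cons_subset_cons _ (List.map_subset _ hs)))
  | eqI t => intro Δ _; exact .eqI t
  | eqE _ _ ih₁ ih₂ => intro Δ hs; exact .eqE (ih₁ hs) (ih₂ hs)

/-- The theorems of a theory are closed under substitution: generalise all free variables and
instantiate the quantifiers again. -/
theorem Provable.rename {T : Set Fml} {φ : Fml} (h : Provable T φ) (ρ : ℕ → ℕ) :
    Provable T (φ.rename ρ) := by
  have key : ∀ (k : ℕ) (φ : Fml), FreeBelow k φ → Provable T φ → ∀ ρ : ℕ → ℕ,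
      Provable T (φ.rename ρ) := by
    intro k
    induction k with
    | zero =>
      intro φ hφ h ρ
      rw [rename_eq_self]
      · exact h
      · intro n hn
        exact absurd ((freeBelow_iff_occ φ 0).1 hφ n hn) (Nat.not_lt_zero _)
    | succ k ih =>
      intro φ hφ h ρ
      have h₁ : Provable T (all φ) := Deriv.allI (Γ := []) h
      have h₂ := Deriv.allE (ρ 0) (ih (all φ) hφ h₁ (fun n => ρ (n + 1)))
      rw [inst_eq, rename_rename] at h₂
      have hρ : (instRen (ρ 0) ∘ liftRen fun n => ρ (n + 1)) = ρ := by
        funext n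
        cases n <;> rfl
      rwa [hρ] at h₂
  obtain ⟨k, hk⟩ := exists_bound_occ φ
  exact key k φ ((freeBelow_iff_occ φ k).2 hk) h ρ

theorem Deriv.rename {T : Set Fml} {Γ : List Fml} {φ : Fml} (h : Deriv T Γ φ) :
    ∀ ρ : ℕ → ℕ, Deriv T (Γ.map (Fml.rename ρ)) (φ.rename ρ) := by
  have hmap : ∀ (Γ : List Fml) (ρ : ℕ → ℕ), (Γ.map shift).map (Fml.rename (liftRen ρ)) =
      (Γ.map (Fml.rename ρ)).map shift := by
    intro Γ ρ
    simp [rename_shift]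
  induction h with
  | ax h => intro ρ; exact Deriv.weaken (Provable.rename (.ax h) ρ) (List.nil_subset _)
  | hyp h => intro ρ; exact .hyp (List.mem_map_of_mem h)
  | botE _ ih => intro ρ; exact .botE (ih ρ)
  | andI _ _ ih₁ ih₂ => intro ρ; exact .andI (ih₁ ρ) (ih₂ ρ)
  | andE₁ _ ih => intro ρ; exact .andE₁ (ih ρ)
  | andE₂ _ ih => intro ρ; exact .andE₂ (ih ρ)
  | orI₁ _ ih => intro ρ; exact .orI₁ (ih ρ)
  | orI₂ _ ih => intro ρ; exact .orI₂ (ih ρ)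
  | orE _ _ _ ih ih₁ ih₂ => intro ρ; exact .orE (ih ρ) (ih₁ ρ) (ih₂ ρ)
  | impI _ ih => intro ρ; exact .impI (ih ρ)
  | impE _ _ ih₁ ih₂ => intro ρ; exact .impE (ih₁ ρ) (ih₂ ρ)
  | allI _ ih =>
    intro ρ
    have := ih (liftRen ρ)
    rw [hmap] at this
    exact .allI this
  | allE t _ ih => intro ρ; rw [rename_inst]; exact .allE (ρ t) (ih ρ)
  | exI t _ ih =>
    intro ρ
    have := ih ρ
    rw [rename_inst] at this
    exact .exI (ρ t) this
  | exE _ _ ih₁ ih₂ =>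
    intro ρ
    have := ih₂ (liftRen ρ)
    rw [List.map_cons, hmap, rename_shift] at this
    exact .exE (ih₁ ρ) this
  | eqI t => intro ρ; exact .eqI (ρ t)
  | @eqE Γ φ s t _ _ ih₁ ih₂ =>
    intro ρ
    have := ih₂ ρ
    rw [rename_inst] at this ⊢
    exact .eqE (ih₁ ρ) this

/-- `φ` is derivable in `T` from finitely many assumptions taken from `S`. -/
def Entails (T S : Set Fml) (φ : Fml) : Prop := ∃ Γ : List Fml, (∀ γ ∈ Γ, γ ∈ S) ∧ Deriv T Γ φ

namespace Entails

variable {T S S' : Set Fml} {φ ψ χ : Fml}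

theorem mono (h : Entails T S φ) (hS : S ⊆ S') : Entails T S' φ := by
  obtain ⟨Γ, h₁, h₂⟩ := h
  exact ⟨Γ, fun γ hγ => hS (h₁ γ hγ), h₂⟩

theorem of_mem (h : φ ∈ S) : Entails T S φ := ⟨[φ], by simpa using h, .hyp (by simp)⟩

theorem of_provable (h : Provable T φ) : Entails T S φ := ⟨[], by simp, h⟩

theorem map (f : ∀ Γ, Deriv T Γ φ → Deriv T Γ ψ) (h : Entails T S φ) : Entails T S ψ := by
  obtain ⟨Γ, h₁, h₂⟩ := h
  exact ⟨Γ, h₁, f Γ h₂⟩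

theorem map₂ (f : ∀ Γ, Deriv T Γ φ → Deriv T Γ ψ → Deriv T Γ χ) (h : Entails T S φ)
    (h' : Entails T S ψ) : Entails T S χ := by
  obtain ⟨Γ, h₁, h₂⟩ := h
  obtain ⟨Δ, h₃, h₄⟩ := h'
  refine ⟨Γ ++ Δ, fun γ hγ => ?_, f _ (h₂.weaken (by simp)) (h₄.weaken (by simp))⟩
  rcases List.mem_append.1 hγ with h | h
  · exact h₁ γ h
  · exact h₃ γ h

theorem exists_list (h : Entails T (insert φ S) ψ) :
    ∃ Γ : List Fml, (∀ γ ∈ Γ, γ ∈ S) ∧ Deriv T (φ :: Γ) ψ := by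
  classical
  obtain ⟨Γ, h₁, h₂⟩ := h
  refine ⟨Γ.filter (· ≠ φ), fun γ hγ => ?_, h₂.weaken fun γ hγ => ?_⟩
  · have := List.mem_filter.1 hγ
    exact (h₁ γ this.1).resolve_left (by simpa using this.2)
  · by_cases h : γ = φ
    · simp [h]
    · simp [h, hγ]

theorem impI (h : Entails T (insert φ S) ψ) : Entails T S (imp φ ψ) := by
  obtain ⟨Γ, h₁, h₂⟩ := h.exists_list
  exact ⟨Γ, h₁, .impI h₂⟩

theorem cut (h : Entails T (insert φ S) ψ) (h' : Entails T S φ) : Entails T S ψ :=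
  map₂ (fun _ => .impE) h.impI h'

/-- A variable that does not occur in the assumptions may be generalised. -/
theorem allI_fresh {c : ℕ} (hS : ∀ γ ∈ S, ¬ Occ c γ) (hφ : ¬ Occ c (all φ))
    (h : Entails T S (φ.inst c)) : Entails T S (all φ) := by
  obtain ⟨Γ, h₁, h₂⟩ := h
  let σ : ℕ → ℕ := fun n => if n = c then 0 else n + 1
  refine ⟨Γ, h₁, .allI ?_⟩
  have h₃ := h₂.rename σ
  rw [inst_eq, rename_rename, rename_eq_self] at h₃
  · convert h₃ using 1
    refine List.map_congr_left fun γ hγ => rename_congr fun n hn => ?_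
    have : n ≠ c := by rintro rfl; exact hS γ (h₁ γ hγ) hn
    simp [σ, this]
  · intro n hn
    cases n with
    | zero => simp [σ, instRen]
    | succ n =>
      have : n ≠ c := by rintro rfl; exact hφ hn
      simp [σ, instRen, this]

/-- A fresh variable may serve as a witness of an existential statement. -/
theorem exE_fresh {c : ℕ} (hS : ∀ γ ∈ S, ¬ Occ c γ) (hφ : ¬ Occ c (ex φ)) (hψ : ¬ Occ c ψ)
    (h : Entails T S (ex φ)) (h' : Entails T (insert (φ.inst c) S) ψ) : Entails T S ψ := by
  have hi := h'.impI
  have ha : Entails T S (all (imp φ ψ.shift)) := by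
    refine allI_fresh hS (φ := imp φ ψ.shift) (c := c) ?_ ?_
    · rintro (hn | hn)
      · exact hφ hn
      · rw [shift, occ_rename] at hn
        obtain ⟨n, hn, hnc⟩ := hn
        exact hψ (Nat.succ_injective hnc ▸ hn)
    · convert hi using 1
      change imp (φ.inst c) (ψ.shift.inst c) = _
      rw [shift, inst_eq (Fml.rename Nat.succ ψ), rename_rename]
      congr 1
      exact rename_eq_self fun n _ => rfl
  refine map₂ (fun Γ h₁ h₂ => ?_) h ha
  refine .exE h₁ ?_
  have h₃ := h₂.rename Nat.succ
  have h₄ := (Deriv.allE 0 h₃).weaken (List.subset_cons_self φ _)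
  have h₅ : (Fml.rename (liftRen Nat.succ) (imp φ ψ.shift)).inst 0 = imp φ ψ.shift := by
    rw [inst_eq, rename_rename]
    refine rename_eq_self fun n _ => ?_
    cases n <;> rfl
  rw [h₅] at h₄
  exact .impE h₄ (.hyp (by simp))

end Entails

/-! ### Kripke models -/

/-- The data of a Kripke structure for the language of set theory: a domain, a membership
relation and an equality relation at every world, all of them increasing. Equality is only
required to be a congruence. -/
structure KFrame (W X : Type) [Preorder W] where
  /-- `D w x`: the object `x` exists at the world `w`. -/
  D : W → X → Prop
  /-- Membership at the world `w`. -/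
  E : W → X → X → Prop
  /-- Equality at the world `w`. -/
  Q : W → X → X → Prop
  D_mono : ∀ {w v x}, w ≤ v → D w x → D v x
  E_mono : ∀ {w v x y}, w ≤ v → E w x y → E v x y
  Q_mono : ∀ {w v x y}, w ≤ v → Q w x y → Q v x y
  E_left : ∀ {w x y}, E w x y → D w x
  E_right : ∀ {w x y}, E w x y → D w y
  Q_refl : ∀ {w x}, D w x → Q w x x
  Q_symm : ∀ {w x y}, Q w x y → Q w y x
  Q_trans : ∀ {w x y z}, Q w x y → Q w y z → Q w x z
  E_congr : ∀ {w x x' y y'}, Q w x x' → Q w y y' → E w x y → E w x' y'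

/-- Extension of an assignment by a value for the variable `0`. -/
def cons {X : Type} (d : X) (ρ : ℕ → X) : ℕ → X
  | 0 => d
  | n + 1 => ρ n

theorem comp_liftRen {X : Type} (d : X) (ρ : ℕ → X) (σ : ℕ → ℕ) :
    cons d ρ ∘ liftRen σ = cons d (ρ ∘ σ) := by
  funext n
  cases n <;> rfl

namespace KFrame

variable {W X : Type} [Preorder W] (K : KFrame W X)

/-- Kripke forcing. -/
def Forces : W → Fml → (ℕ → X) → Prop
  | w, .mem i j, ρ => K.E w (ρ i) (ρ j)
  | w, .eq i j, ρ => K.Q w (ρ i) (ρ j)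
  | _, .bot, _ => False
  | w, .and φ ψ, ρ => Forces w φ ρ ∧ Forces w ψ ρ
  | w, .or φ ψ, ρ => Forces w φ ρ ∨ Forces w ψ ρ
  | w, .imp φ ψ, ρ => ∀ v, w ≤ v → Forces v φ ρ → Forces v ψ ρ
  | w, .all φ, ρ => ∀ v, w ≤ v → ∀ d, K.D v d → Forces v φ (cons d ρ)
  | w, .ex φ, ρ => ∃ d, K.D w d ∧ Forces w φ (cons d ρ)

variable {K}

theorem Forces.mono {φ : Fml} : ∀ {w v : W} {ρ : ℕ → X}, w ≤ v → K.Forces w φ ρ →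
    K.Forces v φ ρ := by
  induction φ with
  | mem i j => intro w v ρ h h'; exact K.E_mono h h'
  | eq i j => intro w v ρ h h'; exact K.Q_mono h h'
  | bot => intro w v ρ h h'; exact h'
  | and φ ψ h₁ h₂ => intro w v ρ h h'; exact ⟨h₁ h h'.1, h₂ h h'.2⟩
  | or φ ψ h₁ h₂ => intro w v ρ h h'; exact h'.imp (h₁ h) (h₂ h)
  | imp φ ψ h₁ h₂ => intro w v ρ h h' u hu; exact h' u (h.trans hu)
  | all φ ih => intro w v ρ h h' u hu; exact h' u (h.trans hu)
  | ex φ ih =>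
    intro w v ρ h h'
    obtain ⟨d, hd, h'⟩ := h'
    exact ⟨d, K.D_mono h hd, ih h h'⟩

theorem forces_rename {φ : Fml} : ∀ {w : W} {σ : ℕ → ℕ} {ρ : ℕ → X},
    K.Forces w (φ.rename σ) ρ ↔ K.Forces w φ (ρ ∘ σ) := by
  induction φ with
  | mem i j | eq i j | bot => intros; exact Iff.rfl
  | and φ ψ h₁ h₂ | or φ ψ h₁ h₂ | imp φ ψ h₁ h₂ =>
    intro w σ ρ; simp only [rename, Forces, h₁, h₂]
  | all φ h | ex φ h => intro w σ ρ; simp only [rename, Forces, h, comp_liftRen]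

theorem Forces.congr {φ : Fml} : ∀ {w : W} {ρ σ : ℕ → X}, (∀ n, K.Q w (ρ n) (σ n)) →
    K.Forces w φ ρ → K.Forces w φ σ := by
  have hcons : ∀ {w : W} {ρ σ : ℕ → X} {d : X}, K.D w d → (∀ n, K.Q w (ρ n) (σ n)) →
      ∀ n, K.Q w (cons d ρ n) (cons d σ n) := by
    intro w ρ σ d hd h n
    cases n with
    | zero => exact K.Q_refl hd
    | succ n => exact h n
  induction φ with
  | mem i j => intro w ρ σ h h'; exact K.E_congr (h i) (h j) h'
  | eq i j => intro w ρ σ h h'; exact K.Q_trans (K.Q_trans (K.Q_symm (h i)) h') (h j)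
  | bot => intro w ρ σ h h'; exact h'
  | and φ ψ h₁ h₂ => intro w ρ σ h h'; exact ⟨h₁ h h'.1, h₂ h h'.2⟩
  | or φ ψ h₁ h₂ => intro w ρ σ h h'; exact h'.imp (h₁ h) (h₂ h)
  | imp φ ψ h₁ h₂ =>
    intro w ρ σ h h' v hv hφ
    have hQ : ∀ n, K.Q v (ρ n) (σ n) := fun n => K.Q_mono hv (h n)
    exact h₂ hQ (h' v hv (h₁ (fun n => K.Q_symm (hQ n)) hφ))
  | all φ ih =>
    intro w ρ σ h h' v hv d hd
    exact ih (hcons hd fun n => K.Q_mono hv (h n)) (h' v hv d hd)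
  | ex φ ih =>
    intro w ρ σ h h'
    obtain ⟨d, hd, h'⟩ := h'
    exact ⟨d, hd, ih (hcons hd h) h'⟩

end KFrame

/-! ### Completeness of Kripke semantics -/

/-- A world of the canonical model of `T`: a set of variables, which serve as the objects of the
world, and a consistent, prime, deductively closed set of formulas in these variables with the
witness property. Infinitely many variables are left over for the later worlds. -/
structure World (T : Set Fml) where
  /-- The variables that exist at the world. -/
  V : Set ℕ
  /-- The formulas that hold at the world. -/
  S : Set Fml
  coinf : Vᶜ.Infinite
  nonempty : V.Nonempty
  occ : ∀ φ ∈ S, ∀ n, Occ n φ → n ∈ V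
  closed : ∀ φ, (∀ n, Occ n φ → n ∈ V) → Entails T S φ → φ ∈ S
  not_bot : bot ∉ S
  prime : ∀ φ ψ, Fml.or φ ψ ∈ S → φ ∈ S ∨ ψ ∈ S
  witness : ∀ φ, ex φ ∈ S → ∃ c ∈ V, φ.inst c ∈ S

instance (T : Set Fml) : Preorder (World T) where
  le w v := w.V ⊆ v.V ∧ w.S ⊆ v.S
  le_refl _ := ⟨subset_rfl, subset_rfl⟩
  le_trans _ _ _ h h' := ⟨h.1.trans h'.1, h.2.trans h'.2⟩

/-- A coinfinite set of variables can be enlarged by infinitely many variables in such a way that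
infinitely many are still left over. -/
theorem exists_intermediate_coinfinite {V : Set ℕ} (hV : Vᶜ.Infinite) :
    ∃ V' : Set ℕ, V ⊆ V' ∧ V'ᶜ.Infinite ∧ (V' \ V).Infinite := by
  let e := hV.natEmbedding
  have he : Function.Injective fun n => ((e n : (Vᶜ : Set ℕ)) : ℕ) :=
    Subtype.val_injective.comp e.injective
  refine ⟨V ∪ Set.range (fun n => (e (2 * n) : ℕ)), Set.subset_union_left, ?_, ?_⟩
  · refine Set.Infinite.mono (s := Set.range fun n => (e (2 * n + 1) : ℕ)) ?_ ?_
    · rintro _ ⟨n, rfl⟩ (h | ⟨m, h⟩)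
      · exact (e (2 * n + 1)).2 h
      · have := he h
        omega
    · exact Set.infinite_range_of_injective fun a b h => by have := he h; omega
  · refine Set.Infinite.mono (s := Set.range fun n => (e (2 * n) : ℕ)) ?_ ?_
    · rintro _ ⟨n, rfl⟩
      exact ⟨Or.inr ⟨n, rfl⟩, (e (2 * n)).2⟩
    · exact Set.infinite_range_of_injective fun a b h => by have := he h; omega

theorem exists_fresh {U : Set ℕ} (hU : U.Infinite) (L : List Fml) :
    ∃ c ∈ U, ∀ γ ∈ L, ¬ Occ c γ := by
  have hb : ∃ k, ∀ γ ∈ L, ∀ n, Occ n γ → n < k := by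
    induction L with
    | nil => exact ⟨0, by simp⟩
    | cons γ L ih =>
      obtain ⟨a, ha⟩ := ih
      obtain ⟨b, hb⟩ := exists_bound_occ γ
      refine ⟨a + b, fun δ hδ n hn => ?_⟩
      rcases List.mem_cons.1 hδ with rfl | h
      · have := hb n hn; omega
      · have := ha δ h n hn; omega
  obtain ⟨k, hk⟩ := hb
  obtain ⟨c, hc, hkc⟩ := hU.exists_gt k
  exact ⟨c, hc, fun γ hγ h => absurd (hk γ hγ c h) (by omega)⟩

/-- Lindenbaum's lemma with Henkin witnesses: the formulas are decided one by one, and a new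
formula is accepted, together with a fresh witness if it is existential, as long as `χ` does
not become derivable. -/
theorem exists_world {T : Set Fml} {V : Set ℕ} {S : Set Fml} {χ : Fml} (hV : Vᶜ.Infinite)
    (hS : ∀ φ ∈ S, ∀ n, Occ n φ → n ∈ V) (h : ¬ Entails T S χ) :
    ∃ w : World T, V ⊆ w.V ∧ S ⊆ w.S ∧ χ ∉ w.S := by
  obtain ⟨V', hVV', hV', hinf⟩ := exists_intermediate_coinfinite hV
  have : Countable Fml := code_injective.countable
  have : Nonempty Fml := ⟨bot⟩
  obtain ⟨enum, henum⟩ := exists_surjective_nat Fml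
  -- the finite sets of formulas that may be accepted
  let Good : List Fml → Prop := fun Δ =>
    (∀ γ ∈ Δ, ∀ n, Occ n γ → n ∈ V') ∧ ¬ Entails T (S ∪ {γ | γ ∈ Δ}) χ
  have step : ∀ (φ : Fml) (Δ : List Fml), Good Δ → ∃ Δ' : List Fml, Good Δ' ∧ Δ ⊆ Δ' ∧
      ((∀ n, Occ n φ → n ∈ V') → Entails T (insert φ (S ∪ {γ | γ ∈ Δ})) χ ∨
        (φ ∈ Δ' ∧ ∀ ψ, φ = ex ψ → ∃ c ∈ V', ψ.inst c ∈ Δ')) := by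
    intro φ Δ hΔ
    by_cases hφ : ∀ n, Occ n φ → n ∈ V'
    swap
    · exact ⟨Δ, hΔ, List.Subset.refl _, fun h => absurd h hφ⟩
    by_cases hχφ : Entails T (insert φ (S ∪ {γ | γ ∈ Δ})) χ
    · exact ⟨Δ, hΔ, List.Subset.refl _, fun _ => Or.inl hχφ⟩
    have hset : ∀ (a : Fml) (Δ : List Fml),
        S ∪ {γ | γ ∈ a :: Δ} = insert a (S ∪ {γ | γ ∈ Δ}) := by
      intro a Δ; ext γ; simp; tauto
    have hgood : Good (φ :: Δ) := by
      refine ⟨fun γ hγ => ?_, by rwa [hset]⟩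
      rcases List.mem_cons.1 hγ with rfl | hγ
      · exact hφ
      · exact hΔ.1 γ hγ
    by_cases hex : ∃ ψ, φ = ex ψ
    swap
    · exact ⟨φ :: Δ, hgood, List.subset_cons_self _ _,
        fun _ => Or.inr ⟨by simp, fun ψ h => absurd ⟨ψ, h⟩ hex⟩⟩
    obtain ⟨ψ, rfl⟩ := hex
    obtain ⟨c, hc, hfresh⟩ := exists_fresh hinf (χ :: ex ψ :: Δ)
    refine ⟨ψ.inst c :: ex ψ :: Δ, ⟨fun γ hγ => ?_, ?_⟩, ?_, fun _ => Or.inr ⟨by simp, ?_⟩⟩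
    · rcases List.mem_cons.1 hγ with rfl | hγ
      · intro n hn
        rcases occ_inst hn with rfl | hn
        · exact hc.1
        · exact hφ n hn
      · exact hgood.1 γ hγ
    · rw [hset]
      intro hent
      refine hgood.2 (Entails.exE_fresh ?_ (hfresh (ex ψ) (by simp)) (hfresh χ (by simp))
        (Entails.of_mem (by simp)) hent)
      rintro γ (hγ | hγ)
      · exact fun hn => hc.2 (hS γ hγ c hn)
      · exact hfresh γ (List.mem_cons_of_mem _ hγ)
    · exact fun γ hγ => by simp [hγ]
    · intro ψ' h
      cases h
      exact ⟨c, hc.1, by simp⟩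
  choose next hnext using step
  -- the accepted formulas after `n` decisions
  let seq : ℕ → {Δ : List Fml // Good Δ} := fun n => Nat.rec
    ⟨[], by simpa [Good] using h⟩ (fun n Δ => ⟨next (enum n) Δ.1 Δ.2, (hnext _ _ Δ.2).1⟩) n
  have hmono : Monotone fun n => S ∪ {γ | γ ∈ (seq n).1} := by
    refine monotone_nat_of_le_succ fun n => ?_
    exact Set.union_subset_union_right _ (hnext (enum n) (seq n).1 (seq n).2).2.1
  let S' : Set Fml := ⋃ n, S ∪ {γ | γ ∈ (seq n).1}
  have hSeq : ∀ n, S ∪ {γ | γ ∈ (seq n).1} ⊆ S' := fun n =>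
    Set.subset_iUnion (s := fun n => S ∪ {γ | γ ∈ (seq n).1}) n
  have hcompact : ∀ φ, Entails T S' φ → ∃ n, Entails T (S ∪ {γ | γ ∈ (seq n).1}) φ := by
    rintro φ ⟨Γ, hΓ, hd⟩
    suffices hb : ∃ n, ∀ γ ∈ Γ, γ ∈ S ∪ {γ | γ ∈ (seq n).1} by
      obtain ⟨n, hn⟩ := hb
      exact ⟨n, Γ, hn, hd⟩
    clear hd
    induction Γ with
    | nil => exact ⟨0, by simp⟩
    | cons γ Γ ih =>
      obtain ⟨a, ha⟩ := ih fun δ hδ => hΓ δ (List.mem_cons_of_mem _ hδ)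
      obtain ⟨b, hb⟩ := Set.mem_iUnion.1 (hΓ γ (by simp))
      refine ⟨max a b, fun δ hδ => ?_⟩
      rcases List.mem_cons.1 hδ with rfl | hδ
      · exact hmono (le_max_right a b) hb
      · exact hmono (le_max_left a b) (ha δ hδ)
  have hχ' : ¬ Entails T S' χ := fun hent => by
    obtain ⟨n, hn⟩ := hcompact χ hent
    exact (seq n).2.2 hn
  have hdec : ∀ φ, (∀ n, Occ n φ → n ∈ V') → Entails T (insert φ S') χ ∨
      (φ ∈ S' ∧ ∀ ψ, φ = ex ψ → ∃ c ∈ V', ψ.inst c ∈ S') := by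
    intro φ hφ
    obtain ⟨n, rfl⟩ := henum φ
    have hsub : {γ | γ ∈ (seq (n + 1)).1} ⊆ S' := Set.subset_union_right.trans (hSeq (n + 1))
    rcases (hnext (enum n) (seq n).1 (seq n).2).2.2 hφ with h | ⟨h₁, h₂⟩
    · exact Or.inl (h.mono (Set.insert_subset_insert (hSeq n)))
    · refine Or.inr ⟨hsub h₁, fun ψ hψ => ?_⟩
      obtain ⟨c, hc, hcψ⟩ := h₂ ψ hψ
      exact ⟨c, hc, hsub hcψ⟩
  have hocc : ∀ φ ∈ S', ∀ n, Occ n φ → n ∈ V' := by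
    intro φ hφ n hn
    obtain ⟨m, hm | hm⟩ := Set.mem_iUnion.1 hφ
    · exact hVV' (hS φ hm n hn)
    · exact (seq m).2.1 φ hm n hn
  refine ⟨⟨V', S', hV', hinf.nonempty.mono Set.sdiff_subset, hocc, ?_, ?_, ?_, ?_⟩, hVV',
    fun φ hφ => hSeq 0 (Or.inl hφ), fun hc => hχ' (Entails.of_mem hc)⟩
  · intro φ hφ hent
    rcases hdec φ hφ with h | h
    · exact absurd (h.cut hent) hχ'
    · exact h.1
  · exact fun hb => hχ' ((Entails.of_mem hb).map fun _ => .botE)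
  · intro φ ψ hor
    rcases hdec φ fun n hn => hocc _ hor n (Or.inl hn) with h₁ | h₁
    · rcases hdec ψ fun n hn => hocc _ hor n (Or.inr hn) with h₂ | h₂
      · -- if both disjuncts were rejected, then `χ` would follow from the disjunction
        refine absurd ?_ hχ'
        obtain ⟨Γ₁, hΓ₁, hd₁⟩ := h₁.exists_list
        obtain ⟨Γ₂, hΓ₂, hd₂⟩ := h₂.exists_list
        refine ⟨Fml.or φ ψ :: (Γ₁ ++ Γ₂), fun γ hγ => ?_,
          Deriv.orE (φ := φ) (ψ := ψ) (.hyp (by simp)) (hd₁.weaken ?_) (hd₂.weaken ?_)⟩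
        · rcases List.mem_cons.1 hγ with rfl | hγ
          · exact hor
          · rcases List.mem_append.1 hγ with hγ | hγ
            · exact hΓ₁ γ hγ
            · exact hΓ₂ γ hγ
        · exact List.cons_subset_cons _ fun γ hγ => by simp [hγ]
        · exact List.cons_subset_cons _ fun γ hγ => by simp [hγ]
      · exact Or.inr h₂.1
    · exact Or.inl h₁.1
  · intro φ hex
    rcases hdec (ex φ) (hocc _ hex) with h | h
    · exact absurd (h.cut (Entails.of_mem hex)) hχ'
    · exact h.2 φ rfl

namespace World

variable {T : Set Fml}

/-- Equal variables may be replaced by each other in the formulas of a world. -/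
theorem subst (w : World T) {i j : ℕ} (φ : Fml) (hφ : ∀ n, Occ n (φ.inst j) → n ∈ w.V)
    (h : eq i j ∈ w.S) (h' : φ.inst i ∈ w.S) : φ.inst j ∈ w.S :=
  w.closed _ hφ (Entails.map₂ (fun _ => .eqE) (Entails.of_mem h) (Entails.of_mem h'))

end World

/-- The canonical Kripke structure of a theory. -/
def canonical (T : Set Fml) : KFrame (World T) ℕ where
  D w x := x ∈ w.V
  E w x y := mem x y ∈ w.S
  Q w x y := eq x y ∈ w.S
  D_mono h h' := h.1 h'
  E_mono h h' := h.2 h'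
  Q_mono h h' := h.2 h'
  E_left {w x _} h := w.occ _ h x (Or.inl rfl)
  E_right {w _ y} h := w.occ _ h y (Or.inr rfl)
  Q_refl {w x} h := w.closed _ (by rintro n (rfl | rfl) <;> exact h) ⟨[], by simp, .eqI x⟩
  Q_symm {w x y} h := by
    have hx := w.occ _ h x (Or.inl rfl)
    have hy := w.occ _ h y (Or.inr rfl)
    refine w.subst (i := x) (j := y) (eq 0 (x + 1)) ?_ h ?_
    · rintro n (rfl | rfl) <;> assumption
    · exact w.closed _ (by rintro n (rfl | rfl) <;> assumption) ⟨[], by simp, .eqI x⟩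
  Q_trans {w x y z} h h' := by
    have hx := w.occ _ h x (Or.inl rfl)
    have hz := w.occ _ h' z (Or.inr rfl)
    refine w.subst (i := y) (j := z) (eq (x + 1) 0) ?_ h' h
    rintro n (rfl | rfl) <;> assumption
  E_congr {w x x' y y'} hx hy h := by
    have hx' := w.occ _ hx x' (Or.inr rfl)
    have hyy := w.occ _ hy y (Or.inl rfl)
    have hy' := w.occ _ hy y' (Or.inr rfl)
    refine w.subst (i := y) (j := y') (mem (x' + 1) 0) ?_ hy ?_
    · rintro n (rfl | rfl) <;> assumption
    · refine w.subst (i := x) (j := x') (mem 0 (y + 1)) ?_ hx h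
      rintro n (rfl | rfl) <;> assumption

/-- At a world of the canonical model the forced formulas are those which belong to it. -/
theorem forces_canonical_iff {T : Set Fml} {φ : Fml} : ∀ {w : World T} {ρ : ℕ → ℕ},
    (∀ n, Occ n φ → ρ n ∈ w.V) → ((canonical T).Forces w φ ρ ↔ φ.rename ρ ∈ w.S) := by
  have hocc : ∀ {φ : Fml} {w : World T} {ρ : ℕ → ℕ}, (∀ n, Occ n φ → ρ n ∈ w.V) →
      ∀ n, Occ n (φ.rename ρ) → n ∈ w.V := by
    intro φ w ρ h n hn
    obtain ⟨m, hm, rfl⟩ := occ_rename.1 hn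
    exact h m hm
  have hcons : ∀ {φ : Fml} {w : World T} {ρ : ℕ → ℕ} {d : ℕ}, (∀ n, Occ (n + 1) φ → ρ n ∈ w.V) →
      d ∈ w.V → ∀ n, Occ n φ → cons d ρ n ∈ w.V := by
    intro φ w ρ d h hd n hn
    cases n with
    | zero => exact hd
    | succ n => exact h n hn
  have hinst : ∀ (φ : Fml) (ρ : ℕ → ℕ) (d : ℕ),
      (φ.rename (liftRen ρ)).inst d = φ.rename (cons d ρ) := by
    intro φ ρ d
    rw [inst_eq, rename_rename]
    congr 1
    funext n
    cases n <;> rfl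
  induction φ with
  | mem i j => intro w ρ _; exact Iff.rfl
  | eq i j => intro w ρ _; exact Iff.rfl
  | bot => intro w ρ _; exact ⟨False.elim, fun h => w.not_bot h⟩
  | and φ ψ h₁ h₂ =>
    intro w ρ h
    simp only [KFrame.Forces]
    rw [h₁ fun n hn => h n (Or.inl hn), h₂ fun n hn => h n (Or.inr hn)]
    constructor
    · rintro ⟨hφ, hψ⟩
      exact w.closed _ (hocc h)
        (Entails.map₂ (fun _ => .andI) (Entails.of_mem hφ) (Entails.of_mem hψ))
    · intro hand
      have := Entails.of_mem (T := T) hand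
      exact ⟨w.closed _ (hocc fun n hn => h n (Or.inl hn)) (this.map fun _ => .andE₁),
        w.closed _ (hocc fun n hn => h n (Or.inr hn)) (this.map fun _ => .andE₂)⟩
  | or φ ψ h₁ h₂ =>
    intro w ρ h
    simp only [KFrame.Forces]
    rw [h₁ fun n hn => h n (Or.inl hn), h₂ fun n hn => h n (Or.inr hn)]
    constructor
    · rintro (hφ | hψ)
      · exact w.closed _ (hocc h) ((Entails.of_mem hφ).map fun _ => .orI₁)
      · exact w.closed _ (hocc h) ((Entails.of_mem hψ).map fun _ => .orI₂)
    · exact w.prime _ _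
  | imp φ ψ h₁ h₂ =>
    intro w ρ h
    constructor
    · intro hf
      by_contra hn
      have hφ : ∀ n, Occ n (φ.rename ρ) → n ∈ w.V := hocc fun n hn => h n (Or.inl hn)
      obtain ⟨v, hV, hS, hv⟩ := exists_world (T := T) (S := insert (φ.rename ρ) w.S)
        (χ := ψ.rename ρ) w.coinf
        (by rintro γ (rfl | hγ); exacts [hφ, w.occ γ hγ])
        (fun hent => hn (w.closed _ (hocc h) hent.impI))
      have hle : w ≤ v := ⟨hV, (Set.subset_insert _ _).trans hS⟩
      refine hv ((h₂ fun n hn => hV (h n (Or.inr hn))).1 (hf v hle ?_))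
      exact (h₁ fun n hn => hV (h n (Or.inl hn))).2 (hS (Set.mem_insert _ _))
    · intro hi v hv hφ
      rw [h₂ fun n hn => hv.1 (h n (Or.inr hn))]
      rw [h₁ fun n hn => hv.1 (h n (Or.inl hn))] at hφ
      exact v.closed _ (hocc fun n hn => hv.1 (h n (Or.inr hn)))
        (Entails.map₂ (fun _ => .impE) (Entails.of_mem (hv.2 hi)) (Entails.of_mem hφ))
  | all φ ih =>
    intro w ρ h
    constructor
    · intro hf
      by_contra hn
      obtain ⟨c, hc⟩ := w.coinf.nonempty
      have hinsert : (insert c w.V)ᶜ.Infinite := by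
        have : (insert c w.V)ᶜ = w.Vᶜ \ {c} := by ext n; simp; tauto
        rw [this]
        exact w.coinf.sdiff (Set.finite_singleton c)
      obtain ⟨v, hV, hS, hv⟩ := exists_world (T := T) (S := w.S)
        (χ := (φ.rename (liftRen ρ)).inst c) hinsert
        (fun γ hγ n hn => Or.inr (w.occ γ hγ n hn))
        (fun hent => hn (w.closed _ (hocc h) (Entails.allI_fresh
          (fun γ hγ ho => hc (w.occ γ hγ c ho)) (fun ho => hc (hocc h c ho)) hent)))
      have hle : w ≤ v := ⟨(Set.subset_insert _ _).trans hV, hS⟩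
      have hcv : c ∈ v.V := hV (Set.mem_insert _ _)
      rw [hinst] at hv
      exact hv ((ih (hcons (fun n hn => hle.1 (h n hn)) hcv)).1 (hf v hle c hcv))
    · intro ha v hv d hd
      rw [ih (hcons (fun n hn => hv.1 (h n hn)) hd), ← hinst]
      refine v.closed _ ?_ ((Entails.of_mem (hv.2 ha)).map fun _ => .allE d)
      rw [hinst]
      exact hocc (hcons (fun n hn => hv.1 (h n hn)) hd)
  | ex φ ih =>
    intro w ρ h
    constructor
    · rintro ⟨d, hd, hf⟩
      rw [ih (hcons h hd), ← hinst] at hf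
      exact w.closed _ (hocc h) ((Entails.of_mem hf).map fun _ => .exI d)
    · intro he
      obtain ⟨c, hc, hf⟩ := w.witness _ he
      rw [hinst] at hf
      exact ⟨c, hc, (ih (hcons h hc)).2 hf⟩

/-- The theorems of `T` are forced in the canonical structure of `T`. -/
theorem forces_of_provable {T : Set Fml} {φ : Fml} (h : Provable T φ) (w : World T) {ρ : ℕ → ℕ}
    (hρ : ∀ n, ρ n ∈ w.V) : (canonical T).Forces w φ ρ := by
  rw [forces_canonical_iff fun n _ => hρ n]
  refine w.closed _ (fun n hn => ?_) (Entails.of_provable (h.rename ρ))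
  obtain ⟨m, _, rfl⟩ := occ_rename.1 hn
  exact hρ m

/-- Completeness: to prove a sentence in `T` it suffices to check that it is forced at all worlds of
the canonical structure. -/
theorem provable_of_forces {T : Set Fml} {φ : Fml} (hφ : FreeBelow 0 φ)
    (h : ∀ (w : World T) (ρ : ℕ → ℕ), (∀ n, ρ n ∈ w.V) → (canonical T).Forces w φ ρ) :
    Provable T φ := by
  by_contra hn
  have hocc : ∀ n, ¬ Occ n φ := fun n hn => Nat.not_lt_zero _ ((freeBelow_iff_occ φ 0).1 hφ n hn)
  obtain ⟨w, -, -, hw⟩ := exists_world (T := T) (V := ∅) (S := ∅) (χ := φ)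
    (by simpa using Set.infinite_univ) (by simp) (fun ⟨Γ, hΓ, hd⟩ => hn (hd.weaken fun γ hγ =>
      absurd (hΓ γ hγ) (by simp)))
  obtain ⟨c, hc⟩ := w.nonempty
  have := (forces_canonical_iff (fun n h => absurd h (hocc n))).1 (h w (fun _ => c) fun _ => hc)
  rw [rename_eq_self fun n h => absurd h (hocc n)] at this
  exact hw this

/-! ### Set-theoretic notions in a Kripke structure -/

namespace KFrame

section Notions

variable {W X : Type} [Preorder W] (K : KFrame W X)

/-- `x = ∅`, read at the world `w`. -/
def Zero (w : W) (x : X) : Prop := ∀ v, w ≤ v → ∀ d, ¬ K.E v d x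

/-- `x = y ∪ {y}`, read at the world `w`. -/
def Succ (w : W) (x y : X) : Prop :=
  ∀ v, w ≤ v → ∀ d, K.D v d → (K.E v d x ↔ K.E v d y ∨ K.Q v d y)

/-- `z = {a, b}`, read at the world `w`. -/
def UPair (w : W) (z a b : X) : Prop :=
  ∀ v, w ≤ v → ∀ d, K.D v d → (K.E v d z ↔ K.Q v d a ∨ K.Q v d b)

/-- `z = ⟨a, b⟩`, read at the world `w`. -/
def Pair (w : W) (z a b : X) : Prop :=
  ∀ v, w ≤ v → ∀ d, K.D v d → (K.E v d z ↔ K.UPair v d a a ∨ K.UPair v d a b)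

/-- `o = ω`, read at the world `w`. -/
def Om (w : W) (o : X) : Prop :=
  ∀ v, w ≤ v → ∀ d, K.D v d → (K.E v d o ↔ K.Zero v d ∨ ∃ y, K.E v y o ∧ K.Succ v d y)

/-- `x` is the `n`-th numeral, read at the world `w`. -/
def Num (w : W) : ℕ → X → Prop
  | 0, x => K.Zero w x
  | n + 1, x => ∃ y, K.D w y ∧ Num w n y ∧ K.Succ w x y

end Notions

section Forcing

variable {W X : Type} [Preorder W] {K : KFrame W X}

theorem forces_all_iff {w : W} {φ ψ : Fml} {ρ : ℕ → X} : K.Forces w (all (iff φ ψ)) ρ ↔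
    ∀ v, w ≤ v → ∀ d, K.D v d → (K.Forces v φ (cons d ρ) ↔ K.Forces v ψ (cons d ρ)) := by
  constructor
  · intro h v hv d hd
    exact ⟨(h v hv d hd).1 v le_rfl, (h v hv d hd).2 v le_rfl⟩
  · intro h v hv d hd
    exact ⟨fun u hu => (h u (hv.trans hu) d (K.D_mono hu hd)).1,
      fun u hu => (h u (hv.trans hu) d (K.D_mono hu hd)).2⟩

theorem forces_ball {w : W} {a : ℕ} {φ : Fml} {ρ : ℕ → X} : K.Forces w (ball a φ) ρ ↔
    ∀ v, w ≤ v → ∀ d, K.E v d (ρ a) → K.Forces v φ (cons d ρ) :=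
  ⟨fun h v hv d hd => h v hv d (K.E_left hd) v le_rfl hd,
    fun h _ hv d _ u hu hd' => h u (hv.trans hu) d hd'⟩

theorem forces_bex {w : W} {a : ℕ} {φ : Fml} {ρ : ℕ → X} : K.Forces w (bex a φ) ρ ↔
    ∃ d, K.E w d (ρ a) ∧ K.Forces w φ (cons d ρ) :=
  ⟨fun ⟨d, _, h⟩ => ⟨d, h⟩, fun ⟨d, h⟩ => ⟨d, K.E_left h.1, h⟩⟩

theorem forces_neg {w : W} {φ : Fml} {ρ : ℕ → X} : K.Forces w (neg φ) ρ ↔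
    ∀ v, w ≤ v → ¬ K.Forces v φ ρ := Iff.rfl

theorem forces_isEmpty {w : W} {i : ℕ} {ρ : ℕ → X} :
    K.Forces w (isEmpty i) ρ ↔ K.Zero w (ρ i) :=
  ⟨fun h v hv d hd => h v hv d (K.E_left hd) v le_rfl hd,
    fun h _ hv d _ u hu hd' => h u (hv.trans hu) d hd'⟩

theorem forces_isSucc {w : W} {i j : ℕ} {ρ : ℕ → X} :
    K.Forces w (isSucc i j) ρ ↔ K.Succ w (ρ i) (ρ j) := forces_all_iff

theorem forces_isUPair {w : W} {i j k : ℕ} {ρ : ℕ → X} :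
    K.Forces w (isUPair i j k) ρ ↔ K.UPair w (ρ i) (ρ j) (ρ k) := forces_all_iff

theorem forces_isPair {w : W} {i j k : ℕ} {ρ : ℕ → X} :
    K.Forces w (isPair i j k) ρ ↔ K.Pair w (ρ i) (ρ j) (ρ k) := by
  unfold isPair
  rw [forces_all_iff]
  simp only [Forces, forces_isUPair]
  rfl

theorem forces_isOmega {w : W} {i : ℕ} {ρ : ℕ → X} :
    K.Forces w (isOmega i) ρ ↔ K.Om w (ρ i) := by
  unfold isOmega
  rw [forces_all_iff]
  simp only [Forces, forces_isSucc, forces_isEmpty, forces_bex]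
  rfl

theorem forces_isNumeral {n : ℕ} : ∀ {w : W} {i : ℕ} {ρ : ℕ → X},
    K.Forces w (isNumeral n i) ρ ↔ K.Num w n (ρ i) := by
  induction n with
  | zero => intro w i ρ; exact forces_isEmpty
  | succ n ih =>
    intro w i ρ
    simp only [isNumeral, Forces, ih, forces_isSucc]
    rfl

theorem Zero.mono {w v : W} {x : X} (h : K.Zero w x) (hv : w ≤ v) : K.Zero v x :=
  fun u hu => h u (hv.trans hu)

theorem Succ.mono {w v : W} {x y : X} (h : K.Succ w x y) (hv : w ≤ v) : K.Succ v x y :=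
  fun u hu => h u (hv.trans hu)

theorem UPair.mono {w v : W} {x y z : X} (h : K.UPair w x y z) (hv : w ≤ v) : K.UPair v x y z :=
  fun u hu => h u (hv.trans hu)

theorem Pair.mono {w v : W} {x y z : X} (h : K.Pair w x y z) (hv : w ≤ v) : K.Pair v x y z :=
  fun u hu => h u (hv.trans hu)

theorem Om.mono {w v : W} {x : X} (h : K.Om w x) (hv : w ≤ v) : K.Om v x :=
  fun u hu => h u (hv.trans hu)

theorem Num.mono {n : ℕ} : ∀ {w v : W} {x : X}, K.Num w n x → w ≤ v → K.Num v n x := by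
  induction n with
  | zero => intro w v x h hv; exact Zero.mono h hv
  | succ n ih =>
    rintro w v x ⟨y, hy, hn, hs⟩ hv
    exact ⟨y, K.D_mono hv hy, ih hn hv, hs.mono hv⟩

theorem E_congr_right {w : W} {d x y : X} (h : K.Q w x y) (hE : K.E w d x) : K.E w d y :=
  K.E_congr (K.Q_refl (K.E_left hE)) h hE

theorem E_congr_left {w : W} {x y d : X} (h : K.Q w x y) (hE : K.E w x d) : K.E w y d :=
  K.E_congr h (K.Q_refl (K.E_right hE)) hE

theorem Succ.mem {w : W} {x y : X} (h : K.Succ w x y) (hy : K.D w y) : K.E w y x :=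
  (h w le_rfl y hy).2 (Or.inr (K.Q_refl hy))

theorem Succ.not_zero {w : W} {x y : X} (h : K.Succ w x y) (hy : K.D w y) : ¬ K.Zero w x :=
  fun h' => h' w le_rfl y (h.mem hy)

theorem UPair.inj {w : W} {x a b c d : X} (h : K.UPair w x a b)
    (h' : K.UPair w x c d) (hc : K.D w c) (hd : K.D w d) :
    (K.Q w c a ∨ K.Q w c b) ∧ (K.Q w d a ∨ K.Q w d b) :=
  ⟨(h w le_rfl c hc).1 ((h' w le_rfl c hc).2 (Or.inl (K.Q_refl hc))),
    (h w le_rfl d hd).1 ((h' w le_rfl d hd).2 (Or.inr (K.Q_refl hd)))⟩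

theorem E_iff_right {w : W} {d x y : X} (h : K.Q w x y) : K.E w d x ↔ K.E w d y :=
  ⟨E_congr_right h, E_congr_right (K.Q_symm h)⟩

theorem Q_iff_right {w : W} {d x y : X} (h : K.Q w x y) : K.Q w d x ↔ K.Q w d y :=
  ⟨fun h' => K.Q_trans h' h, fun h' => K.Q_trans h' (K.Q_symm h)⟩

theorem Zero.congr {w : W} {x x' : X} (h : K.Zero w x) (hx : K.Q w x x') : K.Zero w x' :=
  fun v hv d hd => h v hv d (E_congr_right (K.Q_symm (K.Q_mono hv hx)) hd)

theorem Succ.congr {w : W} {x x' y y' : X} (h : K.Succ w x y) (hx : K.Q w x x')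
    (hy : K.Q w y y') : K.Succ w x' y' := by
  intro v hv d hd
  rw [← E_iff_right (K.Q_mono hv hx), h v hv d hd, E_iff_right (K.Q_mono hv hy),
    Q_iff_right (K.Q_mono hv hy)]

theorem UPair.congr {w : W} {z z' a a' b b' : X} (h : K.UPair w z a b) (hz : K.Q w z z')
    (ha : K.Q w a a') (hb : K.Q w b b') : K.UPair w z' a' b' := by
  intro v hv d hd
  rw [← E_iff_right (K.Q_mono hv hz), h v hv d hd, Q_iff_right (K.Q_mono hv ha),
    Q_iff_right (K.Q_mono hv hb)]

theorem Pair.congr {w : W} {z z' a a' b b' : X} (h : K.Pair w z a b) (hz : K.Q w z z')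
    (ha : K.Q w a a') (hb : K.Q w b b') : K.Pair w z' a' b' := by
  have key : ∀ {a a' b b' : X}, K.Q w a a' → K.Q w b b' → ∀ v, w ≤ v → ∀ d, K.D v d →
      K.UPair v d a b → K.UPair v d a' b' := fun ha hb v hv d hd h =>
    h.congr (K.Q_refl hd) (K.Q_mono hv ha) (K.Q_mono hv hb)
  intro v hv d hd
  rw [← E_iff_right (K.Q_mono hv hz), h v hv d hd]
  exact ⟨Or.imp (key ha ha v hv d hd) (key ha hb v hv d hd),
    Or.imp (key (K.Q_symm ha) (K.Q_symm ha) v hv d hd) (key (K.Q_symm ha) (K.Q_symm hb) v hv d hd)⟩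

theorem Num.congr {n : ℕ} {w : W} {x x' : X} (h : K.Num w n x) (hx : K.Q w x x') :
    K.Num w n x' := by
  cases n with
  | zero => exact Zero.congr h hx
  | succ n =>
    obtain ⟨y, hy, hn, hs⟩ := h
    exact ⟨y, hy, hn, hs.congr hx (K.Q_refl hy)⟩

/-- All axioms of `CZF` are forced. -/
def IsModel (K : KFrame W X) : Prop :=
  ∀ φ ∈ CZF, ∀ (w : W) (ρ : ℕ → X), (∀ n, K.D w (ρ n)) → K.Forces w φ ρ

theorem D_cons {w : W} {d : X} {ρ : ℕ → X} (hd : K.D w d) (hρ : ∀ n, K.D w (ρ n)) :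
    ∀ n, K.D w (cons d ρ n)
  | 0 => hd
  | n + 1 => hρ n

end Forcing

end KFrame

/-! ### Elementary set theory in a Kripke model of `CZF` -/

namespace KFrame.IsModel

variable {W X : Type} [Preorder W] {K : KFrame W X} (hK : K.IsModel)

include hK

theorem ext {w : W} {a b : X} (ha : K.D w a) (hb : K.D w b)
    (h : ∀ v, w ≤ v → ∀ d, K.D v d → (K.E v d a ↔ K.E v d b)) : K.Q w a b := by
  have h₁ := hK _ .extensionality w (fun _ => a) fun _ => ha
  refine h₁ w le_rfl a ha w le_rfl b hb w le_rfl ?_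
  exact forces_all_iff.2 h

theorem exists_uPair {w : W} {a b : X} (ha : K.D w a) (hb : K.D w b) :
    ∃ z, K.D w z ∧ K.UPair w z a b := by
  have h₁ := hK _ .pairing w (fun _ => a) fun _ => ha
  obtain ⟨z, hz, h⟩ := h₁ w le_rfl a ha w le_rfl b hb
  exact ⟨z, hz, forces_isUPair.1 h⟩

theorem exists_union {w : W} {a : X} (ha : K.D w a) : ∃ x, K.D w x ∧
    ∀ v, w ≤ v → ∀ y, K.D v y → (K.E v y x ↔ ∃ z, K.E v z a ∧ K.E v y z) := by
  have h₁ := hK _ .union w (fun _ => a) fun _ => ha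
  obtain ⟨x, hx, h⟩ := h₁ w le_rfl a ha
  refine ⟨x, hx, fun v hv y hy => ?_⟩
  have := (forces_all_iff.1 h) v hv y hy
  rw [forces_bex] at this
  exact this

theorem exists_omega {w : W} {a : X} (ha : K.D w a) : ∃ o, K.D w o ∧ K.Om w o := by
  obtain ⟨x, hx, h⟩ := hK _ .infinity w (fun _ => a) fun _ => ha
  exact ⟨x, hx, forces_isOmega.1 h⟩

theorem exists_zero {w : W} {a : X} (ha : K.D w a) : ∃ z, K.D w z ∧ K.Zero w z := by
  obtain ⟨x, hx, h⟩ := hK _ (.separation bot .bot) w (fun _ => a) (fun _ => ha) w le_rfl a ha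
  refine ⟨x, hx, fun v hv d hd => ?_⟩
  exact (((forces_all_iff.1 h) v hv d (K.E_left hd)).1 hd).2

theorem set_induction {w : W} (φ : Fml) {ρ : ℕ → X} (hρ : ∀ n, K.D w (ρ n))
    (h : ∀ v, w ≤ v → ∀ a, K.D v a → (∀ u, v ≤ u → ∀ x, K.E u x a → K.Forces u φ (cons x ρ)) →
      K.Forces v φ (cons a ρ)) :
    ∀ v, w ≤ v → ∀ a, K.D v a → K.Forces v φ (cons a ρ) := by
  refine hK _ (.setInduction φ) w ρ hρ w le_rfl ?_
  intro v hv a ha u hu h'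
  refine h u (hv.trans hu) a (K.D_mono hu ha) fun t ht x hx => ?_
  have := forces_ball.1 h' t ht x hx
  rw [forces_rename] at this
  convert this using 1
  funext n
  cases n <;> rfl

theorem strong_collection {w : W} (φ : Fml) {ρ : ℕ → X} (hρ : ∀ n, K.D w (ρ n)) {a : X}
    (ha : K.D w a)
    (h : ∀ v, w ≤ v → ∀ x, K.E v x a →
      ∃ y, K.D v y ∧ K.Forces v φ (cons y (cons x (cons a ρ)))) :
    ∃ b, K.D w b ∧
      (∀ v, w ≤ v → ∀ x, K.E v x a → ∃ y, K.E v y b ∧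
        K.Forces v φ (cons y (cons x (cons a ρ)))) ∧
      (∀ v, w ≤ v → ∀ y, K.E v y b → ∃ x, K.E v x a ∧
        K.Forces v φ (cons y (cons x (cons a ρ)))) := by
  obtain ⟨b, hb, h₁, h₂⟩ := hK _ (.strongCollection φ) w ρ hρ w le_rfl a ha w le_rfl
    (forces_ball.2 h)
  refine ⟨b, hb, fun v hv x hx => ?_, fun v hv y hy => ?_⟩
  · obtain ⟨y, hy, h⟩ := forces_bex.1 (forces_ball.1 h₁ v hv x hx)
    refine ⟨y, hy, ?_⟩
    rw [forces_rename] at h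
    convert h using 1
    funext n
    rcases n with _ | _ | n <;> rfl
  · obtain ⟨x, hx, h⟩ := forces_bex.1 (forces_ball.1 h₂ v hv y hy)
    refine ⟨x, hx, ?_⟩
    rw [forces_rename] at h
    convert h using 1
    funext n
    rcases n with _ | _ | n <;> rfl

theorem zero_unique {w : W} {x y : X} (hx : K.D w x) (hy : K.D w y) (h : K.Zero w x)
    (h' : K.Zero w y) : K.Q w x y :=
  hK.ext hx hy fun v hv d _ => ⟨fun h₁ => absurd h₁ (h v hv d), fun h₁ => absurd h₁ (h' v hv d)⟩

theorem succ_unique {w : W} {x y x' y' : X} (hx : K.D w x) (hx' : K.D w x')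
    (h : K.Succ w x y) (h' : K.Succ w x' y') (hy : K.Q w y y') : K.Q w x x' :=
  hK.ext hx hx' fun v hv d hd => by
    rw [h v hv d hd, h' v hv d hd, E_iff_right (K.Q_mono hv hy), Q_iff_right (K.Q_mono hv hy)]

theorem uPair_unique {w : W} {x y a b : X} (hx : K.D w x) (hy : K.D w y)
    (h : K.UPair w x a b) (h' : K.UPair w y a b) : K.Q w x y :=
  hK.ext hx hy fun v hv d hd => by rw [h v hv d hd, h' v hv d hd]

theorem pair_unique {w : W} {x y a b : X} (hx : K.D w x) (hy : K.D w y)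
    (h : K.Pair w x a b) (h' : K.Pair w y a b) : K.Q w x y :=
  hK.ext hx hy fun v hv d hd => by rw [h v hv d hd, h' v hv d hd]

theorem exists_pair {w : W} {a b : X} (ha : K.D w a) (hb : K.D w b) :
    ∃ z, K.D w z ∧ K.Pair w z a b := by
  obtain ⟨x, hx, hxa⟩ := hK.exists_uPair ha ha
  obtain ⟨y, hy, hyb⟩ := hK.exists_uPair ha hb
  obtain ⟨z, hz, h⟩ := hK.exists_uPair hx hy
  refine ⟨z, hz, fun v hv d hd => ?_⟩
  rw [h v hv d hd]
  have key : ∀ {x a b : X}, K.D w x → K.D w a → K.D w b → K.UPair w x a b →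
      (K.Q v d x ↔ K.UPair v d a b) := fun {x a b} hx ha hb h =>
    ⟨fun hq => (h.mono hv).congr (K.Q_symm hq) (K.Q_refl (K.D_mono hv ha))
      (K.Q_refl (K.D_mono hv hb)), fun hd' => hK.uPair_unique hd (K.D_mono hv hx) hd' (h.mono hv)⟩
  rw [key hx ha ha hxa, key hy ha hb hyb]

/-- Kuratowski pairs are injective. The usual case distinction on `a = b` is not available
intuitionistically; that `b` is `c` or `d` and that `d` is `a` or `b` is enough. -/
theorem pair_inj {w : W} {z a b c d : X} (ha : K.D w a) (hb : K.D w b) (hc : K.D w c)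
    (hd : K.D w d) (h : K.Pair w z a b) (h' : K.Pair w z c d) : K.Q w a c ∧ K.Q w b d := by
  obtain ⟨x, hx, hxa⟩ := hK.exists_uPair ha ha
  obtain ⟨y, hy, hyb⟩ := hK.exists_uPair ha hb
  obtain ⟨x', hx', hxc⟩ := hK.exists_uPair hc hc
  obtain ⟨y', hy', hyd⟩ := hK.exists_uPair hc hd
  have h₁ := (h' w le_rfl x hx).1 ((h w le_rfl x hx).2 (Or.inl hxa))
  have h₂ := (h' w le_rfl y hy).1 ((h w le_rfl y hy).2 (Or.inr hyb))
  have h₃ := (h w le_rfl y' hy').1 ((h' w le_rfl y' hy').2 (Or.inr hyd))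
  have hac : K.Q w a c := by
    rcases h₁ with h₁ | h₁
    · exact K.Q_symm ((hxa.inj h₁ hc hc).1.elim id id)
    · exact K.Q_symm ((hxa.inj h₁ hc hd).1.elim id id)
  refine ⟨hac, ?_⟩
  have hca := K.Q_symm hac
  -- `b` is `c` or `d`, and `d` is `a` or `b`
  have hb' : K.Q w b c ∨ K.Q w b d := by
    rcases h₂ with h₂ | h₂
    · exact Or.inl ((h₂.inj hyb ha hb).2.elim id id)
    · exact (h₂.inj hyb ha hb).2
  have hd' : K.Q w d a ∨ K.Q w d b := by
    rcases h₃ with h₃ | h₃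
    · exact Or.inl ((h₃.inj hyd hc hd).2.elim id id)
    · exact (h₃.inj hyd hc hd).2
  rcases hb' with hb' | hb'
  · rcases hd' with hd' | hd'
    · exact K.Q_trans hb' (K.Q_trans hca (K.Q_symm hd'))
    · exact K.Q_symm hd'
  · exact hb'

/-- `a ∪ {b}` exists. -/
theorem exists_adjoin {w : W} {a b : X} (ha : K.D w a) (hb : K.D w b) : ∃ x, K.D w x ∧
    ∀ v, w ≤ v → ∀ d, K.D v d → (K.E v d x ↔ K.E v d a ∨ K.Q v d b) := by
  obtain ⟨s, hs, hsb⟩ := hK.exists_uPair hb hb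
  obtain ⟨p, hp, hpa⟩ := hK.exists_uPair ha hs
  obtain ⟨x, hx, h⟩ := hK.exists_union hp
  refine ⟨x, hx, fun v hv d hd => ?_⟩
  rw [h v hv d hd]
  constructor
  · rintro ⟨z, hz, hdz⟩
    rcases (hpa v hv z (K.E_left hz)).1 hz with hz | hz
    · exact Or.inl (E_congr_right hz hdz)
    · exact Or.inr (((hsb v hv d hd).1 (E_congr_right hz hdz)).elim id id)
  · rintro (hd' | hd')
    · exact ⟨a, (hpa v hv a (K.D_mono hv ha)).2 (Or.inl (K.Q_refl (K.D_mono hv ha))), hd'⟩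
    · exact ⟨s, (hpa v hv s (K.D_mono hv hs)).2 (Or.inr (K.Q_refl (K.D_mono hv hs))),
        (hsb v hv d hd).2 (Or.inl hd')⟩

theorem exists_succ {w : W} {y : X} (hy : K.D w y) : ∃ x, K.D w x ∧ K.Succ w x y :=
  hK.exists_adjoin hy hy

/-- By set induction, no set is an element of itself. -/
theorem mem_irrefl {w : W} {a : X} : ¬ K.E w a a := by
  intro h
  have ha := K.E_left h
  refine hK.set_induction (w := w) (neg (mem 0 0)) (ρ := fun _ => a) (fun _ => ha) ?_ w le_rfl a ha
    w le_rfl h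
  intro v _ b hb ih u hu hbb
  exact ih u hu b hbb u le_rfl hbb

/-! ### Arithmetic of `ω` -/

/-- Induction on `ω` for a property `P` of worlds and objects that is expressed by a formula `φ`
with parameters `ρ`. -/
theorem omega_induction {w : W} {o : X} (ho : K.D w o) (hω : K.Om w o) {P : W → X → Prop}
    (φ : Fml) (ρ : ℕ → X) (hρ : ∀ n, K.D w (ρ n))
    (hP : ∀ v, w ≤ v → ∀ x, K.Forces v φ (cons x ρ) ↔ P v x)
    (zero : ∀ v, w ≤ v → ∀ x, K.E v x o → K.Zero v x → P v x)
    (succ : ∀ v, w ≤ v → ∀ x y, K.E v x o → K.E v y o → K.Succ v x y → P v y → P v x) :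
    ∀ v, w ≤ v → ∀ x, K.E v x o → P v x := by
  let σ : ℕ → ℕ := fun n => match n with | 0 => 0 | k + 1 => k + 2
  have hσ : ∀ v x, w ≤ v → (K.Forces v (φ.rename σ) (cons x (cons o ρ)) ↔ P v x) := by
    intro v x hv
    rw [forces_rename, ← hP v hv]
    have : cons x (cons o ρ) ∘ σ = cons x ρ := by funext n; cases n <;> rfl
    rw [this]
  have key := hK.set_induction (w := w) (imp (mem 0 1) (φ.rename σ)) (D_cons ho hρ) ?_
  · intro v hv x hx
    exact (hσ v x hv).1 (key v hv x (K.E_left hx) v le_rfl hx)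
  · intro v hv a ha ih u hu hao
    rw [hσ u a (hv.trans hu)]
    rcases (hω u (hv.trans hu) a (K.D_mono hu ha)).1 hao with h | ⟨y, hy, hs⟩
    · exact zero u (hv.trans hu) a hao h
    · refine succ u (hv.trans hu) a y hao hy hs ?_
      have hya : K.E u y a := (hs u le_rfl y (K.E_left hy)).2 (Or.inr (K.Q_refl (K.E_left hy)))
      exact (hσ u y (hv.trans hu)).1 (ih u hu y hya u le_rfl hy)

variable {w : W} {o : X} (ho : K.D w o) (hω : K.Om w o)

include hω

omit hK in
theorem zero_or_succ {n : X} (hn : K.E w n o) : K.Zero w n ∨ ∃ y, K.E w y o ∧ K.Succ w n y :=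
  (hω w le_rfl n (K.E_left hn)).1 hn

omit hK in
theorem zero_mem {z : X} (hz : K.D w z) (h : K.Zero w z) : K.E w z o :=
  (hω w le_rfl z hz).2 (Or.inl h)

omit hK in
theorem succ_mem {x y : X} (hx : K.D w x) (hy : K.E w y o) (h : K.Succ w x y) : K.E w x o :=
  (hω w le_rfl x hx).2 (Or.inr ⟨y, hy, h⟩)

include ho

theorem mem_omega_of_mem {n m : X} (hn : K.E w n o) (hm : K.E w m n) : K.E w m o := by
  refine hK.omega_induction ho hω (P := fun v n => ∀ u, v ≤ u → ∀ m, K.E u m n → K.E u m o)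
    (ball 0 (mem 0 2)) (fun _ => o) (fun _ => ho) ?_ ?_ ?_ w le_rfl n hn w le_rfl m hm
  · intro v _ x
    exact forces_ball
  · intro v _ x _ hz u hu m hm
    exact absurd hm (hz u hu m)
  · intro v hv x y _ hy hs ih u hu m hm
    rcases (hs u hu m (K.E_left hm)).1 hm with h | h
    · exact ih u hu m h
    · exact E_congr_left (K.Q_symm h) (K.E_mono hu hy)

theorem mem_trans {n m k : X} (hn : K.E w n o) (hm : K.E w m n) (hk : K.E w k m) : K.E w k n := by
  refine hK.omega_induction ho hω (P := fun v n => ∀ u, v ≤ u → ∀ m, K.E u m n →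
    ∀ t, u ≤ t → ∀ k, K.E t k m → K.E t k n)
    (ball 0 (ball 0 (mem 0 2))) (fun _ => o) (fun _ => ho) ?_ ?_ ?_ w le_rfl n hn w le_rfl m hm
    w le_rfl k hk
  · intro v _ x
    rw [forces_ball]
    simp only [forces_ball]
    exact Iff.rfl
  · intro v _ x _ hz u hu m hm
    exact absurd hm (hz u hu m)
  · intro v hv x y _ hy hs ih u hu m hm t ht k hk
    refine (hs t (hu.trans ht) k (K.E_left hk)).2 (Or.inl ?_)
    rcases (hs u hu m (K.E_left hm)).1 hm with h | h
    · exact ih u hu m h t ht k hk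
    · exact E_congr_right (K.Q_mono ht h) hk

theorem succ_inj {x x' y y' : X} (hy : K.E w y o) (hy' : K.E w y' o) (h : K.Succ w x y)
    (h' : K.Succ w x' y') (hx : K.Q w x x') : K.Q w y y' := by
  have hyx := E_congr_right hx (h.mem (K.E_left hy))
  have hyx' := E_congr_right (K.Q_symm hx) (h'.mem (K.E_left hy'))
  rcases (h' w le_rfl y (K.E_left hy)).1 hyx with h₁ | h₁
  · rcases (h w le_rfl y' (K.E_left hy')).1 hyx' with h₂ | h₂
    · exact absurd (hK.mem_trans ho hω hy h₂ h₁) hK.mem_irrefl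
    · exact K.Q_symm h₂
  · exact h₁

theorem zero_eq_or_mem {z n : X} (hz : K.D w z) (h : K.Zero w z) (hn : K.E w n o) :
    K.Q w z n ∨ K.E w z n := by
  refine hK.omega_induction ho hω (P := fun v n => K.Q v z n ∨ K.E v z n)
    (Fml.or (eq 1 0) (mem 1 0)) (fun _ => z) (fun _ => hz) ?_ ?_ ?_ w le_rfl n hn
  · intro v _ x
    exact Iff.rfl
  · intro v hv x hx hzx
    exact Or.inl (hK.zero_unique (K.D_mono hv hz) (K.E_left hx) (h.mono hv) hzx)
  · intro v hv x y hx hy hs ih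
    exact Or.inr ((hs v le_rfl z (K.D_mono hv hz)).2 ih.symm)

theorem succ_eq_or_mem {n s m : X} (hs : K.D w s) (hns : K.Succ w s n)
    (hm : K.E w m o) (h : K.E w n m) : K.E w s m ∨ K.Q w s m := by
  have hn := K.E_left h
  refine hK.omega_induction ho hω
    (P := fun v m => ∀ u, v ≤ u → K.E u n m → K.E u s m ∨ K.Q u s m)
    (imp (mem 1 0) (Fml.or (mem 2 0) (eq 2 0))) (cons n fun _ => s) (D_cons hn fun _ => hs) ?_ ?_ ?_
    w le_rfl m hm w le_rfl h
  · intro v _ x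
    exact Iff.rfl
  · intro v _ x _ hz u hu hnm
    exact absurd hnm (hz u hu n)
  · intro v hv x y hx hy hxy ih u hu hnm
    have hsu := K.D_mono (hv.trans hu) hs
    rcases (hxy u hu n (K.E_left hnm)).1 hnm with h₁ | h₁
    · exact Or.inl ((hxy u hu s hsu).2 (ih u hu h₁))
    · exact Or.inr (hK.succ_unique hsu (K.E_right hnm) (hns.mono (hv.trans hu)) (hxy.mono hu) h₁)

theorem trichotomy {n m : X} (hn : K.E w n o) (hm : K.E w m o) :
    K.E w n m ∨ K.Q w n m ∨ K.E w m n := by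
  refine hK.omega_induction ho hω (P := fun v n => ∀ u, v ≤ u → ∀ m, K.E u m o →
    K.E u n m ∨ K.Q u n m ∨ K.E u m n)
    (ball 1 (Fml.or (mem 1 0) (Fml.or (eq 1 0) (mem 0 1)))) (fun _ => o) (fun _ => ho) ?_ ?_ ?_
    w le_rfl n hn w le_rfl m hm
  · intro v _ x
    exact forces_ball
  · intro v hv x hx hz u hu m hm
    have hvu := hv.trans hu
    rcases hK.zero_eq_or_mem (K.D_mono hvu ho) (hω.mono hvu) (K.D_mono hu (K.E_left hx))
      (hz.mono hu) hm with h | h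
    · exact Or.inr (Or.inl h)
    · exact Or.inl h
  · intro v hv x y hx hy hs ih u hu m hm
    have hvu := hv.trans hu
    have hmx : K.E u m y ∨ K.Q u m y → K.E u m x := (hs u hu m (K.E_left hm)).2
    rcases ih u hu m hm with h | h | h
    · rcases hK.succ_eq_or_mem (K.D_mono hvu ho) (hω.mono hvu) (K.D_mono hu (K.E_left hx))
        (hs.mono hu) hm h with h | h
      · exact Or.inl h
      · exact Or.inr (Or.inl h)
    · exact Or.inr (Or.inr (hmx (Or.inr (K.Q_symm h))))
    · exact Or.inr (Or.inr (hmx (Or.inl h)))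

end KFrame.IsModel

/-! ### Definition by recursion on `ω` -/

/-- The substitution instance `φ(i, j)` of a formula `φ` in the variables `0` and `1`. -/
def app₂ (φ : Fml) (i j : ℕ) : Fml := φ.rename (cons i fun _ => j)

/-- The substitution instance `φ(i, j, k, l)` of a formula `φ` in the variables `0` to `3`. -/
def app₄ (φ : Fml) (i j k l : ℕ) : Fml := φ.rename (cons i (cons j (cons k fun _ => l)))

/-- `f` is a history of the recursion with initial value `I(-, z)` and step `S(-, -, -, z)`:
every element of `f` is a pair `⟨i, a⟩` such that either `i = 0` and `I(a, z)`, or `i = i' + 1` and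
`S(a, a', i', z)` for some `⟨i', a'⟩ ∈ f`. -/
def isHistory (I S : Fml) (f z : ℕ) : Fml :=
  ball f (ex (ex (and (isPair 2 1 0) (Fml.or
    (and (isEmpty 1) (app₂ I 0 (z + 3)))
    (bex (f + 3) (ex (ex (and (isPair 2 1 0) (and (isSucc 4 1) (app₄ S 3 0 1 (z + 6)))))))))))

/-- `a` is the value at `n` of the function defined by recursion from `I` and `S`, with
parameter `z`. -/
def recF (I S : Fml) (n a z : ℕ) : Fml :=
  ex (and (isHistory I S 0 (z + 1)) (bex 0 (isPair 0 (n + 2) (a + 2))))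

namespace KFrame

variable {W X : Type} [Preorder W] (K : KFrame W X)

/-- Forcing of a formula in two variables. -/
def F₂ (φ : Fml) (w : W) (a b : X) : Prop := K.Forces w φ (cons a fun _ => b)

/-- Forcing of a formula in four variables. -/
def F₄ (φ : Fml) (w : W) (a b c d : X) : Prop :=
  K.Forces w φ (cons a (cons b (cons c fun _ => d)))

/-- The meaning of `isHistory` at a world. -/
def Hist (I S : Fml) (w : W) (f z : X) : Prop := ∀ v, w ≤ v → ∀ p, K.E v p f →
  ∃ i, K.D v i ∧ ∃ a, K.D v a ∧ K.Pair v p i a ∧ ((K.Zero v i ∧ K.F₂ I v a z) ∨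
    ∃ p', K.E v p' f ∧ ∃ i', K.D v i' ∧ ∃ a', K.D v a' ∧ K.Pair v p' i' a' ∧ K.Succ v i i' ∧
      K.F₄ S v a a' i' z)

/-- The meaning of `recF` at a world. -/
def Rec (I S : Fml) (w : W) (n a z : X) : Prop :=
  ∃ f, K.D w f ∧ K.Hist I S w f z ∧ ∃ p, K.E w p f ∧ K.Pair w p n a

variable {K}

theorem forces_app₂ {φ : Fml} {w : W} {i j : ℕ} {ρ : ℕ → X} :
    K.Forces w (app₂ φ i j) ρ ↔ K.F₂ φ w (ρ i) (ρ j) := by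
  rw [app₂, forces_rename, F₂]
  have : ρ ∘ cons i (fun _ => j) = cons (ρ i) fun _ => ρ j := by
    funext n; cases n <;> rfl
  rw [this]

theorem forces_app₄ {φ : Fml} {w : W} {i j k l : ℕ} {ρ : ℕ → X} :
    K.Forces w (app₄ φ i j k l) ρ ↔ K.F₄ φ w (ρ i) (ρ j) (ρ k) (ρ l) := by
  rw [app₄, forces_rename, F₄]
  have : ρ ∘ cons i (cons j (cons k fun _ => l)) =
      cons (ρ i) (cons (ρ j) (cons (ρ k) fun _ => ρ l)) := by
    funext n; rcases n with _ | _ | _ | n <;> rfl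
  rw [this]

theorem F₂.mono {φ : Fml} {w v : W} {a b : X} (h : K.F₂ φ w a b) (hv : w ≤ v) : K.F₂ φ v a b :=
  Forces.mono hv h

theorem F₄.mono {φ : Fml} {w v : W} {a b c d : X} (h : K.F₄ φ w a b c d) (hv : w ≤ v) :
    K.F₄ φ v a b c d :=
  Forces.mono hv h

theorem F₂.congr {φ : Fml} {w : W} {a b a' b' : X} (h : K.F₂ φ w a b) (ha : K.Q w a a')
    (hb : K.Q w b b') : K.F₂ φ w a' b' :=
  Forces.congr (fun n => by cases n; exacts [ha, hb]) h

theorem F₄.congr {φ : Fml} {w : W} {a b c d a' b' c' d' : X} (h : K.F₄ φ w a b c d)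
    (ha : K.Q w a a') (hb : K.Q w b b') (hc : K.Q w c c') (hd : K.Q w d d') :
    K.F₄ φ w a' b' c' d' :=
  Forces.congr (fun n => by rcases n with _ | _ | _ | n; exacts [ha, hb, hc, hd]) h

theorem forces_isHistory {I S : Fml} {w : W} {f z : ℕ} {ρ : ℕ → X} :
    K.Forces w (isHistory I S f z) ρ ↔ K.Hist I S w (ρ f) (ρ z) := by
  unfold isHistory
  rw [forces_ball]
  simp only [Forces, forces_isPair, forces_isEmpty, forces_isSucc, forces_bex, forces_app₂,
    forces_app₄]
  rfl

theorem forces_recF {I S : Fml} {w : W} {n a z : ℕ} {ρ : ℕ → X} :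
    K.Forces w (recF I S n a z) ρ ↔ K.Rec I S w (ρ n) (ρ a) (ρ z) := by
  simp only [recF, Forces, forces_isHistory, forces_bex, forces_isPair]
  rfl

theorem Hist.mono {I S : Fml} {w v : W} {f z : X} (h : K.Hist I S w f z) (hv : w ≤ v) :
    K.Hist I S v f z :=
  fun u hu => h u (hv.trans hu)

theorem Rec.mono {I S : Fml} {w v : W} {n a z : X} (h : K.Rec I S w n a z) (hv : w ≤ v) :
    K.Rec I S v n a z := by
  obtain ⟨f, hf, hh, p, hp, hpa⟩ := h
  exact ⟨f, K.D_mono hv hf, hh.mono hv, p, K.E_mono hv hp, hpa.mono hv⟩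

theorem Rec.congr {I S : Fml} {w : W} {n a z n' a' : X} (h : K.Rec I S w n a z)
    (hn : K.Q w n n') (ha : K.Q w a a') : K.Rec I S w n' a' z := by
  obtain ⟨f, hf, hh, p, hp, hpa⟩ := h
  exact ⟨f, hf, hh, p, hp, hpa.congr (K.Q_refl (K.E_left hp)) hn ha⟩

/-- The formulas `I` and `S` define the data of a recursion on `o` with parameter `z` and with
values in the class `{a | C(a, o)}`. -/
structure RecData (K : KFrame W X) (w : W) (o z : X) (I S C : Fml) : Prop where
  init_exists : ∀ v, w ≤ v → ∃ a, K.D v a ∧ K.F₂ I v a z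
  init_mem : ∀ v, w ≤ v → ∀ a, K.D v a → K.F₂ I v a z → K.F₂ C v a o
  init_unique : ∀ v, w ≤ v → ∀ a a', K.D v a → K.D v a' → K.F₂ I v a z → K.F₂ I v a' z → K.Q v a a'
  step_exists : ∀ v, w ≤ v → ∀ i b, K.E v i o → K.D v b → K.F₂ C v b o →
    ∃ a, K.D v a ∧ K.F₄ S v a b i z
  step_mem : ∀ v, w ≤ v → ∀ i a b, K.E v i o → K.D v a → K.D v b → K.F₂ C v b o →
    K.F₄ S v a b i z → K.F₂ C v a o
  step_unique : ∀ v, w ≤ v → ∀ i a a' b, K.E v i o → K.D v a → K.D v a' → K.D v b → K.F₂ C v b o →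
    K.F₄ S v a b i z → K.F₄ S v a' b i z → K.Q v a a'

theorem RecData.mono {w v : W} {o z : X} {I S C : Fml} (h : K.RecData w o z I S C)
    (hv : w ≤ v) : K.RecData v o z I S C :=
  ⟨fun u hu => h.1 u (hv.trans hu), fun u hu => h.2 u (hv.trans hu),
    fun u hu => h.3 u (hv.trans hu), fun u hu => h.4 u (hv.trans hu),
    fun u hu => h.5 u (hv.trans hu), fun u hu => h.6 u (hv.trans hu)⟩

end KFrame

namespace KFrame.IsModel

variable {W X : Type} [Preorder W] {K : KFrame W X} (hK : K.IsModel)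

include hK

theorem rec_zero {I S : Fml} {w : W} {n a z : X} (hn : K.D w n) (ha : K.D w a)
    (h0 : K.Zero w n) (hI : K.F₂ I w a z) : K.Rec I S w n a z := by
  obtain ⟨p, hp, hpa⟩ := hK.exists_pair hn ha
  obtain ⟨f, hf, hfp⟩ := hK.exists_uPair hp hp
  refine ⟨f, hf, fun v hv q hq => ?_, p, (hfp w le_rfl p hp).2 (Or.inl (K.Q_refl hp)), hpa⟩
  have hqp := ((hfp v hv q (K.E_left hq)).1 hq).elim id id
  have hn := K.D_mono hv hn
  have ha := K.D_mono hv ha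
  exact ⟨n, hn, a, ha, (hpa.mono hv).congr (K.Q_symm hqp) (K.Q_refl hn) (K.Q_refl ha),
    Or.inl ⟨h0.mono hv, hI.mono hv⟩⟩

/-- A history of the value at `i` is extended by the pair `⟨n, a⟩`. -/
theorem rec_succ {I S : Fml} {w : W} {n a i b z : X} (hn : K.D w n) (ha : K.D w a) (hi : K.D w i)
    (hb : K.D w b) (h : K.Rec I S w i b z) (hs : K.Succ w n i) (hS : K.F₄ S w a b i z) :
    K.Rec I S w n a z := by
  obtain ⟨f, hf, hh, p', hp', hpb⟩ := h
  obtain ⟨p, hp, hpa⟩ := hK.exists_pair hn ha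
  obtain ⟨g, hg, hgp⟩ := hK.exists_adjoin hf hp
  have hsub : ∀ v, w ≤ v → ∀ q, K.E v q f → K.E v q g := fun v hv q hq =>
    (hgp v hv q (K.E_left hq)).2 (Or.inl hq)
  refine ⟨g, hg, fun v hv q hq => ?_, p, (hgp w le_rfl p hp).2 (Or.inr (K.Q_refl hp)), hpa⟩
  rcases (hgp v hv q (K.E_left hq)).1 hq with hq | hq
  · obtain ⟨j, hj, c, hc, hqc, h⟩ := hh v hv q hq
    refine ⟨j, hj, c, hc, hqc, h.imp id ?_⟩
    rintro ⟨r, hr, h⟩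
    exact ⟨r, hsub v hv r hr, h⟩
  · have hn := K.D_mono hv hn
    have ha := K.D_mono hv ha
    exact ⟨n, hn, a, ha, (hpa.mono hv).congr (K.Q_symm hq) (K.Q_refl hn) (K.Q_refl ha),
      Or.inr ⟨p', hsub v hv p' (K.E_mono hv hp'), i, K.D_mono hv hi, b, K.D_mono hv hb,
        hpb.mono hv, hs.mono hv, hS.mono hv⟩⟩

theorem rec_inv {I S : Fml} {w : W} {n a z : X} (hn : K.D w n) (ha : K.D w a) (hz : K.D w z)
    (h : K.Rec I S w n a z) : (K.Zero w n ∧ K.F₂ I w a z) ∨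
      ∃ i, K.D w i ∧ ∃ b, K.D w b ∧ K.Succ w n i ∧ K.Rec I S w i b z ∧ K.F₄ S w a b i z := by
  obtain ⟨f, hf, hh, p, hp, hpa⟩ := h
  obtain ⟨n', hn', a', ha', hpa', h⟩ := hh w le_rfl p hp
  obtain ⟨hnn, haa⟩ := hK.pair_inj hn' ha' hn ha hpa' hpa
  rcases h with ⟨h0, hI⟩ | ⟨p', hp', i, hi, b, hb, hpb, hs, hS⟩
  · exact Or.inl ⟨h0.congr hnn, hI.congr haa (K.Q_refl hz)⟩
  · exact Or.inr ⟨i, hi, b, hb, hs.congr hnn (K.Q_refl hi), ⟨f, hf, hh, p', hp', hpb⟩,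
      hS.congr haa (K.Q_refl hb) (K.Q_refl hi) (K.Q_refl hz)⟩

variable {w : W} {o z : X} (ho : K.D w o) (hω : K.Om w o) (hz : K.D w z) {I S C : Fml}
  (hR : K.RecData w o z I S C)

include ho hω hz hR

theorem rec_mem {n a : X} (hn : K.E w n o) (ha : K.D w a) (h : K.Rec I S w n a z) :
    K.F₂ C w a o := by
  -- the property `P` spells out what it means to force the formula that is proved by induction
  refine hK.omega_induction ho hω (P := fun v n => ∀ u, v ≤ u → ∀ a, K.D u a → ∀ t, u ≤ t →
      K.Rec I S t n a z → K.F₂ C t a o)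
    (all (imp (recF I S 1 0 2) (app₂ C 0 3))) (cons z fun _ => o) (D_cons hz fun _ => ho) ?_ ?_ ?_
    w le_rfl n hn w le_rfl a ha w le_rfl h
  · intro v _ x
    simp only [Forces, forces_recF, forces_app₂]
    exact Iff.rfl
  · intro v hv x hx hx0 u hu a ha t ht h
    have hvt := hv.trans (hu.trans ht)
    rcases hK.rec_inv (K.E_left (K.E_mono (hu.trans ht) hx)) (K.D_mono ht ha)
      (K.D_mono hvt hz) h with h | ⟨i, hi, b, hb, hs, -, -⟩
    · exact hR.init_mem t hvt a (K.D_mono ht ha) h.2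
    · exact absurd (hx0.mono (hu.trans ht)) (hs.not_zero hi)
  · intro v hv x y hx hy hxy ih u hu a ha t ht h
    have hvt := hv.trans (hu.trans ht)
    rcases hK.rec_inv (K.E_left (K.E_mono (hu.trans ht) hx)) (K.D_mono ht ha)
      (K.D_mono hvt hz) h with h | ⟨i, hi, b, hb, hs, hr, hS⟩
    · exact absurd h.1 ((hxy.mono (hu.trans ht)).not_zero (K.E_left (K.E_mono (hu.trans ht) hy)))
    · have hxt := K.E_mono (hu.trans ht) hx
      have hio : K.E t i o := hK.mem_omega_of_mem (K.D_mono hvt ho) (hω.mono hvt) hxt (hs.mem hi)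
      have hiy := hK.succ_inj (K.D_mono hvt ho) (hω.mono hvt) hio (K.E_mono (hu.trans ht) hy) hs
        (hxy.mono (hu.trans ht)) (K.Q_refl (K.E_left hxt))
      exact hR.step_mem t hvt i a b hio (K.D_mono ht ha) hb
        (ih t (hu.trans ht) b hb t le_rfl (hr.congr hiy (K.Q_refl hb))) hS

theorem rec_exists {n : X} (hn : K.E w n o) : ∃ a, K.D w a ∧ K.Rec I S w n a z := by
  refine hK.omega_induction ho hω (P := fun v n => ∃ a, K.D v a ∧ K.Rec I S v n a z)
    (ex (recF I S 1 0 2)) (fun _ => z) (fun _ => hz) ?_ ?_ ?_ w le_rfl n hn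
  · intro v _ x
    simp only [Forces, forces_recF]
    exact Iff.rfl
  · intro v hv x hx hx0
    obtain ⟨a, ha, hI⟩ := hR.init_exists v hv
    exact ⟨a, ha, hK.rec_zero (K.E_left hx) ha hx0 hI⟩
  · rintro v hv x y hx hy hxy ⟨b, hb, hr⟩
    obtain ⟨a, ha, hS⟩ := hR.step_exists v hv y b hy hb
      (hK.rec_mem (K.D_mono hv ho) (hω.mono hv) (K.D_mono hv hz) (hR.mono hv) hy hb hr)
    exact ⟨a, ha, hK.rec_succ (K.E_left hx) ha (K.E_left hy) hb hr hxy hS⟩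

theorem rec_unique {n a a' : X} (hn : K.E w n o) (ha : K.D w a) (ha' : K.D w a')
    (h : K.Rec I S w n a z) (h' : K.Rec I S w n a' z) : K.Q w a a' := by
  refine hK.omega_induction ho hω (P := fun v n => ∀ u, v ≤ u → ∀ a, K.D u a → ∀ t, u ≤ t →
      ∀ a', K.D t a' → ∀ s, t ≤ s → K.Rec I S s n a z ∧ K.Rec I S s n a' z → K.Q s a a')
    (all (all (imp (and (recF I S 2 1 3) (recF I S 2 0 3)) (eq 1 0)))) (fun _ => z) (fun _ => hz)
    ?_ ?_ ?_ w le_rfl n hn w le_rfl a ha w le_rfl a' ha' w le_rfl ⟨h, h'⟩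
  · intro v _ x
    simp only [Forces, forces_recF]
    exact Iff.rfl
  · rintro v hv x hx hx0 u hu a ha t ht a' ha' s hs ⟨h, h'⟩
    have hus := ht.trans hs
    have hvs := hv.trans (hu.trans hus)
    have hxs := K.E_left (K.E_mono (hu.trans hus) hx)
    have ha := K.D_mono hus ha
    have ha' := K.D_mono hs ha'
    have hI : ∀ a, K.D s a → K.Rec I S s x a z → K.F₂ I s a z := by
      intro a ha h
      rcases hK.rec_inv hxs ha (K.D_mono hvs hz) h with h | ⟨i, hi, b, hb, hs, -, -⟩
      · exact h.2
      · exact absurd (hx0.mono (hu.trans hus)) (hs.not_zero hi)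
    exact hR.init_unique s hvs a a' ha ha' (hI a ha h) (hI a' ha' h')
  · rintro v hv x y hx hy hxy ih u hu a ha t ht a' ha' s hs ⟨h, h'⟩
    have hus := ht.trans hs
    have hvs := hv.trans (hu.trans hus)
    have hxs := K.E_mono (hu.trans hus) hx
    have hys := K.E_mono (hu.trans hus) hy
    have hxys := hxy.mono (hu.trans hus)
    have ha := K.D_mono hus ha
    have ha' := K.D_mono hs ha'
    have hos := K.D_mono hvs ho
    have hωs := hω.mono hvs
    have hzs := K.D_mono hvs hz
    have hS : ∀ a, K.D s a → K.Rec I S s x a z →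
        ∃ b, K.D s b ∧ K.Rec I S s y b z ∧ K.F₄ S s a b y z := by
      intro a ha h
      rcases hK.rec_inv (K.E_left hxs) ha hzs h with h | ⟨i, hi, b, hb, hs, hr, hS⟩
      · exact absurd h.1 (hxys.not_zero (K.E_left hys))
      · have hio := hK.mem_omega_of_mem hos hωs hxs (hs.mem hi)
        have hiy := hK.succ_inj hos hωs hio hys hs hxys (K.Q_refl (K.E_left hxs))
        exact ⟨b, hb, hr.congr hiy (K.Q_refl hb),
          hS.congr (K.Q_refl ha) (K.Q_refl hb) hiy (K.Q_refl hzs)⟩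
    obtain ⟨b, hb, hr, hS₁⟩ := hS a ha h
    obtain ⟨b', hb', hr', hS₂⟩ := hS a' ha' h'
    have hbb := ih s (hu.trans hus) b hb s le_rfl b' hb' s le_rfl ⟨hr, hr'⟩
    exact hR.step_unique s hvs y a a' b' hys ha ha' hb'
      (hK.rec_mem hos hωs hzs (hR.mono hvs) hys hb' hr')
      (hS₁.congr (K.Q_refl ha) hbb (K.Q_refl (K.E_left hys)) (K.Q_refl hzs)) hS₂

end KFrame.IsModel

/-! ### The pairing function -/

theorem unpair_succ (n : ℕ) : Nat.unpair (n + 1) =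
    if (Nat.unpair n).1 + 1 < (Nat.unpair n).2 then ((Nat.unpair n).1 + 1, (Nat.unpair n).2)
    else if (Nat.unpair n).1 + 1 = (Nat.unpair n).2 then ((Nat.unpair n).2, 0)
    else if (Nat.unpair n).2 < (Nat.unpair n).1 then ((Nat.unpair n).1, (Nat.unpair n).2 + 1)
    else (0, (Nat.unpair n).2 + 1) := by
  obtain ⟨⟨a, b⟩, rfl⟩ : ∃ p : ℕ × ℕ, Nat.pair p.1 p.2 = n := ⟨Nat.unpair n, Nat.pair_unpair n⟩
  simp only [Nat.unpair_pair]
  have key : ∀ c d, Nat.pair a b + 1 = Nat.pair c d → Nat.unpair (Nat.pair a b + 1) = (c, d) := by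
    intro c d h
    rw [h, Nat.unpair_pair]
  split_ifs with h₁ h₂ h₃
  · refine key _ _ ?_
    rw [Nat.pair, Nat.pair, if_pos (by omega), if_pos h₁]
    ring
  · subst h₂
    refine key _ _ ?_
    rw [Nat.pair, Nat.pair, if_pos (by omega), if_neg (by omega)]
    ring
  · refine key _ _ ?_
    rw [Nat.pair, Nat.pair, if_neg (by omega), if_neg (by omega)]
    ring
  · obtain rfl : a = b := by omega
    refine key _ _ ?_
    rw [Nat.pair, Nat.pair, if_neg (by omega), if_pos (by omega)]
    ring

/-- `(a', b')` is the pair that follows `(a, b)` in the enumeration `Nat.unpair` of the pairs of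
natural numbers. -/
def isNextPair (a b a' b' : ℕ) : Fml :=
  Fml.or (and (isSucc a' a) (and (mem a' b) (eq b' b)))
    (Fml.or (and (isSucc b a) (and (eq a' b) (isEmpty b')))
      (Fml.or (and (mem b a) (and (eq a' a) (isSucc b' b)))
        (and (eq a b) (and (isEmpty a') (isSucc b' b)))))

/-- The initial value `⟨0, 0⟩` of the enumeration of the pairs. -/
def pairInit : Fml := ex (and (isEmpty 0) (isPair 1 0 0))

/-- The step of the enumeration of the pairs. -/
def pairStep : Fml :=
  ex (ex (ex (ex (and (isPair 5 3 2) (and (isPair 4 1 0) (isNextPair 3 2 1 0))))))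

/-- The class of the pairs of elements of `ω`. -/
def pairClass : Fml := bex 1 (bex 2 (isPair 2 1 0))

/-- The number `n` is the code of the pair of `a` and `b`. -/
def isCode (n a b : ℕ) : Fml :=
  ex (and (isPair 0 (a + 1) (b + 1)) (recF pairInit pairStep (n + 1) 0 (n + 1)))

namespace KFrame

variable {W X : Type} [Preorder W] (K : KFrame W X)

/-- The meaning of `isNextPair` at a world. -/
def NextPair (w : W) (a b a' b' : X) : Prop :=
  (K.Succ w a' a ∧ K.E w a' b ∧ K.Q w b' b) ∨ (K.Succ w b a ∧ K.Q w a' b ∧ K.Zero w b') ∨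
    (K.E w b a ∧ K.Q w a' a ∧ K.Succ w b' b) ∨ (K.Q w a b ∧ K.Zero w a' ∧ K.Succ w b' b)

/-- The meaning of `isCode` at a world. -/
def Code (w : W) (n a b : X) : Prop :=
  ∃ p, K.D w p ∧ K.Pair w p a b ∧ K.Rec pairInit pairStep w n p n

variable {K}

theorem forces_isNextPair {w : W} {a b a' b' : ℕ} {ρ : ℕ → X} :
    K.Forces w (isNextPair a b a' b') ρ ↔ K.NextPair w (ρ a) (ρ b) (ρ a') (ρ b') := by
  simp only [isNextPair, Forces, forces_isSucc, forces_isEmpty]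
  exact Iff.rfl

theorem f₂_pairInit {w : W} {a z : X} :
    K.F₂ pairInit w a z ↔ ∃ e, K.D w e ∧ K.Zero w e ∧ K.Pair w a e e := by
  simp only [F₂, pairInit, Forces, forces_isEmpty, forces_isPair]
  exact Iff.rfl

theorem f₄_pairStep {w : W} {p' p i z : X} : K.F₄ pairStep w p' p i z ↔
    ∃ a, K.D w a ∧ ∃ b, K.D w b ∧ ∃ a', K.D w a' ∧ ∃ b', K.D w b' ∧ K.Pair w p a b ∧
      K.Pair w p' a' b' ∧ K.NextPair w a b a' b' := by
  simp only [F₄, pairStep, Forces, forces_isNextPair, forces_isPair]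
  exact Iff.rfl

theorem f₂_pairClass {w : W} {p o : X} :
    K.F₂ pairClass w p o ↔ ∃ a, K.E w a o ∧ ∃ b, K.E w b o ∧ K.Pair w p a b := by
  simp only [F₂, pairClass, forces_bex, forces_isPair]
  exact Iff.rfl

theorem forces_isCode {w : W} {n a b : ℕ} {ρ : ℕ → X} :
    K.Forces w (isCode n a b) ρ ↔ K.Code w (ρ n) (ρ a) (ρ b) := by
  simp only [isCode, Forces, forces_isPair, forces_recF]
  exact Iff.rfl

theorem rec_pair_param {w : W} {n p z z' : X} (h : K.Rec pairInit pairStep w n p z) :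
    K.Rec pairInit pairStep w n p z' := by
  simpa only [Rec, Hist, f₂_pairInit, f₄_pairStep] using h

theorem Code.mono {w v : W} {n a b : X} (h : K.Code w n a b) (hv : w ≤ v) : K.Code v n a b := by
  obtain ⟨p, hp, hpa, hr⟩ := h
  exact ⟨p, K.D_mono hv hp, hpa.mono hv, hr.mono hv⟩

theorem Code.congr {w : W} {n a b n' a' b' : X} (h : K.Code w n a b) (hn : K.Q w n n')
    (ha : K.Q w a a') (hb : K.Q w b b') : K.Code w n' a' b' := by
  obtain ⟨p, hp, hpa, hr⟩ := h
  exact ⟨p, hp, hpa.congr (K.Q_refl hp) ha hb, rec_pair_param (hr.congr hn (K.Q_refl hp))⟩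

theorem NextPair.congr {w : W} {a b a' b' c d c' d' : X} (h : K.NextPair w a b a' b')
    (ha : K.Q w a c) (hb : K.Q w b d) (ha' : K.Q w a' c') (hb' : K.Q w b' d') :
    K.NextPair w c d c' d' := by
  have hQ : ∀ {x y x' y' : X}, K.Q w x x' → K.Q w y y' → K.Q w x y → K.Q w x' y' :=
    fun hx hy h => K.Q_trans (K.Q_symm hx) (K.Q_trans h hy)
  rcases h with ⟨h₁, h₂, h₃⟩ | ⟨h₁, h₂, h₃⟩ | ⟨h₁, h₂, h₃⟩ | ⟨h₁, h₂, h₃⟩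
  · exact Or.inl ⟨h₁.congr ha' ha, K.E_congr ha' hb h₂, hQ hb' hb h₃⟩
  · exact Or.inr (Or.inl ⟨h₁.congr hb ha, hQ ha' hb h₂, h₃.congr hb'⟩)
  · exact Or.inr (Or.inr (Or.inl ⟨K.E_congr hb ha h₁, hQ ha' ha h₂, h₃.congr hb' hb⟩))
  · exact Or.inr (Or.inr (Or.inr ⟨hQ ha hb h₁, h₂.congr ha', h₃.congr hb' hb⟩))

end KFrame

namespace KFrame.IsModel

variable {W X : Type} [Preorder W] {K : KFrame W X} (hK : K.IsModel)
  {w : W} {o : X} (ho : K.D w o) (hω : K.Om w o)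

include hK ho hω

theorem nextPair_exists {a b : X} (ha : K.E w a o) (hb : K.E w b o) :
    ∃ a', K.E w a' o ∧ ∃ b', K.E w b' o ∧ K.NextPair w a b a' b' := by
  obtain ⟨z, hz, hz0⟩ := hK.exists_zero ho
  obtain ⟨s, hs, hsa⟩ := hK.exists_succ (K.E_left ha)
  obtain ⟨t, ht, htb⟩ := hK.exists_succ (K.E_left hb)
  have hzo := zero_mem hω hz hz0
  have hso := succ_mem hω hs ha hsa
  have hto := succ_mem hω ht hb htb
  rcases hK.trichotomy ho hω ha hb with h | h | h
  · rcases hK.succ_eq_or_mem ho hω hs hsa hb h with h | h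
    · exact ⟨s, hso, b, hb, Or.inl ⟨hsa, h, K.Q_refl (K.E_left hb)⟩⟩
    · exact ⟨b, hb, z, hzo, Or.inr (Or.inl ⟨hsa.congr h (K.Q_refl (K.E_left ha)),
        K.Q_refl (K.E_left hb), hz0⟩)⟩
  · exact ⟨z, hzo, t, hto, Or.inr (Or.inr (Or.inr ⟨h, hz0, htb⟩))⟩
  · exact ⟨a, ha, t, hto, Or.inr (Or.inr (Or.inl ⟨h, K.Q_refl (K.E_left ha), htb⟩))⟩

omit hK ho in
theorem nextPair_mem {a b a' b' : X} (ha : K.E w a o) (hb : K.E w b o) (ha' : K.D w a')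
    (hb' : K.D w b') (h : K.NextPair w a b a' b') : K.E w a' o ∧ K.E w b' o := by
  rcases h with ⟨h₁, h₂, h₃⟩ | ⟨h₁, h₂, h₃⟩ | ⟨h₁, h₂, h₃⟩ | ⟨h₁, h₂, h₃⟩
  · exact ⟨succ_mem hω ha' ha h₁, E_congr_left (K.Q_symm h₃) hb⟩
  · exact ⟨E_congr_left (K.Q_symm h₂) hb, zero_mem hω hb' h₃⟩
  · exact ⟨E_congr_left (K.Q_symm h₂) ha, succ_mem hω hb' hb h₃⟩
  · exact ⟨zero_mem hω ha' h₂, succ_mem hω hb' hb h₃⟩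

omit hK ho hω in
theorem nextPair_not_zero {a b a' b' : X} (ha : K.E w a o) (hb : K.E w b o)
    (h : K.NextPair w a b a' b') : ¬ (K.Zero w a' ∧ K.Zero w b') := by
  rintro ⟨h₀, h₀'⟩
  rcases h with ⟨h₁, h₂, h₃⟩ | ⟨h₁, h₂, h₃⟩ | ⟨h₁, h₂, h₃⟩ | ⟨h₁, h₂, h₃⟩
  · exact h₁.not_zero (K.E_left ha) h₀
  · exact h₁.not_zero (K.E_left ha) (h₀.congr h₂)
  · exact h₃.not_zero (K.E_left hb) h₀'
  · exact h₃.not_zero (K.E_left hb) h₀'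

theorem nextPair_unique {a b a' b' c' d' : X} (ha : K.E w a o) (hb : K.E w b o)
    (ha' : K.E w a' o) (hb' : K.E w b' o) (hc' : K.E w c' o) (hd' : K.E w d' o)
    (h : K.NextPair w a b a' b') (h' : K.NextPair w a b c' d') : K.Q w a' c' ∧ K.Q w b' d' := by
  have asymm : ∀ {x y}, K.E w x o → K.E w x y → ¬ K.E w y x := fun hx h h' =>
    hK.mem_irrefl (hK.mem_trans ho hω hx h' h)
  have ne : ∀ {x y}, K.E w x y → ¬ K.Q w x y := fun h h' => hK.mem_irrefl (E_congr_left h' h)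
  have ne' : ∀ {x y}, K.E w x y → ¬ K.Q w y x := fun h h' => ne h (K.Q_symm h')
  have lt : ∀ {x}, K.Succ w x a → K.E w x b → K.E w a b := fun h h' =>
    hK.mem_trans ho hω hb h' (h.mem (K.E_left ha))
  have succ : ∀ {x x' y}, K.E w x o → K.E w x' o → K.D w y → K.Succ w x y → K.Succ w x' y →
      K.Q w x x' := fun hx hx' hy h h' =>
    hK.succ_unique (K.E_left hx) (K.E_left hx') h h' (K.Q_refl hy)
  have gap : ∀ {x}, K.E w x o → K.Succ w x a → K.E w x b → ¬ K.Succ w b a := fun hx h h' h'' =>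
    ne h' (succ hx hb (K.E_left ha) h h'')
  have haD := K.E_left ha
  have hbD := K.E_left hb
  rcases h with ⟨h₁, h₂, h₃⟩ | ⟨h₁, h₂, h₃⟩ | ⟨h₁, h₂, h₃⟩ | ⟨h₁, h₂, h₃⟩
  · rcases h' with ⟨h₄, h₅, h₆⟩ | ⟨h₄, h₅, h₆⟩ | ⟨h₄, h₅, h₆⟩ | ⟨h₄, h₅, h₆⟩
    · exact ⟨succ ha' hc' haD h₁ h₄, K.Q_trans h₃ (K.Q_symm h₆)⟩
    · exact absurd h₄ (gap ha' h₁ h₂)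
    · exact absurd h₄ (asymm ha (lt h₁ h₂))
    · exact absurd h₄ (ne (lt h₁ h₂))
  · rcases h' with ⟨h₄, h₅, h₆⟩ | ⟨h₄, h₅, h₆⟩ | ⟨h₄, h₅, h₆⟩ | ⟨h₄, h₅, h₆⟩
    · exact absurd h₁ (gap hc' h₄ h₅)
    · exact ⟨K.Q_trans h₂ (K.Q_symm h₅), hK.zero_unique (K.E_left hb') (K.E_left hd') h₃ h₆⟩
    · exact absurd h₄ (asymm ha (h₁.mem haD))
    · exact absurd h₄ (ne (h₁.mem haD))
  · rcases h' with ⟨h₄, h₅, h₆⟩ | ⟨h₄, h₅, h₆⟩ | ⟨h₄, h₅, h₆⟩ | ⟨h₄, h₅, h₆⟩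
    · exact absurd h₁ (asymm ha (lt h₄ h₅))
    · exact absurd h₁ (asymm ha (h₄.mem haD))
    · exact ⟨K.Q_trans h₂ (K.Q_symm h₅), succ hb' hd' hbD h₃ h₆⟩
    · exact absurd h₄ (ne' h₁)
  · rcases h' with ⟨h₄, h₅, h₆⟩ | ⟨h₄, h₅, h₆⟩ | ⟨h₄, h₅, h₆⟩ | ⟨h₄, h₅, h₆⟩
    · exact absurd h₁ (ne (lt h₄ h₅))
    · exact absurd h₁ (ne (h₄.mem haD))
    · exact absurd h₁ (ne' h₄)
    · exact ⟨hK.zero_unique (K.E_left ha') (K.E_left hc') h₂ h₅, succ hb' hd' hbD h₃ h₆⟩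

theorem nextPair_inj {a b a' b' c d : X} (ha : K.E w a o) (hb : K.E w b o)
    (ha' : K.E w a' o) (hb' : K.E w b' o) (hc : K.E w c o) (hd : K.E w d o)
    (h : K.NextPair w a b a' b') (h' : K.NextPair w c d a' b') : K.Q w a c ∧ K.Q w b d := by
  have key : ∀ {b c d : X}, K.E w d o → K.E w a' b → K.Q w b' b → K.E w d c → K.Q w a' c →
      K.Succ w b' d → False := by
    intro b c d hd h₂ h₃ h₄ h₅ h₆
    have h₇ := E_congr_right (K.Q_symm h₅) h₄
    rcases (h₆ w le_rfl a' (K.E_left ha')).1 (E_congr_right (K.Q_symm h₃) h₂) with h | h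
    · exact hK.mem_irrefl (hK.mem_trans ho hω hd h h₇)
    · exact hK.mem_irrefl (E_congr_right h h₇)
  have ra := K.Q_refl (K.E_left ha')
  have rb := K.Q_refl (K.E_left hb')
  have haD := K.E_left ha
  have hbD := K.E_left hb
  have hcD := K.E_left hc
  have hdD := K.E_left hd
  rcases h with ⟨h₁, h₂, h₃⟩ | ⟨h₁, h₂, h₃⟩ | ⟨h₁, h₂, h₃⟩ | ⟨h₁, h₂, h₃⟩
  · rcases h' with ⟨h₄, h₅, h₆⟩ | ⟨h₄, h₅, h₆⟩ | ⟨h₄, h₅, h₆⟩ | ⟨h₄, h₅, h₆⟩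
    · exact ⟨hK.succ_inj ho hω ha hc h₁ h₄ ra, K.Q_trans (K.Q_symm h₃) h₆⟩
    · exact absurd (E_congr_right (K.Q_symm h₃) h₂) (h₆ w le_rfl a')
    · exact (key hd h₂ h₃ h₄ h₅ h₆).elim
    · exact absurd h₅ (h₁.not_zero haD)
  · rcases h' with ⟨h₄, h₅, h₆⟩ | ⟨h₄, h₅, h₆⟩ | ⟨h₄, h₅, h₆⟩ | ⟨h₄, h₅, h₆⟩
    · exact absurd (E_congr_right (K.Q_symm h₆) h₅) (h₃ w le_rfl a')
    · have hbd := K.Q_trans (K.Q_symm h₂) h₅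
      exact ⟨hK.succ_inj ho hω ha hc h₁ h₄ hbd, hbd⟩
    · exact absurd h₃ (h₆.not_zero hdD)
    · exact absurd h₃ (h₆.not_zero hdD)
  · rcases h' with ⟨h₄, h₅, h₆⟩ | ⟨h₄, h₅, h₆⟩ | ⟨h₄, h₅, h₆⟩ | ⟨h₄, h₅, h₆⟩
    · exact (key hb h₅ h₆ h₁ h₂ h₃).elim
    · exact absurd h₆ (h₃.not_zero hbD)
    · exact ⟨K.Q_trans (K.Q_symm h₂) h₅, hK.succ_inj ho hω hb hd h₃ h₆ rb⟩
    · exact absurd (E_congr_right (K.Q_symm h₂) h₁) (h₅ w le_rfl b)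
  · rcases h' with ⟨h₄, h₅, h₆⟩ | ⟨h₄, h₅, h₆⟩ | ⟨h₄, h₅, h₆⟩ | ⟨h₄, h₅, h₆⟩
    · exact absurd h₂ (h₄.not_zero hcD)
    · exact absurd h₆ (h₃.not_zero hbD)
    · exact absurd (E_congr_right (K.Q_symm h₅) h₄) (h₂ w le_rfl d)
    · have hbd := hK.succ_inj ho hω hb hd h₃ h₆ rb
      exact ⟨K.Q_trans h₁ (K.Q_trans hbd (K.Q_symm h₄)), hbd⟩

theorem recData_pair : K.RecData w o o pairInit pairStep pairClass where
  init_exists v hv := by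
    obtain ⟨e, he, he0⟩ := hK.exists_zero (K.D_mono hv ho)
    obtain ⟨p, hp, hpe⟩ := hK.exists_pair he he
    exact ⟨p, hp, f₂_pairInit.2 ⟨e, he, he0, hpe⟩⟩
  init_mem v hv p _ h := by
    obtain ⟨e, he, he0, hpe⟩ := f₂_pairInit.1 h
    have heo := zero_mem (hω.mono hv) he he0
    exact f₂_pairClass.2 ⟨e, heo, e, heo, hpe⟩
  init_unique v hv p p' hp hp' h h' := by
    obtain ⟨e, he, he0, hpe⟩ := f₂_pairInit.1 h
    obtain ⟨e', he', he0', hpe'⟩ := f₂_pairInit.1 h'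
    have hee := hK.zero_unique he he' he0 he0'
    exact hK.pair_unique hp hp' (hpe.congr (K.Q_refl hp) hee hee) hpe'
  step_exists v hv i p hi hp h := by
    obtain ⟨a, ha, b, hb, hpa⟩ := f₂_pairClass.1 h
    obtain ⟨a', ha', b', hb', hs⟩ := hK.nextPair_exists (K.D_mono hv ho) (hω.mono hv) ha hb
    obtain ⟨p', hp', hpa'⟩ := hK.exists_pair (K.E_left ha') (K.E_left hb')
    exact ⟨p', hp', f₄_pairStep.2 ⟨a, K.E_left ha, b, K.E_left hb, a', K.E_left ha', b',
      K.E_left hb', hpa, hpa', hs⟩⟩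
  step_mem v hv i p' p hi hp' hp h hS := by
    obtain ⟨c, hc, d, hd, hpc⟩ := f₂_pairClass.1 h
    obtain ⟨a, ha, b, hb, a', ha', b', hb', hpa, hpa', hs⟩ := f₄_pairStep.1 hS
    obtain ⟨hca, hdb⟩ := hK.pair_inj (K.E_left hc) (K.E_left hd) ha hb hpc hpa
    obtain ⟨h₁, h₂⟩ := nextPair_mem (hω.mono hv) (E_congr_left hca hc) (E_congr_left hdb hd)
      ha' hb' hs
    exact f₂_pairClass.2 ⟨a', h₁, b', h₂, hpa'⟩
  step_unique v hv i p' p'' p hi hp' hp'' hp h hS hS' := by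
    obtain ⟨c, hc, d, hd, hpc⟩ := f₂_pairClass.1 h
    obtain ⟨a₁, ha₁, b₁, hb₁, a', ha', b', hb', hpa₁, hpa', hs⟩ := f₄_pairStep.1 hS
    obtain ⟨a₂, ha₂, b₂, hb₂, a'', ha'', b'', hb'', hpa₂, hpa'', hs'⟩ := f₄_pairStep.1 hS'
    obtain ⟨hca₁, hdb₁⟩ := hK.pair_inj ha₁ hb₁ (K.E_left hc) (K.E_left hd) hpa₁ hpc
    obtain ⟨hca₂, hdb₂⟩ := hK.pair_inj ha₂ hb₂ (K.E_left hc) (K.E_left hd) hpa₂ hpc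
    have hs := hs.congr hca₁ hdb₁ (K.Q_refl ha') (K.Q_refl hb')
    have hs' := hs'.congr hca₂ hdb₂ (K.Q_refl ha'') (K.Q_refl hb'')
    obtain ⟨h₁, h₂⟩ := nextPair_mem (hω.mono hv) hc hd ha' hb' hs
    obtain ⟨h₃, h₄⟩ := nextPair_mem (hω.mono hv) hc hd ha'' hb'' hs'
    obtain ⟨h₅, h₆⟩ := hK.nextPair_unique (K.D_mono hv ho) (hω.mono hv) hc hd h₁ h₂ h₃ h₄ hs hs'
    exact hK.pair_unique hp' hp'' (hpa'.congr (K.Q_refl hp') h₅ h₆) hpa''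

omit ho hω in
theorem code_zero {n a b : X} (hn : K.D w n) (ha : K.D w a) (hb : K.D w b) (h : K.Zero w n)
    (ha0 : K.Zero w a) (hb0 : K.Zero w b) : K.Code w n a b := by
  obtain ⟨p, hp, hpa⟩ := hK.exists_pair ha hb
  refine ⟨p, hp, hpa, hK.rec_zero hn hp h (f₂_pairInit.2 ⟨a, ha, ha0, ?_⟩)⟩
  exact hpa.congr (K.Q_refl hp) (K.Q_refl ha) (hK.zero_unique hb ha hb0 ha0)

omit ho hω in
theorem code_succ {n i a b a' b' : X} (hn : K.D w n) (hi : K.D w i) (ha : K.D w a) (hb : K.D w b)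
    (ha' : K.D w a') (hb' : K.D w b') (hni : K.Succ w n i) (h : K.Code w i a b)
    (hs : K.NextPair w a b a' b') : K.Code w n a' b' := by
  obtain ⟨p, hp, hpa, hr⟩ := h
  obtain ⟨p', hp', hpa'⟩ := hK.exists_pair ha' hb'
  exact ⟨p', hp', hpa', hK.rec_succ hn hp' hi hp (rec_pair_param hr) hni
    (f₄_pairStep.2 ⟨a, ha, b, hb, a', ha', b', hb', hpa, hpa', hs⟩)⟩

theorem code_exists {n : X} (hn : K.E w n o) :
    ∃ a, K.E w a o ∧ ∃ b, K.E w b o ∧ K.Code w n a b := by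
  have hR := hK.recData_pair ho hω
  obtain ⟨p, hp, hr⟩ := hK.rec_exists ho hω ho hR hn
  obtain ⟨a, ha, b, hb, hpa⟩ := f₂_pairClass.1 (hK.rec_mem ho hω ho hR hn hp hr)
  exact ⟨a, ha, b, hb, p, hp, hpa, rec_pair_param hr⟩

theorem code_mem {n a b : X} (hn : K.E w n o) (ha : K.D w a) (hb : K.D w b)
    (h : K.Code w n a b) : K.E w a o ∧ K.E w b o := by
  obtain ⟨p, hp, hpa, hr⟩ := h
  obtain ⟨a', ha', b', hb', hpa'⟩ := f₂_pairClass.1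
    (hK.rec_mem ho hω ho (hK.recData_pair ho hω) hn hp (rec_pair_param hr))
  obtain ⟨h₁, h₂⟩ := hK.pair_inj (K.E_left ha') (K.E_left hb') ha hb hpa' hpa
  exact ⟨E_congr_left h₁ ha', E_congr_left h₂ hb'⟩

theorem code_unique {n a b a' b' : X} (hn : K.E w n o) (ha : K.D w a) (hb : K.D w b)
    (ha' : K.D w a') (hb' : K.D w b') (h : K.Code w n a b) (h' : K.Code w n a' b') :
    K.Q w a a' ∧ K.Q w b b' := by
  obtain ⟨p, hp, hpa, hr⟩ := h
  obtain ⟨p', hp', hpa', hr'⟩ := h'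
  have hpp := hK.rec_unique ho hω ho (hK.recData_pair ho hω) hn hp hp' (rec_pair_param hr)
    (rec_pair_param hr')
  exact hK.pair_inj ha hb ha' hb' (hpa.congr hpp (K.Q_refl ha) (K.Q_refl hb)) hpa'

theorem code_inv {n a b : X} (hn : K.E w n o) (ha : K.D w a) (hb : K.D w b)
    (h : K.Code w n a b) : (K.Zero w n ∧ K.Zero w a ∧ K.Zero w b) ∨
      ∃ i, K.E w i o ∧ K.Succ w n i ∧ ∃ c, K.E w c o ∧ ∃ d, K.E w d o ∧ K.Code w i c d ∧
        K.NextPair w c d a b := by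
  obtain ⟨p, hp, hpa, hr⟩ := h
  rcases hK.rec_inv (K.E_left hn) hp (K.E_left hn) hr with ⟨h₀, hI⟩ | ⟨i, hi, q, hq, hs, hr', hS⟩
  · obtain ⟨e, he, he0, hpe⟩ := f₂_pairInit.1 hI
    obtain ⟨h₁, h₂⟩ := hK.pair_inj he he ha hb hpe hpa
    exact Or.inl ⟨h₀, he0.congr h₁, he0.congr h₂⟩
  · obtain ⟨c, hc, d, hd, a', ha', b', hb', hqc, hpa', hn'⟩ := f₄_pairStep.1 hS
    obtain ⟨h₁, h₂⟩ := hK.pair_inj ha' hb' ha hb hpa' hpa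
    have hio := hK.mem_omega_of_mem ho hω hn (hs.mem hi)
    have hcode : K.Code w i c d := ⟨q, hq, hqc, rec_pair_param hr'⟩
    obtain ⟨hco, hdo⟩ := hK.code_mem ho hω hio hc hd hcode
    exact Or.inr ⟨i, hio, hs, c, hco, d, hdo, hcode,
      hn'.congr (K.Q_refl hc) (K.Q_refl hd) h₁ h₂⟩

theorem code_inj {n n' a b : X} (hn : K.E w n o) (hn' : K.E w n' o) (ha : K.D w a) (hb : K.D w b)
    (h : K.Code w n a b) (h' : K.Code w n' a b) : K.Q w n n' := by
  refine hK.omega_induction ho hω (P := fun v n => ∀ u, v ≤ u → ∀ n', K.E u n' o → ∀ t, u ≤ t →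
      ∀ a, K.D t a → ∀ s, t ≤ s → ∀ b, K.D s b → ∀ r, s ≤ r → K.Code r n a b ∧ K.Code r n' a b →
        K.Q r n n')
    (ball 1 (all (all (imp (and (isCode 3 1 0) (isCode 2 1 0)) (eq 3 2))))) (fun _ => o)
    (fun _ => ho) ?_ ?_ ?_ w le_rfl n hn w le_rfl n' hn' w le_rfl a ha w le_rfl b hb w le_rfl
    ⟨h, h'⟩
  · intro v _ x
    simp only [forces_ball, Forces, forces_isCode]
    exact Iff.rfl
  · rintro v hv x hx hx0 u hu n' hn' t ht a ha s hs b hb r hr ⟨h, h'⟩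
    have hur := ht.trans (hs.trans hr)
    have hvr := hv.trans (hu.trans hur)
    have hor := K.D_mono hvr ho
    have hωr := hω.mono hvr
    have hxr := K.E_mono (hu.trans hur) hx
    have hnr := K.E_mono hur hn'
    have ha := K.D_mono (hs.trans hr) ha
    have hb := K.D_mono hr hb
    rcases hK.code_inv hor hωr hxr ha hb h with ⟨_, h₁, h₂⟩ | ⟨i, hi, hs', -⟩
    · rcases hK.code_inv hor hωr hnr ha hb h' with ⟨h₃, _⟩ | ⟨i, hi, hs', c, hc, d, hd, -, hst⟩
      · exact hK.zero_unique (K.E_left hxr) (K.E_left hnr) (hx0.mono (hu.trans hur)) h₃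
      · exact absurd ⟨h₁, h₂⟩ (nextPair_not_zero hc hd hst)
    · exact absurd (hx0.mono (hu.trans hur)) (hs'.not_zero (K.E_left hi))
  · rintro v hv x y hx hy hxy ih u hu n' hn' t ht a ha s hs b hb r hr ⟨h, h'⟩
    have hur := ht.trans (hs.trans hr)
    have hvr := hv.trans (hu.trans hur)
    have hor := K.D_mono hvr ho
    have hωr := hω.mono hvr
    have hxr := K.E_mono (hu.trans hur) hx
    have hyr := K.E_mono (hu.trans hur) hy
    have hxyr := hxy.mono (hu.trans hur)
    have hnr := K.E_mono hur hn'
    have ha := K.D_mono (hs.trans hr) ha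
    have hb := K.D_mono hr hb
    rcases hK.code_inv hor hωr hxr ha hb h with ⟨h₁, -⟩ | ⟨i, hi, hsi, c, hc, d, hd, hic, hst⟩
    · exact absurd h₁ (hxyr.not_zero (K.E_left hyr))
    obtain ⟨hao, hbo⟩ := nextPair_mem hωr hc hd ha hb hst
    rcases hK.code_inv hor hωr hnr ha hb h' with ⟨-, h₁, h₂⟩ |
      ⟨j, hj, hsj, c', hc', d', hd', hjc, hst'⟩
    · exact absurd ⟨h₁, h₂⟩ (nextPair_not_zero hc hd hst)
    obtain ⟨hcc, hdd⟩ := hK.nextPair_inj hor hωr hc' hd' hao hbo hc hd hst' hst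
    have hiy := hK.succ_inj hor hωr hi hyr hsi hxyr (K.Q_refl (K.E_left hxr))
    have hyj := ih r (hu.trans hur) j hj r le_rfl c (K.E_left hc) r le_rfl d (K.E_left hd) r le_rfl
      ⟨hic.congr hiy (K.Q_refl (K.E_left hc)) (K.Q_refl (K.E_left hd)),
        hjc.congr (K.Q_refl (K.E_left hj)) hcc hdd⟩
    exact hK.succ_unique (K.E_left hxr) (K.E_left hnr) hxyr hsj hyj

omit ho in
/-- Every step of the enumeration leads from a coded pair to a coded pair. -/
theorem exists_code_nextPair {a b a' b' : X} (ha : K.D w a) (hb : K.D w b) (ha' : K.D w a')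
    (hb' : K.D w b') (h : ∃ n, K.E w n o ∧ K.Code w n a b) (hs : K.NextPair w a b a' b') :
    ∃ n, K.E w n o ∧ K.Code w n a' b' := by
  obtain ⟨n, hn, h⟩ := h
  obtain ⟨m, hm, hmn⟩ := hK.exists_succ (K.E_left hn)
  exact ⟨m, succ_mem hω hm hn hmn, hK.code_succ hm (K.E_left hn) ha hb ha' hb' hmn h hs⟩

theorem exists_code_of_lt {m z : X} (hm : K.E w m o) (hz : K.D w z) (hz0 : K.Zero w z)
    (h : ∃ n, K.E w n o ∧ K.Code w n z m) {a : X} (ham : K.E w a m) :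
    ∃ n, K.E w n o ∧ K.Code w n a m := by
  have hao := hK.mem_omega_of_mem ho hω hm ham
  have hmD := K.E_left hm
  refine hK.omega_induction ho hω (P := fun v a => ∀ u, v ≤ u → K.E u a m →
      ∃ n, K.E u n o ∧ K.Code u n a m)
    (imp (mem 0 1) (bex 2 (isCode 0 1 2))) (cons m fun _ => o) (D_cons hmD fun _ => ho) ?_ ?_ ?_
    w le_rfl a hao w le_rfl ham
  · intro v _ x
    simp only [forces_bex, Forces, forces_isCode]
    exact Iff.rfl
  · intro v hv x hx hx0 u hu hxm
    obtain ⟨n, hn, h⟩ := h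
    have hvu := hv.trans hu
    exact ⟨n, K.E_mono hvu hn, (h.mono hvu).congr (K.Q_refl (K.E_left (K.E_mono hvu hn)))
      (hK.zero_unique (K.D_mono hvu hz) (K.E_left hxm) (hz0.mono hvu) (hx0.mono hu))
      (K.Q_refl (K.D_mono hvu hmD))⟩
  · intro v hv x y hx hy hxy ih u hu hxm
    have hvu := hv.trans hu
    have hou := K.D_mono hvu ho
    have hωu := hω.mono hvu
    have hyu := K.E_left (K.E_mono hu hy)
    have hmu := K.D_mono hvu hmD
    have hym : K.E u y m := hK.mem_trans hou hωu (K.E_mono hvu hm) hxm ((hxy.mono hu).mem hyu)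
    exact hK.exists_code_nextPair hωu hyu hmu (K.E_left hxm) hmu (ih u hu hym)
      (Or.inl ⟨hxy.mono hu, hxm, K.Q_refl hmu⟩)

theorem exists_code_of_le {m z : X} (hm : K.E w m o) (hz : K.D w z) (hz0 : K.Zero w z)
    (h : ∃ n, K.E w n o ∧ K.Code w n z m) {b : X} (hb : K.E w b o)
    (hbm : K.E w b m ∨ K.Q w b m) :
    ∃ n, K.E w n o ∧ K.Code w n m b := by
  have hmD := K.E_left hm
  -- the pair `(m, 0)`
  have h₀ : ∃ n, K.E w n o ∧ K.Code w n m z := by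
    rcases zero_or_succ hω hm with hm0 | ⟨y, hy, hmy⟩
    · obtain ⟨n, hn, h⟩ := h
      have hmz := hK.zero_unique hmD hz hm0 hz0
      exact ⟨n, hn, h.congr (K.Q_refl (K.E_left hn)) (K.Q_symm hmz) hmz⟩
    · exact hK.exists_code_nextPair hω (K.E_left hy) hmD hmD hz
        (hK.exists_code_of_lt ho hω hm hz hz0 h (hmy.mem (K.E_left hy)))
        (Or.inr (Or.inl ⟨hmy, K.Q_refl hmD, hz0⟩))
  refine hK.omega_induction ho hω (P := fun v b => ∀ u, v ≤ u → (K.E u b m ∨ K.Q u b m) →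
      ∃ n, K.E u n o ∧ K.Code u n m b)
    (imp (Fml.or (mem 0 1) (eq 0 1)) (bex 2 (isCode 0 2 1))) (cons m fun _ => o)
    (D_cons hmD fun _ => ho) ?_ ?_ ?_ w le_rfl b hb w le_rfl hbm
  · intro v _ x
    simp only [forces_bex, Forces, forces_isCode]
    exact Iff.rfl
  · intro v hv x hx hx0 u hu _
    obtain ⟨n, hn, h⟩ := h₀
    have hvu := hv.trans hu
    exact ⟨n, K.E_mono hvu hn, (h.mono hvu).congr (K.Q_refl (K.E_left (K.E_mono hvu hn)))
      (K.Q_refl (K.D_mono hvu hmD)) (hK.zero_unique (K.D_mono hvu hz) (K.E_left (K.E_mono hu hx))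
        (hz0.mono hvu) (hx0.mono hu))⟩
  · intro v hv x y hx hy hxy ih u hu hxm
    have hvu := hv.trans hu
    have hou := K.D_mono hvu ho
    have hωu := hω.mono hvu
    have hyu := K.E_left (K.E_mono hu hy)
    have hmu := K.D_mono hvu hmD
    have hyx := (hxy.mono hu).mem hyu
    have hym : K.E u y m := by
      rcases hxm with hxm | hxm
      · exact hK.mem_trans hou hωu (K.E_mono hvu hm) hxm hyx
      · exact E_congr_right hxm hyx
    exact hK.exists_code_nextPair hωu hmu hyu hmu (K.E_left (K.E_mono hu hx))
      (ih u hu (Or.inl hym)) (Or.inr (Or.inr (Or.inl ⟨hym, K.Q_refl hmu, hxy.mono hu⟩)))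

/-- The enumeration reaches `(0, m)` for every `m`: after `(0, m)` it runs through the pairs
`(a, m)` with `a < m`, then through the pairs `(m, b)` with `b ≤ m`, and then comes `(0, m + 1)`. -/
theorem exists_code_zero_left {z m : X} (hz : K.D w z) (hz0 : K.Zero w z) (hm : K.E w m o) :
    ∃ n, K.E w n o ∧ K.Code w n z m := by
  refine hK.omega_induction ho hω (P := fun v m => ∃ n, K.E v n o ∧ K.Code v n z m)
    (bex 1 (isCode 0 3 1)) (cons o fun _ => z)
    (D_cons ho fun _ => hz) ?_ ?_ ?_ w le_rfl m hm
  · intro v _ x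
    simp only [forces_bex, forces_isCode]
    exact Iff.rfl
  · intro v hv x hx hx0
    have hzv := K.D_mono hv hz
    exact ⟨z, zero_mem (hω.mono hv) hzv (hz0.mono hv),
      hK.code_zero hzv hzv (K.E_left hx) (hz0.mono hv) (hz0.mono hv) hx0⟩
  · intro v hv x y hx hy hxy ih
    have hov := K.D_mono hv ho
    have hωv := hω.mono hv
    have hzv := K.D_mono hv hz
    have hyv := K.E_left hy
    exact hK.exists_code_nextPair hωv hyv hyv hzv (K.E_left hx)
      (hK.exists_code_of_le hov hωv hy hzv (hz0.mono hv) ih hy (Or.inr (K.Q_refl hyv)))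
      (Or.inr (Or.inr (Or.inr ⟨K.Q_refl hyv, hz0.mono hv, hxy⟩)))

theorem code_surj {a b : X} (ha : K.E w a o) (hb : K.E w b o) :
    ∃ n, K.E w n o ∧ K.Code w n a b := by
  obtain ⟨z, hz, hz0⟩ := hK.exists_zero ho
  have h₀ : ∀ {m}, K.E w m o → ∃ n, K.E w n o ∧ K.Code w n z m := fun hm =>
    hK.exists_code_zero_left ho hω hz hz0 hm
  rcases hK.trichotomy ho hω ha hb with h | h | h
  · exact hK.exists_code_of_lt ho hω hb hz hz0 (h₀ hb) h
  · exact hK.exists_code_of_le ho hω ha hz hz0 (h₀ ha) hb (Or.inr (K.Q_symm h))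
  · exact hK.exists_code_of_le ho hω ha hz hz0 (h₀ ha) hb (Or.inl h)

/-! ### Numerals -/

omit ho hω in
theorem num_unique {n : ℕ} : ∀ {x y : X}, K.D w x → K.D w y → K.Num w n x → K.Num w n y →
    K.Q w x y := by
  induction n with
  | zero => intro x y hx hy h h'; exact hK.zero_unique hx hy h h'
  | succ n ih =>
    rintro x y hx hy ⟨x', hx', h, hs⟩ ⟨y', hy', h', hs'⟩
    exact hK.succ_unique hx hy hs hs' (ih hx' hy' h h')

omit hK ho in
theorem num_mem {n : ℕ} : ∀ {x : X}, K.D w x → K.Num w n x → K.E w x o := by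
  induction n with
  | zero => intro x hx h; exact zero_mem hω hx h
  | succ n ih =>
    rintro x hx ⟨y, hy, h, hs⟩
    exact succ_mem hω hx (ih hy h) hs

omit hω in
theorem num_exists (n : ℕ) : ∃ x, K.D w x ∧ K.Num w n x := by
  induction n with
  | zero => exact hK.exists_zero ho
  | succ n ih =>
    obtain ⟨y, hy, h⟩ := ih
    obtain ⟨x, hx, hs⟩ := hK.exists_succ hy
    exact ⟨x, hx, y, hy, h, hs⟩

omit hK ho hω in
theorem num_of_mem {n : ℕ} : ∀ {x y : X}, K.Num w n y → K.E w x y →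
    ∃ m < n, K.Num w m x := by
  induction n with
  | zero => intro x y h hx; exact absurd hx (h w le_rfl x)
  | succ n ih =>
    rintro x y ⟨z, hz, h, hs⟩ hx
    rcases (hs w le_rfl x (K.E_left hx)).1 hx with hx | hx
    · obtain ⟨m, hm, h⟩ := ih h hx
      exact ⟨m, by omega, h⟩
    · exact ⟨n, by omega, h.congr (K.Q_symm hx)⟩

omit ho hω in
theorem num_lt {m n : ℕ} (hmn : m < n) {x : X} (hx : K.D w x) (h : K.Num w m x) :
    ∀ {y : X}, K.Num w n y → K.E w x y := by
  induction n, hmn using Nat.le_induction with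
  | base =>
    rintro y ⟨z, hz, h', hs⟩
    exact (hs w le_rfl x hx).2 (Or.inr (hK.num_unique hx hz h h'))
  | succ n hmn ih =>
    rintro y ⟨z, hz, h', hs⟩
    exact (hs w le_rfl x hx).2 (Or.inl (ih h'))

omit hω in
theorem code_num {n : ℕ} : ∀ {x a b : X}, K.D w x → K.D w a → K.D w b → K.Num w n x →
    K.Num w (Nat.unpair n).1 a → K.Num w (Nat.unpair n).2 b → K.Code w x a b := by
  induction n with
  | zero =>
    intro x a b hx ha hb h h₁ h₂
    exact hK.code_zero hx ha hb h h₁ h₂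
  | succ n ih =>
    rintro x a b hx ha hb ⟨y, hy, h, hs⟩ h₁ h₂
    rw [unpair_succ] at h₁ h₂
    obtain ⟨c, hc, hcn⟩ := hK.num_exists ho (Nat.unpair n).1
    obtain ⟨d, hd, hdn⟩ := hK.num_exists ho (Nat.unpair n).2
    refine hK.code_succ hx hy hc hd ha hb hs (ih hy hc hd h hcn hdn) ?_
    split_ifs at h₁ h₂ with h₃ h₄ h₅
    · obtain ⟨c', hc', hcn', hsc⟩ := h₁
      exact Or.inl ⟨hsc.congr (K.Q_refl ha) (hK.num_unique hc' hc hcn' hcn),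
        hK.num_lt h₃ ha ⟨c', hc', hcn', hsc⟩ hdn, hK.num_unique hb hd h₂ hdn⟩
    · refine Or.inr (Or.inl ⟨?_, hK.num_unique ha hd h₁ hdn, h₂⟩)
      rw [← h₄] at hdn
      obtain ⟨c', hc', hcn', hsc⟩ := hdn
      exact hsc.congr (K.Q_refl hd) (hK.num_unique hc' hc hcn' hcn)
    · obtain ⟨d', hd', hdn', hsd⟩ := h₂
      exact Or.inr (Or.inr (Or.inl ⟨hK.num_lt h₅ hd hdn hcn, hK.num_unique ha hc h₁ hcn,
        hsd.congr (K.Q_refl hb) (hK.num_unique hd' hd hdn' hdn)⟩))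
    · obtain ⟨d', hd', hdn', hsd⟩ := h₂
      have hcd : (Nat.unpair n).1 = (Nat.unpair n).2 := by omega
      rw [hcd] at hcn
      exact Or.inr (Or.inr (Or.inr ⟨hK.num_unique hc hd hcn hdn, h₁,
        hsd.congr (K.Q_refl hb) (hK.num_unique hd' hd hdn' hdn)⟩))

end KFrame.IsModel

/-! ### Primitive recursive functions -/

/-- `Θ(y, x)` represents the function `f` in the Kripke models of `CZF`: it is functional on `ω`,
and it has the values of `f` at the numerals. -/
structure Represents (Θ : Fml) (f : ℕ → ℕ) : Prop where
  total : ∀ {W X : Type} [Preorder W] {K : KFrame W X}, K.IsModel → ∀ {w o}, K.D w o → K.Om w o →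
    ∀ {x}, K.E w x o → ∃ y, K.E w y o ∧ K.F₂ Θ w y x
  unique : ∀ {W X : Type} [Preorder W] {K : KFrame W X}, K.IsModel → ∀ {w o}, K.D w o → K.Om w o →
    ∀ {x y y'}, K.E w x o → K.D w y → K.D w y' → K.F₂ Θ w y x → K.F₂ Θ w y' x → K.Q w y y'
  value : ∀ {W X : Type} [Preorder W] {K : KFrame W X}, K.IsModel → ∀ {w o}, K.D w o → K.Om w o →
    ∀ {n x y}, K.D w x → K.D w y → K.Num w n x → K.Num w (f n) y → K.F₂ Θ w y x

/-- The step of the recursion which defines `Nat.rec (f z) (fun i v => g ⟨z, ⟨i, v⟩⟩)`, where `Θ`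
represents `g`. -/
def precStep (Θ : Fml) : Fml := ex (ex (and (isCode 1 4 3) (and (isCode 0 5 1) (app₂ Θ 2 0))))

theorem KFrame.f₄_precStep {W X : Type} [Preorder W] {K : KFrame W X} {Θ : Fml} {w : W}
    {v' v i z : X} : K.F₄ (precStep Θ) w v' v i z ↔
      ∃ t, K.D w t ∧ ∃ s, K.D w s ∧ K.Code w t i v ∧ K.Code w s z t ∧ K.F₂ Θ w v' s := by
  simp only [F₄, precStep, Forces, forces_isCode, forces_app₂]
  exact Iff.rfl

namespace KFrame.IsModel

variable {W X : Type} [Preorder W] {K : KFrame W X} (hK : K.IsModel)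
  {w : W} {o : X} (ho : K.D w o) (hω : K.Om w o)

include hK ho hω

/-- Only the elements of `ω` are in the domain of a function that is defined by recursion. -/
theorem rec_dom {I S : Fml} {n a z : X} (hn : K.D w n) (ha : K.D w a) (hz : K.D w z)
    (h : K.Rec I S w n a z) : K.E w n o := by
  have key := hK.set_induction (w := w) (all (imp (recF I S 1 0 2) (mem 1 3)))
    (ρ := cons z fun _ => o) (D_cons hz fun _ => ho) ?_ w le_rfl n hn w le_rfl a ha w le_rfl
  · simp only [Forces, forces_recF] at key
    exact key h
  · intro v hv n hn ih u hu a ha t ht h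
    simp only [Forces, forces_recF] at h ih ⊢
    have hvt := hv.trans (hu.trans ht)
    have hn := K.D_mono (hu.trans ht) hn
    rcases hK.rec_inv hn (K.D_mono ht ha) (K.D_mono hvt hz) h with
      ⟨h₀, -⟩ | ⟨i, hi, b, hb, hs, hr, -⟩
    · exact zero_mem (hω.mono hvt) hn h₀
    · exact succ_mem (hω.mono hvt) hn
        (ih t (hu.trans ht) i (hs.mem hi) t le_rfl b hb t le_rfl hr) hs

theorem code_dom {n a b : X} (hn : K.D w n) (h : K.Code w n a b) : K.E w n o := by
  obtain ⟨p, hp, -, hr⟩ := h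
  exact hK.rec_dom ho hω hn hp hn hr

theorem code_inj' {n n' a b : X} (hn : K.D w n) (hn' : K.D w n') (ha : K.D w a) (hb : K.D w b)
    (h : K.Code w n a b) (h' : K.Code w n' a b) : K.Q w n n' :=
  hK.code_inj ho hω (hK.code_dom ho hω hn h) (hK.code_dom ho hω hn' h') ha hb h h'

theorem represents_mem {Θ : Fml} {f : ℕ → ℕ} (hf : Represents Θ f) {x y : X} (hx : K.E w x o)
    (hy : K.D w y) (h : K.F₂ Θ w y x) : K.E w y o := by
  obtain ⟨y', hy', h'⟩ := hf.total hK ho hω hx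
  exact E_congr_left (hf.unique hK ho hω hx (K.E_left hy') hy h' h) hy'

theorem recData_prec {Θ₁ Θ₂ : Fml} {f g : ℕ → ℕ} (hf : Represents Θ₁ f) (hg : Represents Θ₂ g)
    {z : X} (hz : K.E w z o) : K.RecData w o z Θ₁ (precStep Θ₂) (mem 0 1) where
  init_exists v hv := by
    obtain ⟨y, hy, h⟩ := hf.total hK (K.D_mono hv ho) (hω.mono hv) (K.E_mono hv hz)
    exact ⟨y, K.E_left hy, h⟩
  init_mem v hv a ha h :=
    hK.represents_mem (K.D_mono hv ho) (hω.mono hv) hf (K.E_mono hv hz) ha h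
  init_unique v hv a a' ha ha' h h' :=
    hf.unique hK (K.D_mono hv ho) (hω.mono hv) (K.E_mono hv hz) ha ha' h h'
  step_exists v hv i b hi hb hbo := by
    have hov := K.D_mono hv ho
    have hωv := hω.mono hv
    obtain ⟨t, ht, htc⟩ := hK.code_surj hov hωv hi hbo
    obtain ⟨s, hs, hsc⟩ := hK.code_surj hov hωv (K.E_mono hv hz) ht
    obtain ⟨y, hy, h⟩ := hg.total hK hov hωv hs
    exact ⟨y, K.E_left hy, f₄_precStep.2 ⟨t, K.E_left ht, s, K.E_left hs, htc, hsc, h⟩⟩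
  step_mem v hv i a b hi ha hb hbo h := by
    have hov := K.D_mono hv ho
    have hωv := hω.mono hv
    obtain ⟨t, ht, s, hs, htc, hsc, h⟩ := f₄_precStep.1 h
    exact hK.represents_mem hov hωv hg (hK.code_dom hov hωv hs hsc) ha h
  step_unique v hv i a a' b hi ha ha' hb hbo h h' := by
    have hov := K.D_mono hv ho
    have hωv := hω.mono hv
    obtain ⟨t, ht, s, hs, htc, hsc, h⟩ := f₄_precStep.1 h
    obtain ⟨t', ht', s', hs', htc', hsc', h'⟩ := f₄_precStep.1 h'
    have htt := hK.code_inj' hov hωv ht' ht (K.E_left hi) hb htc' htc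
    have hzv := K.E_left (K.E_mono hv hz)
    have hss := hK.code_inj' hov hωv hs' hs hzv ht
      (hsc'.congr (K.Q_refl hs') (K.Q_refl hzv) htt) hsc
    exact hg.unique hK hov hωv (hK.code_dom hov hωv hs hsc) ha ha' h
      (h'.congr (K.Q_refl ha') hss)

end KFrame.IsModel

open KFrame

theorem represents_zero : Represents (isEmpty 0) (fun _ => 0) where
  total hK w o ho hω x hx := by
    obtain ⟨z, hz, h⟩ := hK.exists_zero ho
    exact ⟨z, IsModel.zero_mem hω hz h, forces_isEmpty.2 h⟩
  unique hK w o ho hω x y y' hx hy hy' h h' :=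
    hK.zero_unique hy hy' (forces_isEmpty.1 h) (forces_isEmpty.1 h')
  value hK w o ho hω n x y hx hy hn h := forces_isEmpty.2 h

theorem represents_succ : Represents (isSucc 0 1) Nat.succ where
  total hK w o ho hω x hx := by
    obtain ⟨y, hy, h⟩ := hK.exists_succ (KFrame.E_left _ hx)
    exact ⟨y, IsModel.succ_mem hω hy hx h, forces_isSucc.2 h⟩
  unique hK w o ho hω x y y' hx hy hy' h h' :=
    hK.succ_unique hy hy' (forces_isSucc.1 h) (forces_isSucc.1 h')
      (KFrame.Q_refl _ (KFrame.E_left _ hx))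
  value := by
    rintro W X _ K hK w o ho hω n x y hx hy hn ⟨z, hz, hzn, hs⟩
    exact forces_isSucc.2 (hs.congr (K.Q_refl hy) (hK.num_unique hz hx hzn hn))

theorem represents_left : Represents (ex (isCode 2 1 0)) (fun n => (Nat.unpair n).1) where
  total {W X _ K} hK w o ho hω x hx := by
    obtain ⟨a, ha, b, hb, h⟩ := hK.code_exists ho hω hx
    exact ⟨a, ha, b, K.E_left hb, forces_isCode.2 h⟩
  unique {W X _ K} hK w o ho hω x y y' hx hy hy' h h' := by
    obtain ⟨b, hb, h⟩ := h
    obtain ⟨b', hb', h'⟩ := h'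
    exact (hK.code_unique ho hω hx hy hb hy' hb' (forces_isCode.1 h) (forces_isCode.1 h')).1
  value {W X _ K} hK w o ho hω n x y hx hy hn h := by
    obtain ⟨b, hb, hbn⟩ := hK.num_exists ho (Nat.unpair n).2
    exact ⟨b, hb, forces_isCode.2 (hK.code_num ho hx hy hb hn h hbn)⟩

theorem represents_right : Represents (ex (isCode 2 0 1)) (fun n => (Nat.unpair n).2) where
  total {W X _ K} hK w o ho hω x hx := by
    obtain ⟨a, ha, b, hb, h⟩ := hK.code_exists ho hω hx
    exact ⟨b, hb, a, K.E_left ha, forces_isCode.2 h⟩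
  unique {W X _ K} hK w o ho hω x y y' hx hy hy' h h' := by
    obtain ⟨b, hb, h⟩ := h
    obtain ⟨b', hb', h'⟩ := h'
    exact (hK.code_unique ho hω hx hb hy hb' hy' (forces_isCode.1 h) (forces_isCode.1 h')).2
  value {W X _ K} hK w o ho hω n x y hx hy hn h := by
    obtain ⟨b, hb, hbn⟩ := hK.num_exists ho (Nat.unpair n).1
    exact ⟨b, hb, forces_isCode.2 (hK.code_num ho hx hb hy hn hbn h)⟩

theorem represents_pair {Θ₁ Θ₂ : Fml} {f g : ℕ → ℕ} (hf : Represents Θ₁ f)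
    (hg : Represents Θ₂ g) :
    Represents (ex (ex (and (app₂ Θ₁ 1 3) (and (app₂ Θ₂ 0 3) (isCode 2 1 0)))))
      (fun n => Nat.pair (f n) (g n)) := by
  have key : ∀ {W X : Type} [Preorder W] {K : KFrame W X} {w : W} {y x : X},
      K.F₂ (ex (ex (and (app₂ Θ₁ 1 3) (and (app₂ Θ₂ 0 3) (isCode 2 1 0))))) w y x ↔
        ∃ a, K.D w a ∧ ∃ b, K.D w b ∧ K.F₂ Θ₁ w a x ∧ K.F₂ Θ₂ w b x ∧ K.Code w y a b := by
    intro W X _ K w y x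
    rw [KFrame.F₂]
    simp only [Forces, forces_isCode, forces_app₂]
    exact Iff.rfl
  constructor
  · intro W X _ K hK w o ho hω x hx
    obtain ⟨a, ha, h₁⟩ := hf.total hK ho hω hx
    obtain ⟨b, hb, h₂⟩ := hg.total hK ho hω hx
    obtain ⟨y, hy, h⟩ := hK.code_surj ho hω ha hb
    exact ⟨y, hy, key.2 ⟨a, K.E_left ha, b, K.E_left hb, h₁, h₂, h⟩⟩
  · intro W X _ K hK w o ho hω x y y' hx hy hy' h h'
    obtain ⟨a, ha, b, hb, h₁, h₂, h⟩ := key.1 h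
    obtain ⟨a', ha', b', hb', h₁', h₂', h'⟩ := key.1 h'
    exact hK.code_inj' ho hω hy hy' ha hb h (h'.congr (K.Q_refl hy')
      (hf.unique hK ho hω hx ha' ha h₁' h₁) (hg.unique hK ho hω hx hb' hb h₂' h₂))
  · intro W X _ K hK w o ho hω n x y hx hy hn h
    obtain ⟨a, ha, han⟩ := hK.num_exists ho (f n)
    obtain ⟨b, hb, hbn⟩ := hK.num_exists ho (g n)
    exact key.2 ⟨a, ha, b, hb, hf.value hK ho hω hx ha hn han, hg.value hK ho hω hx hb hn hbn,
      hK.code_num ho hy ha hb h (by simpa using han) (by simpa using hbn)⟩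

theorem represents_comp {Θ₁ Θ₂ : Fml} {f g : ℕ → ℕ} (hf : Represents Θ₁ f)
    (hg : Represents Θ₂ g) :
    Represents (ex (and (app₂ Θ₂ 0 2) (app₂ Θ₁ 1 0))) (fun n => f (g n)) := by
  have key : ∀ {W X : Type} [Preorder W] {K : KFrame W X} {w : W} {y x : X},
      K.F₂ (ex (and (app₂ Θ₂ 0 2) (app₂ Θ₁ 1 0))) w y x ↔
        ∃ a, K.D w a ∧ K.F₂ Θ₂ w a x ∧ K.F₂ Θ₁ w y a := by
    intro W X _ K w y x
    rw [KFrame.F₂]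
    simp only [Forces, forces_app₂]
    exact Iff.rfl
  constructor
  · intro W X _ K hK w o ho hω x hx
    obtain ⟨a, ha, h₁⟩ := hg.total hK ho hω hx
    obtain ⟨y, hy, h⟩ := hf.total hK ho hω ha
    exact ⟨y, hy, key.2 ⟨a, K.E_left ha, h₁, h⟩⟩
  · intro W X _ K hK w o ho hω x y y' hx hy hy' h h'
    obtain ⟨a, ha, h₁, h⟩ := key.1 h
    obtain ⟨a', ha', h₁', h'⟩ := key.1 h'
    exact hf.unique hK ho hω (hK.represents_mem ho hω hg hx ha h₁) hy hy' h
      (h'.congr (K.Q_refl hy') (hg.unique hK ho hω hx ha' ha h₁' h₁))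
  · intro W X _ K hK w o ho hω n x y hx hy hn h
    obtain ⟨a, ha, han⟩ := hK.num_exists ho (g n)
    exact key.2 ⟨a, ha, hg.value hK ho hω hx ha hn han, hf.value hK ho hω ha hy han h⟩

theorem represents_prec {Θ₁ Θ₂ : Fml} {f g : ℕ → ℕ} (hf : Represents Θ₁ f)
    (hg : Represents Θ₂ g) :
    Represents (ex (ex (and (isCode 3 1 0) (recF Θ₁ (precStep Θ₂) 0 2 1))))
      (Nat.unpaired fun z n => Nat.rec (f z) (fun i v => g (Nat.pair z (Nat.pair i v))) n) := by
  have key : ∀ {W X : Type} [Preorder W] {K : KFrame W X} {w : W} {y x : X},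
      K.F₂ (ex (ex (and (isCode 3 1 0) (recF Θ₁ (precStep Θ₂) 0 2 1)))) w y x ↔
        ∃ z, K.D w z ∧ ∃ n, K.D w n ∧ K.Code w x z n ∧ K.Rec Θ₁ (precStep Θ₂) w n y z := by
    intro W X _ K w y x
    rw [KFrame.F₂]
    simp only [Forces, forces_isCode, forces_recF]
    exact Iff.rfl
  constructor
  · intro W X _ K hK w o ho hω x hx
    obtain ⟨z, hz, n, hn, hc⟩ := hK.code_exists ho hω hx
    have hR := hK.recData_prec ho hω hf hg hz
    obtain ⟨y, hy, hr⟩ := hK.rec_exists ho hω (K.E_left hz) hR hn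
    exact ⟨y, hK.rec_mem ho hω (K.E_left hz) hR hn hy hr,
      key.2 ⟨z, K.E_left hz, n, K.E_left hn, hc, hr⟩⟩
  · intro W X _ K hK w o ho hω x y y' hx hy hy' h h'
    obtain ⟨z, hz, n, hn, hc, hr⟩ := key.1 h
    obtain ⟨z', hz', n', hn', hc', hr'⟩ := key.1 h'
    obtain ⟨hzz, hnn⟩ := hK.code_unique ho hω hx hz' hn' hz hn hc' hc
    obtain ⟨hzo, hno⟩ := hK.code_mem ho hω hx hz hn hc
    have hr'' : K.Rec Θ₁ (precStep Θ₂) w n y' z := by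
      have h₁ : K.Forces w (recF Θ₁ (precStep Θ₂) 0 1 2) (cons n' (cons y' fun _ => z')) :=
        forces_recF.2 hr'
      exact forces_recF.1 (h₁.congr (σ := cons n (cons y' fun _ => z)) fun i => by
        rcases i with _ | _ | i
        exacts [hnn, K.Q_refl hy', hzz])
    exact hK.rec_unique ho hω hz (hK.recData_prec ho hω hf hg hzo) hno hy hy' hr hr''
  · intro W X _ K hK w o ho hω N x y hx hy hn h
    obtain ⟨z, hz, hzn⟩ := hK.num_exists ho (Nat.unpair N).1
    obtain ⟨n, hn', hnn⟩ := hK.num_exists ho (Nat.unpair N).2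
    refine key.2 ⟨z, hz, n, hn', hK.code_num ho hx hz hn' hn hzn hnn, ?_⟩
    have hrec : ∀ m : ℕ, ∀ {i a : X}, K.D w i → K.D w a → K.Num w m i →
        K.Num w (Nat.rec (f (Nat.unpair N).1)
          (fun i v => g (Nat.pair (Nat.unpair N).1 (Nat.pair i v))) m) a →
        K.Rec Θ₁ (precStep Θ₂) w i a z := by
      intro m
      induction m with
      | zero =>
        intro i a hi ha him han
        exact hK.rec_zero hi ha him (hf.value hK ho hω hz ha hzn han)
      | succ m ih =>
        rintro i a hi ha ⟨j, hj, hjm, hs⟩ han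
        obtain ⟨b, hb, hbn⟩ := hK.num_exists ho (Nat.rec (f (Nat.unpair N).1)
          (fun i v => g (Nat.pair (Nat.unpair N).1 (Nat.pair i v))) m)
        refine hK.rec_succ hi ha hj hb (ih hj hb hjm hbn) hs (f₄_precStep.2 ?_)
        obtain ⟨t, ht, htn⟩ := hK.num_exists ho (Nat.pair m (Nat.rec (f (Nat.unpair N).1)
          (fun i v => g (Nat.pair (Nat.unpair N).1 (Nat.pair i v))) m))
        obtain ⟨s, hs', hsn⟩ := hK.num_exists ho (Nat.pair (Nat.unpair N).1
          (Nat.pair m (Nat.rec (f (Nat.unpair N).1)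
          (fun i v => g (Nat.pair (Nat.unpair N).1 (Nat.pair i v))) m)))
        exact ⟨t, ht, s, hs', hK.code_num ho ht hj hb htn (by simpa using hjm) (by simpa using hbn),
          hK.code_num ho hs' hz ht hsn (by simpa using hzn) (by simpa using htn),
          hg.value hK ho hω hs' ha hsn han⟩
    exact hrec _ hn' hy hnn h

theorem exists_represents {f : ℕ → ℕ} (hf : Nat.Primrec f) : ∃ Θ, Represents Θ f := by
  induction hf with
  | zero => exact ⟨_, represents_zero⟩
  | succ => exact ⟨_, represents_succ⟩
  | left => exact ⟨_, represents_left⟩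
  | right => exact ⟨_, represents_right⟩
  | pair _ _ h₁ h₂ =>
    obtain ⟨Θ₁, h₁⟩ := h₁
    obtain ⟨Θ₂, h₂⟩ := h₂
    exact ⟨_, represents_pair h₁ h₂⟩
  | comp _ _ h₁ h₂ =>
    obtain ⟨Θ₁, h₁⟩ := h₁
    obtain ⟨Θ₂, h₂⟩ := h₂
    exact ⟨_, represents_comp h₁ h₂⟩
  | prec _ _ h₁ h₂ =>
    obtain ⟨Θ₁, h₁⟩ := h₁
    obtain ⟨Θ₂, h₂⟩ := h₂
    exact ⟨_, represents_prec h₁ h₂⟩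

/-! ### Functions as sets, and `LLPO_∞` in a Kripke model -/

namespace KFrame

variable {W X : Type} [Preorder W] (K : KFrame W X)

/-- `c = a × b`, read at the world `w`. -/
def Prod (w : W) (c a b : X) : Prop := ∀ v, w ≤ v → ∀ d, K.D v d →
  (K.E v d c ↔ ∃ x, K.E v x a ∧ ∃ y, K.E v y b ∧ K.Pair v d x y)

/-- `⟨x, y⟩ ∈ f`, read at the world `w`. -/
def Maps (w : W) (f x y : X) : Prop := ∃ p, K.E w p f ∧ K.Pair w p x y

/-- `f` is a function from `a` to `b`, read at the world `w`. -/
def Fun (w : W) (f a b : X) : Prop :=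
  (∀ v, w ≤ v → ∀ p, K.E v p f → ∃ x, K.E v x a ∧ ∃ y, K.E v y b ∧ K.Pair v p x y) ∧
  (∀ v, w ≤ v → ∀ x, K.E v x a → ∃ y, K.E v y b ∧ K.Maps v f x y ∧
    ∀ u, v ≤ u → ∀ y', K.D u y' → ∀ t, u ≤ t → K.Maps t f x y' → K.Q t y' y)

/-- `f` is a bijection from `a` to `b`, read at the world `w`. -/
def Bij (w : W) (f a b : X) : Prop :=
  K.Fun w f a b ∧ (∀ v, w ≤ v → ∀ y, K.E v y b → ∃ x, K.E v x a ∧ K.Maps v f x y) ∧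
    (∀ v, w ≤ v → ∀ x, K.E v x a → ∀ u, v ≤ u → ∀ x', K.E u x' a → ∀ t, u ≤ t → ∀ y, K.E t y b →
      ∀ s, t ≤ s → K.Maps s f x y ∧ K.Maps s f x' y → K.Q s x x')

variable {K}

theorem forces_isProd {w : W} {i j k : ℕ} {ρ : ℕ → X} :
    K.Forces w (isProd i j k) ρ ↔ K.Prod w (ρ i) (ρ j) (ρ k) := by
  unfold isProd
  rw [forces_all_iff]
  simp only [forces_bex, forces_isPair]
  exact Iff.rfl

theorem forces_maps {w : W} {i j k : ℕ} {ρ : ℕ → X} :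
    K.Forces w (maps i j k) ρ ↔ K.Maps w (ρ i) (ρ j) (ρ k) := by
  simp only [maps, forces_bex, forces_isPair]
  exact Iff.rfl

theorem forces_isFunction {w : W} {i j k : ℕ} {ρ : ℕ → X} :
    K.Forces w (isFunction i j k) ρ ↔ K.Fun w (ρ i) (ρ j) (ρ k) := by
  simp only [isFunction, Forces, forces_ball, forces_bex, forces_isPair, forces_maps]
  exact Iff.rfl

theorem forces_isBijection {w : W} {i j k : ℕ} {ρ : ℕ → X} :
    K.Forces w (isBijection i j k) ρ ↔ K.Bij w (ρ i) (ρ j) (ρ k) := by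
  simp only [isBijection, Forces, forces_ball, forces_bex, forces_isFunction, forces_maps]
  exact Iff.rfl

theorem forces_llpo {w : W} {ρ : ℕ → X} (h : K.Forces w LLPOInfty ρ) {o t c p α : X}
    (ho : K.D w o) (ht : K.D w t) (hc : K.D w c) (hp : K.D w p) (hα : K.D w α)
    (hω : K.Om w o) (ht' : K.Num w 2 t) (hc' : K.Prod w c o o) (hp' : K.Bij w p c o)
    (hα' : K.Fun w α o t)
    (h₁ : ∀ v, w ≤ v → ∀ i, K.E v i o → ∀ j, K.E v j o →
      (∃ e, K.D v e ∧ K.Num v 1 e ∧ K.Maps v α i e) →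
      (∃ e, K.D v e ∧ K.Num v 1 e ∧ K.Maps v α j e) → K.Q v i j) :
    ∃ k, K.E w k o ∧ ∀ v, w ≤ v → ∀ n, K.E v n o → ∃ z, K.D v z ∧ K.Pair v z k n ∧
      ∃ m, K.D v m ∧ K.Maps v p z m ∧ ∃ e, K.D v e ∧ K.Num v 0 e ∧ K.Maps v α m e := by
  simp only [LLPOInfty, Forces, forces_ball, forces_bex, forces_isOmega, forces_isNumeral,
    forces_isProd, forces_isBijection, forces_isFunction, forces_isPair, forces_maps] at h
  refine h w le_rfl o ho w le_rfl t ht w le_rfl c hc w le_rfl p hp w le_rfl α hα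
    w le_rfl hω w le_rfl ht' w le_rfl hc' w le_rfl hp' w le_rfl hα' w le_rfl ?_
  rintro v hv i hi u hu j hj s hs ⟨h₂, h₃⟩
  exact h₁ s (hv.trans (hu.trans hs)) i (K.E_mono (hu.trans hs) hi) j (K.E_mono hs hj) h₂ h₃

end KFrame

namespace KFrame.IsModel

variable {W X : Type} [Preorder W] {K : KFrame W X} (hK : K.IsModel)
  {w : W} {o : X} (ho : K.D w o) (hω : K.Om w o)

include hK ho

/-- Replacement for functions on `o`: if `φ(y, i, x)` defines `y` uniquely for `i ∈ o`, then the
graph of this function is a set. -/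
theorem exists_graph (φ : Fml) {x : X} (hx : K.D w x)
    (h : ∀ v, w ≤ v → ∀ i, K.E v i o → ∃ y, K.D v y ∧ K.F₄ φ v y i x x) :
    ∃ g, K.D w g ∧ (∀ v, w ≤ v → ∀ i, K.E v i o → ∃ y, K.D v y ∧ K.F₄ φ v y i x x ∧
        K.Maps v g i y) ∧
      (∀ v, w ≤ v → ∀ p, K.E v p g → ∃ i, K.E v i o ∧ ∃ y, K.D v y ∧ K.Pair v p i y ∧
        K.F₄ φ v y i x x) := by
  obtain ⟨g, hg, h₁, h₂⟩ := hK.strong_collection (w := w) (a := o)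
    (ex (and (isPair 1 2 0) (app₄ φ 0 2 4 4))) (ρ := fun _ => x) (fun _ => hx) ho (by
      intro v hv i hi
      obtain ⟨y, hy, h⟩ := h v hv i hi
      obtain ⟨p, hp, hpi⟩ := hK.exists_pair (K.E_left hi) hy
      exact ⟨p, hp, y, hy, forces_isPair.2 hpi, forces_app₄.2 h⟩)
  refine ⟨g, hg, fun v hv i hi => ?_, fun v hv p hp => ?_⟩
  · obtain ⟨p, hp, y, hy, hpi, h⟩ := h₁ v hv i hi
    exact ⟨y, hy, forces_app₄.1 h, p, hp, forces_isPair.1 hpi⟩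
  · obtain ⟨i, hi, y, hy, hpi, h⟩ := h₂ v hv p hp
    exact ⟨i, hi, y, hy, forces_isPair.1 hpi, forces_app₄.1 h⟩

include hω

/-- `ω × ω` is the range of the enumeration of the pairs. -/
theorem exists_prod : ∃ c, K.D w c ∧ K.Prod w c o o := by
  have hR := hK.recData_pair ho hω
  obtain ⟨c, hc, h₁, h₂⟩ := hK.strong_collection (w := w) (a := o)
    (recF pairInit pairStep 1 0 1) (ρ := fun _ => o) (fun _ => ho) ho (by
      intro v hv i hi
      obtain ⟨p, hp, hr⟩ := hK.rec_exists (K.D_mono hv ho) (hω.mono hv) (K.D_mono hv ho)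
        (hR.mono hv) hi
      exact ⟨p, hp, forces_recF.2 (rec_pair_param hr)⟩)
  refine ⟨c, hc, fun v hv d hd => ⟨fun hdc => ?_, ?_⟩⟩
  · obtain ⟨n, hn, hr⟩ := h₂ v hv d hdc
    exact f₂_pairClass.1 (hK.rec_mem (K.D_mono hv ho) (hω.mono hv) (K.D_mono hv ho) (hR.mono hv)
      hn hd (rec_pair_param (forces_recF.1 hr)))
  · rintro ⟨a, ha, b, hb, hdab⟩
    obtain ⟨n, hn, p, hp, hpab, hr⟩ := hK.code_surj (K.D_mono hv ho) (hω.mono hv) ha hb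
    obtain ⟨p', hp', hr'⟩ := h₁ v hv n hn
    have hpp := hK.rec_unique (K.D_mono hv ho) (hω.mono hv) (K.D_mono hv ho) (hR.mono hv) hn
      (K.E_left hp') hp (rec_pair_param (forces_recF.1 hr')) (rec_pair_param hr)
    exact E_congr_left (K.Q_trans hpp (hK.pair_unique hp hd hpab hdab)) hp'

/-- The pairing function is a set: it is the inverse of the enumeration of the pairs. -/
theorem exists_pairing {c : X} (hc : K.Prod w c o o) : ∃ p, K.D w p ∧ K.Bij w p c o ∧
    ∀ v, w ≤ v → ∀ z m, K.D v z → K.D v m → K.Maps v p z m →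
      K.Rec pairInit pairStep v m z m := by
  have hR := hK.recData_pair ho hω
  obtain ⟨p, hp, h₁, h₂⟩ := hK.strong_collection (w := w) (a := o)
    (ex (and (recF pairInit pairStep 2 0 2) (isPair 1 0 2))) (ρ := fun _ => o) (fun _ => ho) ho (by
      intro v hv i hi
      obtain ⟨q, hq, hr⟩ := hK.rec_exists (K.D_mono hv ho) (hω.mono hv) (K.D_mono hv ho)
        (hR.mono hv) hi
      obtain ⟨y, hy, hyq⟩ := hK.exists_pair hq (K.E_left hi)
      exact ⟨y, hy, q, hq, forces_recF.2 (rec_pair_param hr), forces_isPair.2 hyq⟩)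
  have hmaps : ∀ v, w ≤ v → ∀ z m, K.D v z → K.D v m → K.Maps v p z m →
      K.Rec pairInit pairStep v m z m := by
    rintro v hv z m hz hm ⟨y, hy, hyz⟩
    obtain ⟨n, hn, q, hq, hr, hyq⟩ := h₂ v hv y hy
    obtain ⟨hqz, hnm⟩ := hK.pair_inj hq (K.E_left hn) hz hm (forces_isPair.1 hyq) hyz
    exact rec_pair_param ((forces_recF.1 hr).congr hnm hqz)
  have hmaps' : ∀ v, w ≤ v → ∀ z m, K.D v z → K.E v m o → K.Rec pairInit pairStep v m z m →
      K.Maps v p z m := by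
    intro v hv z m hz hm h
    obtain ⟨y, hy, q, hq, hr, hyq⟩ := h₁ v hv m hm
    have hqz := hK.rec_unique (K.D_mono hv ho) (hω.mono hv) (K.D_mono hv ho) (hR.mono hv) hm hq hz
      (rec_pair_param (forces_recF.1 hr)) (rec_pair_param h)
    exact ⟨y, hy, (forces_isPair.1 hyq).congr (K.Q_refl (K.E_left hy)) hqz (K.Q_refl (K.E_left hm))⟩
  have hinj : ∀ v, w ≤ v → ∀ z m m', K.E v z c → K.D v m → K.D v m' → K.Maps v p z m →
      K.Maps v p z m' → K.Q v m m' := by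
    intro v hv z m m' hz hm hm' h h'
    obtain ⟨a, ha, b, hb, hzab⟩ := (hc v hv z (K.E_left hz)).1 hz
    exact hK.code_inj' (K.D_mono hv ho) (hω.mono hv) hm hm' (K.E_left ha) (K.E_left hb)
      ⟨z, K.E_left hz, hzab, hmaps v hv z m (K.E_left hz) hm h⟩
      ⟨z, K.E_left hz, hzab, hmaps v hv z m' (K.E_left hz) hm' h'⟩
  refine ⟨p, hp, ⟨⟨?_, ?_⟩, ?_, ?_⟩, hmaps⟩
  · intro v hv y hy
    obtain ⟨n, hn, q, hq, hr, hyq⟩ := h₂ v hv y hy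
    refine ⟨q, (hc v hv q hq).2 (f₂_pairClass.1 ?_), n, hn, forces_isPair.1 hyq⟩
    exact hK.rec_mem (K.D_mono hv ho) (hω.mono hv) (K.D_mono hv ho) (hR.mono hv) hn hq
      (rec_pair_param (forces_recF.1 hr))
  · intro v hv z hz
    obtain ⟨a, ha, b, hb, hzab⟩ := (hc v hv z (K.E_left hz)).1 hz
    obtain ⟨n, hn, q, hq, hqab, hr⟩ := hK.code_surj (K.D_mono hv ho) (hω.mono hv) ha hb
    have hqz := hK.pair_unique hq (K.E_left hz) hqab hzab
    have hzn := hmaps' v hv z n (K.E_left hz) hn (hr.congr (K.Q_refl (K.E_left hn)) hqz)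
    refine ⟨n, hn, hzn, fun u hu m hm t ht hzm => ?_⟩
    have hut := hu.trans ht
    obtain ⟨y, hy, hyz⟩ := hzn
    exact hinj t (hv.trans hut) z m n (K.E_mono hut hz) (K.D_mono ht hm)
      (K.E_left (K.E_mono hut hn)) hzm ⟨y, K.E_mono hut hy, hyz.mono hut⟩
  · intro v hv n hn
    obtain ⟨q, hq, hr⟩ := hK.rec_exists (K.D_mono hv ho) (hω.mono hv) (K.D_mono hv ho)
      (hR.mono hv) hn
    have hqC := hK.rec_mem (K.D_mono hv ho) (hω.mono hv) (K.D_mono hv ho) (hR.mono hv) hn hq hr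
    exact ⟨q, (hc v hv q hq).2 (f₂_pairClass.1 hqC), hmaps' v hv q n hq hn (rec_pair_param hr)⟩
  · rintro v hv z hz u hu z' hz' t ht m hm s hs ⟨h, h'⟩
    have hvs := hv.trans (hu.trans (ht.trans hs))
    have hzs := K.D_mono (hu.trans (ht.trans hs)) (K.E_left hz)
    have hzs' := K.D_mono (ht.trans hs) (K.E_left hz')
    have hms := K.E_mono hs hm
    exact hK.rec_unique (K.D_mono hvs ho) (hω.mono hvs) (K.D_mono hvs ho) (hR.mono hvs) hms hzs hzs'
      (rec_pair_param (hmaps s hvs z m hzs (K.E_left hms) h))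
      (rec_pair_param (hmaps s hvs z' m hzs' (K.E_left hms) h'))

/-- `LLPO_∞` for definable predicates: if `φ(k, n, x)` is decidable and holds for at most one pair
of natural numbers `k`, `n`, then there is `k` such that `φ(k, n, x)` fails for all `n`. -/
theorem llpo_of_decidable (φ : Fml) {ρ : ℕ → X} (hL : K.Forces w LLPOInfty ρ) {x : X}
    (hx : K.D w x)
    (hdec : ∀ v, w ≤ v → ∀ k, K.E v k o → ∀ n, K.E v n o →
      K.F₄ φ v k n x x ∨ ∀ u, v ≤ u → ¬ K.F₄ φ u k n x x)
    (huniq : ∀ v, w ≤ v → ∀ k n k' n', K.E v k o → K.E v n o → K.E v k' o → K.E v n' o →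
      K.F₄ φ v k n x x → K.F₄ φ v k' n' x x → K.Q v k k' ∧ K.Q v n n') :
    ∃ k, K.E w k o ∧ ∀ v, w ≤ v → ∀ n, K.E v n o → ¬ K.F₄ φ v k n x x := by
  obtain ⟨c, hc, hcp⟩ := hK.exists_prod ho hω
  obtain ⟨p, hp, hbij, hpm⟩ := hK.exists_pairing ho hω hcp
  obtain ⟨two, htwo, htwo'⟩ := hK.num_exists ho 2
  -- `χ(i)`: the number `i` is the code of a pair with the property `φ`
  let χ : Fml := ex (ex (and (isCode 3 1 0) (app₄ φ 1 0 4 4)))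
  have hχ : ∀ {v y i}, K.F₄ χ v y i x x ↔
      ∃ k, K.D v k ∧ ∃ n, K.D v n ∧ K.Code v i k n ∧ K.F₄ φ v k n x x := by
    intro v y i
    rw [F₄]
    simp only [χ, Forces, forces_isCode, forces_app₄]
    exact Iff.rfl
  -- the value `y` of the characteristic function at `i`
  let ψ : Fml := Fml.or (and (isNumeral 1 0) χ) (and (isNumeral 0 0) (neg χ))
  have hψ : ∀ {v y i}, K.F₄ ψ v y i x x ↔ (K.Num v 1 y ∧ K.F₄ χ v y i x x) ∨
      (K.Num v 0 y ∧ ∀ u, v ≤ u → ¬ K.F₄ χ u y i x x) := by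
    intro v y i
    rw [F₄]
    simp only [ψ, Forces, forces_isNumeral, forces_neg]
    exact Iff.rfl
  have hχdec : ∀ v, w ≤ v → ∀ i, K.E v i o → ∀ y, K.F₄ χ v y i x x ∨
      ∀ u, v ≤ u → ¬ K.F₄ χ u y i x x := by
    intro v hv i hi y
    obtain ⟨k, hk, n, hn, hcode⟩ := hK.code_exists (K.D_mono hv ho) (hω.mono hv) hi
    rcases hdec v hv k hk n hn with h | h
    · exact Or.inl (hχ.2 ⟨k, K.E_left hk, n, K.E_left hn, hcode, h⟩)
    · refine Or.inr fun u hu h' => h u hu ?_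
      obtain ⟨k', hk', n', hn', hcode', h'⟩ := hχ.1 h'
      have hvu := hv.trans hu
      obtain ⟨hkk, hnn⟩ := hK.code_unique (K.D_mono hvu ho) (hω.mono hvu) (K.E_mono hu hi) hk' hn'
        (K.E_left (K.E_mono hu hk)) (K.E_left (K.E_mono hu hn)) hcode' (hcode.mono hu)
      exact h'.congr hkk hnn (K.Q_refl (K.D_mono hvu hx)) (K.Q_refl (K.D_mono hvu hx))
  have hψuniq : ∀ v, w ≤ v → ∀ i y y', K.D v y → K.D v y' → K.F₄ ψ v y i x x →
      K.F₄ ψ v y' i x x → K.Q v y y' := by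
    intro v hv i y y' hy hy' h h'
    rcases hψ.1 h with ⟨h₁, h₂⟩ | ⟨h₁, h₂⟩ <;> rcases hψ.1 h' with ⟨h₁', h₂'⟩ | ⟨h₁', h₂'⟩
    · exact hK.num_unique hy hy' h₁ h₁'
    · exact absurd (hχ.2 (hχ.1 h₂)) (h₂' v le_rfl)
    · exact absurd (hχ.2 (hχ.1 h₂')) (h₂ v le_rfl)
    · exact hK.num_unique hy hy' h₁ h₁'
  have hψlt : ∀ v, w ≤ v → ∀ i y, K.D v y → K.F₄ ψ v y i x x → K.E v y two := by
    intro v hv i y hy h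
    rcases hψ.1 h with ⟨h₁, h₂⟩ | ⟨h₁, h₂⟩
    · exact hK.num_lt (by norm_num) hy h₁ (htwo'.mono hv)
    · exact hK.num_lt (by norm_num) hy h₁ (htwo'.mono hv)
  obtain ⟨α, hα, hα₁, hα₂⟩ := hK.exists_graph ho ψ hx (by
    intro v hv i hi
    obtain ⟨e₀, he₀, he₀'⟩ := hK.num_exists (K.D_mono hv ho) 0
    obtain ⟨e₁, he₁, he₁'⟩ := hK.num_exists (K.D_mono hv ho) 1
    rcases hχdec v hv i hi e₁ with h | h
    · exact ⟨e₁, he₁, hψ.2 (Or.inl ⟨he₁', h⟩)⟩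
    · exact ⟨e₀, he₀, hψ.2 (Or.inr ⟨he₀', fun u hu h' => h u hu (hχ.2 (hχ.1 h'))⟩)⟩)
  have hαmaps : ∀ v, w ≤ v → ∀ i y, K.D v i → K.D v y → K.Maps v α i y → K.F₄ ψ v y i x x := by
    rintro v hv i y hi hy ⟨q, hq, hqi⟩
    obtain ⟨i', hi', y', hy', hqi', h⟩ := hα₂ v hv q hq
    obtain ⟨hii, hyy⟩ := hK.pair_inj (K.E_left hi') hy' hi hy hqi' hqi
    exact h.congr hyy hii (K.Q_refl (K.D_mono hv hx)) (K.Q_refl (K.D_mono hv hx))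
  have hαfun : K.Fun w α o two := by
    refine ⟨fun v hv q hq => ?_, fun v hv i hi => ?_⟩
    · obtain ⟨i, hi, y, hy, hqi, h⟩ := hα₂ v hv q hq
      exact ⟨i, hi, y, hψlt v hv i y hy h, hqi⟩
    · obtain ⟨y, hy, h, hm⟩ := hα₁ v hv i hi
      refine ⟨y, hψlt v hv i y hy h, hm, fun u hu y' hy' t ht hm' => ?_⟩
      have hut := hu.trans ht
      exact hψuniq t (hv.trans hut) i y' y (K.D_mono ht hy') (K.D_mono hut hy)
        (hαmaps t (hv.trans hut) i y' (K.D_mono hut (K.E_left hi)) (K.D_mono ht hy') hm')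
        (h.mono hut)
  have hone : ∀ v, w ≤ v → ∀ i, K.E v i o → (∃ e, K.D v e ∧ K.Num v 1 e ∧ K.Maps v α i e) →
      ∃ k, K.E v k o ∧ ∃ n, K.E v n o ∧ K.Code v i k n ∧ K.F₄ φ v k n x x := by
    rintro v hv i hi ⟨e, he, ⟨z, hz, hz0, hez⟩, hm⟩
    rcases hψ.1 (hαmaps v hv i e (K.E_left hi) he hm) with ⟨-, h⟩ | ⟨h, -⟩
    · obtain ⟨k, hk, n, hn, hcode, h⟩ := hχ.1 h
      obtain ⟨hko, hno⟩ := hK.code_mem (K.D_mono hv ho) (hω.mono hv) hi hk hn hcode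
      exact ⟨k, hko, n, hno, hcode, h⟩
    · exact absurd h (hez.not_zero hz)
  obtain ⟨k, hk, h⟩ := forces_llpo hL ho htwo hc hp hα hω htwo' hcp hbij hαfun (by
    intro v hv i hi j hj h h'
    obtain ⟨k, hk, n, hn, hcode, h⟩ := hone v hv i hi h
    obtain ⟨k', hk', n', hn', hcode', h'⟩ := hone v hv j hj h'
    obtain ⟨hkk, hnn⟩ := huniq v hv k n k' n' hk hn hk' hn' h h'
    exact hK.code_inj (K.D_mono hv ho) (hω.mono hv) hi hj (K.E_left hk') (K.E_left hn')
      (hcode.congr (K.Q_refl (K.E_left hi)) hkk hnn) hcode')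
  refine ⟨k, hk, fun v hv n hn hφ => ?_⟩
  obtain ⟨z, hz, hzkn, m, hm, hzm, e, he, he0, hme⟩ := h v hv n hn
  have hcode : K.Code v m k n := ⟨z, hz, hzkn, hpm v hv z m hz hm hzm⟩
  rcases hψ.1 (hαmaps v hv m e hm he hme) with ⟨⟨y, hy, -, hey⟩, -⟩ | ⟨-, h⟩
  · exact hey.not_zero hy he0
  · exact h v le_rfl (hχ.2 ⟨k, K.D_mono hv (K.E_left hk), n, K.E_left hn, hcode, hφ⟩)

end KFrame.IsModel

/-! ### The first positive value of a represented function -/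

/-- `y` is the value of the function represented by `Θ` at the code of `(x, n)`. -/
def isValue (Θ : Fml) (x n y : ℕ) : Fml :=
  ex (and (isCode 0 (x + 1) (n + 1)) (app₂ Θ (y + 1) 0))

/-- For the function `U` represented by `Θ`: the number `n` is the first one with `U ⟨x, n⟩ ≠ 0`,
and `U ⟨x, n⟩ = k + 1`. In this formula `k`, `n` and `x` have the indices `0`, `1` and `2`. -/
def firstHit (Θ : Fml) : Fml :=
  and (ex (and (isValue Θ 3 2 0) (isSucc 0 1)))
    (ball 1 (ex (and (isValue Θ 4 1 0) (isEmpty 0))))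

namespace KFrame

variable {W X : Type} [Preorder W] (K : KFrame W X)

/-- The meaning of `isValue` at a world. -/
def Value (Θ : Fml) (w : W) (x n y : X) : Prop := ∃ t, K.D w t ∧ K.Code w t x n ∧ K.F₂ Θ w y t

/-- The meaning of the second half of `firstHit` at a world: the values at `⟨x, m⟩` for `m < n`
are `0`. -/
def ZeroBelow (Θ : Fml) (w : W) (x n : X) : Prop := ∀ v, w ≤ v → ∀ m, K.E v m n →
  ∃ y, K.D v y ∧ K.Value Θ v x m y ∧ K.Zero v y

variable {K}

theorem forces_isValue {Θ : Fml} {w : W} {x n y : ℕ} {ρ : ℕ → X} :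
    K.Forces w (isValue Θ x n y) ρ ↔ K.Value Θ w (ρ x) (ρ n) (ρ y) := by
  simp only [isValue, Forces, forces_isCode, forces_app₂]
  exact Iff.rfl

theorem f₄_firstHit {Θ : Fml} {w : W} {k n x x' : X} : K.F₄ (firstHit Θ) w k n x x' ↔
    (∃ y, K.D w y ∧ K.Value Θ w x n y ∧ K.Succ w y k) ∧ K.ZeroBelow Θ w x n := by
  simp only [F₄, firstHit, Forces, forces_ball, forces_isValue, forces_isSucc, forces_isEmpty]
  exact Iff.rfl

theorem Value.mono {Θ : Fml} {w v : W} {x n y : X} (h : K.Value Θ w x n y) (hv : w ≤ v) :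
    K.Value Θ v x n y := by
  obtain ⟨t, ht, hc, h⟩ := h
  exact ⟨t, K.D_mono hv ht, hc.mono hv, h.mono hv⟩

theorem Value.congr {Θ : Fml} {w : W} {x n n' y : X} (h : K.Value Θ w x n y) (hx : K.D w x)
    (hn : K.Q w n n') : K.Value Θ w x n' y := by
  obtain ⟨t, ht, hc, h⟩ := h
  exact ⟨t, ht, hc.congr (K.Q_refl ht) (K.Q_refl hx) hn, h⟩

end KFrame

namespace KFrame.IsModel

variable {W X : Type} [Preorder W] {K : KFrame W X} (hK : K.IsModel)
  {w : W} {o : X} (ho : K.D w o) (hω : K.Om w o) {Θ : Fml} {U : ℕ → ℕ} (hΘ : Represents Θ U)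
  {x : X}

include hK ho hω hΘ

theorem value_exists (hx : K.E w x o) {n : X} (hn : K.E w n o) :
    ∃ y, K.E w y o ∧ K.Value Θ w x n y := by
  obtain ⟨t, ht, hc⟩ := hK.code_surj ho hω hx hn
  obtain ⟨y, hy, h⟩ := hΘ.total hK ho hω ht
  exact ⟨y, hy, t, K.E_left ht, hc, h⟩

theorem value_unique (hx : K.D w x) {n y y' : X} (hn : K.D w n) (hy : K.D w y) (hy' : K.D w y')
    (h : K.Value Θ w x n y) (h' : K.Value Θ w x n y') : K.Q w y y' := by
  obtain ⟨t, ht, hc, h⟩ := h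
  obtain ⟨t', ht', hc', h'⟩ := h'
  have htt := hK.code_inj' ho hω ht' ht hx hn hc' hc
  exact hΘ.unique hK ho hω (hK.code_dom ho hω ht hc) hy hy' h (h'.congr (K.Q_refl hy') htt)

theorem zeroBelow_decidable (hx : K.E w x o) {n : X} (hn : K.E w n o) :
    K.ZeroBelow Θ w x n ∨ ∀ v, w ≤ v → ¬ K.ZeroBelow Θ v x n := by
  let A : Fml := ball 0 (ex (and (isValue Θ 3 1 0) (isEmpty 0)))
  have hA : ∀ {v n}, K.Forces v A (cons n fun _ => x) ↔ K.ZeroBelow Θ v x n := by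
    intro v n
    simp only [A, Forces, forces_ball, forces_isValue, forces_isEmpty]
    exact Iff.rfl
  refine hK.omega_induction ho hω
    (P := fun v n => K.ZeroBelow Θ v x n ∨ ∀ u, v ≤ u → ¬ K.ZeroBelow Θ u x n)
    (Fml.or A (neg A)) (fun _ => x) (fun _ => K.E_left hx) ?_ ?_ ?_ w le_rfl n hn
  · intro v _ n
    simp only [Forces, forces_neg, hA]
  · intro v hv n _ hn0
    exact Or.inl fun u hu m hm => absurd hm (hn0 u hu m)
  · intro v hv n m hn hm hnm ih
    have hmD := K.E_left hm
    rcases ih with ih | ih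
    · obtain ⟨y, hy, hval⟩ := hK.value_exists (K.D_mono hv ho) (hω.mono hv) hΘ (K.E_mono hv hx) hm
      rcases zero_or_succ (hω.mono hv) hy with hy0 | ⟨j, hj, hyj⟩
      · refine Or.inl fun u hu i hi => ?_
        rcases (hnm u hu i (K.E_left hi)).1 hi with hi | hi
        · exact ih u hu i hi
        · exact ⟨y, K.D_mono hu (K.E_left hy), (hval.mono hu).congr
            (K.D_mono (hv.trans hu) (K.E_left hx)) (K.Q_symm hi), hy0.mono hu⟩
      · refine Or.inr fun u hu h => ?_
        have hvu := hv.trans hu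
        obtain ⟨y', hy', hval', hy0⟩ := h u le_rfl m ((hnm.mono hu).mem (K.D_mono hu hmD))
        have hyy := hK.value_unique (K.D_mono hvu ho) (hω.mono hvu) hΘ
          (K.D_mono hvu (K.E_left hx)) (K.D_mono hu hmD) hy' (K.D_mono hu (K.E_left hy)) hval'
          (hval.mono hu)
        exact (hyj.mono hu).not_zero (K.D_mono hu (K.E_left hj)) (hy0.congr hyy)
    · refine Or.inr fun u hu h => ih u hu fun t ht i hi => ?_
      exact h t ht i ((hnm t (hu.trans ht) i (K.E_left hi)).2 (Or.inl hi))

theorem firstHit_decidable (hx : K.E w x o) {k n : X} (hk : K.E w k o) (hn : K.E w n o) :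
    K.F₄ (firstHit Θ) w k n x x ∨ ∀ v, w ≤ v → ¬ K.F₄ (firstHit Θ) v k n x x := by
  simp only [f₄_firstHit]
  rcases hK.zeroBelow_decidable ho hω hΘ hx hn with hz | hz
  swap
  · exact Or.inr fun v hv h => hz v hv h.2
  obtain ⟨y, hy, hval⟩ := hK.value_exists ho hω hΘ hx hn
  have hsucc : ∀ v, w ≤ v → (∃ y, K.D v y ∧ K.Value Θ v x n y ∧ K.Succ v y k) → K.Succ v y k := by
    rintro v hv ⟨y', hy', hval', hs⟩
    exact hs.congr (hK.value_unique (K.D_mono hv ho) (hω.mono hv) hΘ (K.D_mono hv (K.E_left hx))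
      (K.D_mono hv (K.E_left hn)) hy' (K.D_mono hv (K.E_left hy)) hval' (hval.mono hv))
      (K.Q_refl (K.D_mono hv (K.E_left hk)))
  rcases zero_or_succ hω hy with hy0 | ⟨j, hj, hyj⟩
  · exact Or.inr fun v hv h => (hsucc v hv h.1).not_zero (K.D_mono hv (K.E_left hk)) (hy0.mono hv)
  have hjk : ∀ v, w ≤ v → K.Succ v y k → K.Q v j k := fun v hv h =>
    hK.succ_inj (K.D_mono hv ho) (hω.mono hv) (K.E_mono hv hj) (K.E_mono hv hk) (hyj.mono hv) h
      (K.Q_refl (K.D_mono hv (K.E_left hy)))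
  rcases hK.trichotomy ho hω hj hk with h | h | h
  · refine Or.inr fun v hv h' => hK.mem_irrefl (E_congr_left (hjk v hv (hsucc v hv h'.1))
      (K.E_mono hv h))
  · exact Or.inl ⟨⟨y, K.E_left hy, hval, hyj.congr (K.Q_refl (K.E_left hy)) h⟩, hz⟩
  · refine Or.inr fun v hv h' => hK.mem_irrefl (E_congr_right (hjk v hv (hsucc v hv h'.1))
      (K.E_mono hv h))

theorem firstHit_unique (hx : K.E w x o) {k n k' n' : X} (hk : K.E w k o) (hn : K.E w n o)
    (hk' : K.E w k' o) (hn' : K.E w n' o) (h : K.F₄ (firstHit Θ) w k n x x)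
    (h' : K.F₄ (firstHit Θ) w k' n' x x) : K.Q w k k' ∧ K.Q w n n' := by
  obtain ⟨⟨y, hy, hval, hs⟩, hz⟩ := f₄_firstHit.1 h
  obtain ⟨⟨y', hy', hval', hs'⟩, hz'⟩ := f₄_firstHit.1 h'
  have hxD := K.E_left hx
  have key : ∀ {n n' y k}, K.E w n o → K.D w y → K.D w k → K.Value Θ w x n y → K.Succ w y k →
      K.ZeroBelow Θ w x n' → ¬ K.E w n n' := by
    intro n n' y k hn hy hk hval hs hz hnn
    obtain ⟨y', hy', hval', hy0⟩ := hz w le_rfl n hnn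
    exact hs.not_zero hk
      (hy0.congr (hK.value_unique ho hω hΘ hxD (K.E_left hn) hy' hy hval' hval))
  have hnn : K.Q w n n' := by
    rcases hK.trichotomy ho hω hn hn' with h | h | h
    · exact absurd h (key hn hy (K.E_left hk) hval hs hz')
    · exact h
    · exact absurd h (key hn' hy' (K.E_left hk') hval' hs' hz)
  refine ⟨?_, hnn⟩
  exact hK.succ_inj ho hω hk hk' hs hs' (hK.value_unique ho hω hΘ hxD (K.E_left hn') hy hy'
    (hval.congr hxD hnn) hval')

/-- By `LLPO_∞`, some number is not the first positive value of `fun n => U ⟨x, n⟩`,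
diminished by one. -/
theorem exists_no_firstHit {ρ : ℕ → X} (hL : K.Forces w LLPOInfty ρ) (hx : K.E w x o) :
    ∃ k, K.E w k o ∧ ∀ v, w ≤ v → ∀ n, K.E v n o → ¬ K.F₄ (firstHit Θ) v k n x x :=
  hK.llpo_of_decidable ho hω (firstHit Θ) hL (K.E_left hx)
    (fun _ hv _ hk _ hn => hK.firstHit_decidable (K.D_mono hv ho) (hω.mono hv) hΘ
      (K.E_mono hv hx) hk hn)
    (fun _ hv _ _ _ _ hk hn hk' hn' => hK.firstHit_unique (K.D_mono hv ho) (hω.mono hv) hΘ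
      (K.E_mono hv hx) hk hn hk' hn')

/-- A true instance of `firstHit` at numerals is forced. -/
theorem firstHit_num {e k n : ℕ} (hval : U (Nat.pair e n) = k + 1)
    (hzero : ∀ m < n, U (Nat.pair e m) = 0) {i j : X} (hx : K.D w x) (hi : K.D w i)
    (hj : K.D w j) (hxe : K.Num w e x) (hik : K.Num w k i) (hjn : K.Num w n j) :
    K.F₄ (firstHit Θ) w i j x x := by
  have key : ∀ v, w ≤ v → ∀ {m : ℕ} {l : X}, K.D v l → K.Num v m l →
      ∀ {y}, K.D v y → K.Num v (U (Nat.pair e m)) y → K.Value Θ v x l y := by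
    intro v hv m l hl hlm y hy hyU
    have hov := K.D_mono hv ho
    obtain ⟨t, ht, htn⟩ := hK.num_exists hov (Nat.pair e m)
    exact ⟨t, ht, hK.code_num hov ht (K.D_mono hv hx) hl htn (by simpa using hxe.mono hv)
      (by simpa using hlm), hΘ.value hK hov (hω.mono hv) ht hy htn hyU⟩
  refine f₄_firstHit.2 ⟨?_, fun v hv l hl => ?_⟩
  · obtain ⟨y, hy, hyi⟩ := hK.exists_succ hi
    exact ⟨y, hy, key w le_rfl hj hjn hy (by rw [hval]; exact ⟨i, hi, hik, hyi⟩), hyi⟩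
  · obtain ⟨m, hm, hlm⟩ := num_of_mem (hjn.mono hv) hl
    obtain ⟨y, hy, hy0⟩ := hK.num_exists (K.D_mono hv ho) 0
    exact ⟨y, hy, key v hv (K.E_left hl) hlm hy (by rw [hzero m hm]; exact hy0), hy0⟩

end KFrame.IsModel

/-! ### Closures under finitely many rules are recursively enumerable -/

/-- Patterns: expressions built from parameters, constants, pairing and successor. -/
inductive Pat : Type
  | var (i : ℕ) : Pat
  | num (n : ℕ) : Pat
  | succ (p : Pat) : Pat
  | pair (p q : Pat) : Pat

/-- The value of a pattern when the `i`-th parameter is the `i`-th entry of the list. -/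
def Pat.eval (L : List ℕ) : Pat → ℕ
  | var i => L.getD i 0
  | num n => n
  | succ p => p.eval L + 1
  | pair p q => Nat.pair (p.eval L) (q.eval L)

theorem Pat.primrec_eval (p : Pat) : Primrec fun L => p.eval L := by
  induction p with
  | var i => exact (Primrec.list_getD 0).comp .id (.const i)
  | num n => exact .const n
  | succ p h => exact Primrec.succ.comp h
  | pair p q h₁ h₂ => exact Primrec₂.natPair.comp h₁ h₂

/-- A rule of inference on natural numbers: a list of premises and a conclusion. -/
abbrev Rule := List Pat × Pat

/-- The numbers derivable by the rules in `Rs` from the axioms `⟨t, n⟩` with `n ∈ B`. -/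
inductive Closure (Rs : List Rule) (t : ℕ) (B : ℕ → Prop) : ℕ → Prop
  | base {n : ℕ} : B n → Closure Rs t B (Nat.pair t n)
  | rule (R : Rule) (hR : R ∈ Rs) (L : List ℕ) (h : ∀ p ∈ R.1, Closure Rs t B (p.eval L)) :
      Closure Rs t B (R.2.eval L)

/-- The conclusions drawn by the rules in `Rs`, with parameters `L`, from premises in `acc`. -/
def conclusions : List Rule → List ℕ → List ℕ → List ℕ
  | [], _, _ => []
  | R :: Rs, acc, L =>
    if ∀ p ∈ R.1, p.eval L ∈ acc then R.2.eval L :: conclusions Rs acc L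
    else conclusions Rs acc L

theorem mem_conclusions {Rs : List Rule} {acc L : List ℕ} {n : ℕ} :
    n ∈ conclusions Rs acc L ↔ ∃ R ∈ Rs, (∀ p ∈ R.1, p.eval L ∈ acc) ∧ R.2.eval L = n := by
  induction Rs with
  | nil => simp [conclusions]
  | cons R Rs ih =>
    rw [conclusions]
    split_ifs with h
    · rw [List.mem_cons, ih, List.exists_mem_cons_iff]
      exact or_congr ⟨fun e => ⟨h, e.symm⟩, fun e => e.2.symm⟩ Iff.rfl
    · rw [ih, List.exists_mem_cons_iff]
      exact ⟨Or.inr, fun e => e.resolve_left fun e => h e.1⟩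

theorem primrecPred_premises (ps : List Pat) :
    PrimrecPred fun x : List ℕ × List ℕ => ∀ p ∈ ps, p.eval x.2 ∈ x.1 := by
  induction ps with
  | nil => exact (PrimrecPred.of_eq (p := fun _ => True) ⟨inferInstance, .const _⟩ (by simp))
  | cons p ps ih =>
    have h : PrimrecPred fun x : List ℕ × List ℕ => p.eval x.2 ∈ x.1 :=
      (Primrec.nat_lt.comp (Primrec.list_idxOf.comp (p.primrec_eval.comp .snd) .fst)
        (Primrec.list_length.comp .fst)).of_eq fun x => List.idxOf_lt_length_iff
    exact (h.and ih).of_eq fun x => by simp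

theorem primrec_conclusions (Rs : List Rule) :
    Primrec fun x : List ℕ × List ℕ => conclusions Rs x.1 x.2 := by
  induction Rs with
  | nil => exact .const []
  | cons R Rs ih =>
    exact Primrec.ite (primrecPred_premises R.1)
      (Primrec.list_cons.comp (R.2.primrec_eval.comp .snd) ih) ih

open Nat.Partrec (Code)

/-- One step of the enumeration of a closure: all rules are applied with parameters `L`, and
the axiom with the number `L₁` is added if the program `c` halts on `L₁` within `L₀` steps. -/
def closureStep (Rs : List Rule) (t : ℕ) (c : Code) (L acc : List ℕ) : List ℕ :=
  conclusions Rs acc L ++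
    ((Nat.Partrec.Code.evaln (L.getD 0 0) c (L.getD 1 0)).toList.map fun _ =>
      Nat.pair t (L.getD 1 0)) ++ acc

theorem primrec_closureStep (Rs : List Rule) (t : ℕ) (c : Code) :
    Primrec₂ (closureStep Rs t c) := by
  have h0 : ∀ i, Primrec fun x : List ℕ × List ℕ => x.1.getD i 0 := fun i =>
    (Primrec.list_getD 0).comp .fst (.const i)
  refine Primrec.list_append.comp (Primrec.list_append.comp
    ((primrec_conclusions Rs).comp (Primrec.snd.pair .fst)) (Primrec.list_map
      (Primrec.optionToList.comp (Nat.Partrec.Code.primrec_evaln.comp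
        (((h0 0).pair (.const c)).pair (h0 1))))
      (Primrec₂.natPair.comp (.const t) ((h0 1).comp .fst)).to₂)) .snd

theorem mem_closureStep {Rs : List Rule} {t : ℕ} {c : Code} {L acc : List ℕ} {n : ℕ} :
    n ∈ closureStep Rs t c L acc ↔
      (∃ R ∈ Rs, (∀ p ∈ R.1, p.eval L ∈ acc) ∧ R.2.eval L = n) ∨
      ((∃ r, r ∈ c.evaln (L.getD 0 0) (L.getD 1 0)) ∧ Nat.pair t (L.getD 1 0) = n) ∨
      n ∈ acc := by
  simp only [closureStep, List.mem_append, mem_conclusions, or_assoc, List.mem_map,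
    Option.mem_toList, exists_and_right, Option.mem_def]

/-- The closure of a recursively enumerable set under finitely many rules is recursively
enumerable: run the enumeration along all finite lists of parameters. -/
theorem exists_enumeration_closure (Rs : List Rule) (t : ℕ) {B : ℕ → Prop} (hB : REPred B) :
    ∃ check : ℕ → ℕ → Bool, Primrec₂ check ∧
      ∀ n, Closure Rs t B n ↔ ∃ m, check m n = true := by
  obtain ⟨c, hc⟩ := Nat.Partrec.Code.exists_code.1 (Partrec.nat_iff.1
    (hB.map (Computable.const 0).to₂ : Partrec fun n => (Part.assert (B n) fun _ =>
      Part.some ()).map fun _ => (0 : ℕ)))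
  have hc : ∀ n, B n ↔ ∃ k r, r ∈ c.evaln k n := by
    intro n
    have := congrFun hc n
    rw [exists_comm]
    simp only [← Nat.Partrec.Code.evaln_complete, this]
    simp
  -- the numbers derived by applying the rules with the given lists of parameters, last one first
  let run : List (List ℕ) → List ℕ := List.foldr (closureStep Rs t c) []
  have hrun : Primrec run := Primrec.list_foldr .id (.const [])
    ((primrec_closureStep Rs t c).comp (Primrec.fst.comp .snd) (Primrec.snd.comp .snd)).to₂
  have hmem : ∀ n, Closure Rs t B n ↔ ∃ C, n ∈ run C := by
    have append_right : ∀ C D, run D ⊆ run (C ++ D) := by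
      intro C D
      induction C with
      | nil => exact List.Subset.refl _
      | cons L C ih => exact fun n hn => mem_closureStep.2 (Or.inr (Or.inr (ih hn)))
    have append_left : ∀ C D, run C ⊆ run (C ++ D) := by
      intro C D
      induction C with
      | nil => intro n hn; simp [run] at hn
      | cons L C ih =>
        intro n hn
        rcases mem_closureStep.1 hn with ⟨R, hR, h, e⟩ | h | h
        · exact mem_closureStep.2 (Or.inl ⟨R, hR, fun p hp => ih (h p hp), e⟩)
        · exact mem_closureStep.2 (Or.inr (Or.inl h))
        · exact mem_closureStep.2 (Or.inr (Or.inr (ih h)))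
    intro n
    constructor
    · intro h
      induction h with
      | base h =>
        obtain ⟨k, r, hr⟩ := (hc _).1 h
        exact ⟨[[k, _]], mem_closureStep.2 (Or.inr (Or.inl ⟨⟨r, hr⟩, rfl⟩))⟩
      | rule R hR L _ ih =>
        have : ∃ C, ∀ p ∈ R.1, p.eval L ∈ run C := by
          clear hR
          generalize R.1 = ps at ih
          induction ps with
          | nil => exact ⟨[], by simp⟩
          | cons p ps ihp =>
            obtain ⟨C, hC⟩ := ih p (by simp)
            obtain ⟨D, hD⟩ := ihp fun q hq => ih q (by simp [hq])
            refine ⟨C ++ D, fun q hq => ?_⟩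
            rcases List.mem_cons.1 hq with rfl | hq
            · exact append_left _ _ hC
            · exact append_right _ _ (hD q hq)
        obtain ⟨C, hC⟩ := this
        exact ⟨L :: C, mem_closureStep.2 (Or.inl ⟨R, hR, hC, rfl⟩)⟩
    · rintro ⟨C, hC⟩
      induction C generalizing n with
      | nil => simp [run] at hC
      | cons L C ih =>
        rcases mem_closureStep.1 hC with ⟨R, hR, h, rfl⟩ | ⟨⟨r, hr⟩, rfl⟩ | h
        · exact .rule R hR L fun p hp => ih _ (h p hp)
        · exact .base ((hc _).2 ⟨_, r, hr⟩)
        · exact ih _ h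
  refine ⟨fun m n => decide ((run (Denumerable.ofNat _ m)).idxOf n <
    (run (Denumerable.ofNat _ m)).length), ?_, fun n => ?_⟩
  · have h : Primrec fun x : ℕ × ℕ => run (Denumerable.ofNat _ x.1) :=
      hrun.comp ((Primrec.ofNat _).comp .fst)
    have := (Primrec.nat_lt.comp (Primrec.list_idxOf.comp .snd h) (Primrec.list_length.comp h))
    exact this.decide
  · rw [hmem]
    simp only [decide_eq_true_eq, List.idxOf_lt_length_iff]
    exact ⟨fun ⟨C, h⟩ => ⟨Encodable.encode C, by simpa using h⟩, fun ⟨m, h⟩ => ⟨_, h⟩⟩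

/-! ### Decoding formulas, contexts and renamings -/

theorem snd_lt_pair {a : ℕ} (b : ℕ) (h : a ≠ 0) : b < Nat.pair a b := by
  have := Nat.add_le_pair a b
  omega

namespace Fml

/-- The formula with a given code; numbers that are not codes get some formula as well, in such
a way that decoding commutes with the connectives on all numbers. -/
def decode (n : ℕ) : Fml :=
  match _h : n.unpair.1 with
  | 0 => mem n.unpair.2.unpair.1 n.unpair.2.unpair.2
  | 1 => eq n.unpair.2.unpair.1 n.unpair.2.unpair.2
  | 2 => bot
  | 3 => and (decode n.unpair.2.unpair.1) (decode n.unpair.2.unpair.2)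
  | 4 => or (decode n.unpair.2.unpair.1) (decode n.unpair.2.unpair.2)
  | 5 => imp (decode n.unpair.2.unpair.1) (decode n.unpair.2.unpair.2)
  | 6 => all (decode n.unpair.2)
  | 7 => ex (decode n.unpair.2)
  | _ + 8 => bot
termination_by n
decreasing_by
  all_goals
    have h₁ := snd_lt_pair (a := n.unpair.1) n.unpair.2 (by omega)
    rw [Nat.pair_unpair] at h₁
    have h₂ := Nat.unpair_left_le n.unpair.2
    have h₃ := Nat.unpair_right_le n.unpair.2
    omega

theorem decode_mem (i j : ℕ) : decode (Nat.pair 0 (Nat.pair i j)) = mem i j := by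
  rw [decode]; split <;> simp_all

theorem decode_eq (i j : ℕ) : decode (Nat.pair 1 (Nat.pair i j)) = eq i j := by
  rw [decode]; split <;> simp_all

theorem decode_bot (i : ℕ) : decode (Nat.pair 2 i) = bot := by
  rw [decode]; split <;> simp_all

theorem decode_and (i j : ℕ) :
    decode (Nat.pair 3 (Nat.pair i j)) = and (decode i) (decode j) := by
  rw [decode]; split <;> simp_all

theorem decode_or (i j : ℕ) :
    decode (Nat.pair 4 (Nat.pair i j)) = or (decode i) (decode j) := by
  rw [decode]; split <;> simp_all

theorem decode_imp (i j : ℕ) :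
    decode (Nat.pair 5 (Nat.pair i j)) = imp (decode i) (decode j) := by
  rw [decode]; split <;> simp_all

theorem decode_all (i : ℕ) : decode (Nat.pair 6 i) = all (decode i) := by
  rw [decode]; split <;> simp_all

theorem decode_ex (i : ℕ) : decode (Nat.pair 7 i) = ex (decode i) := by
  rw [decode]; split <;> simp_all

theorem decode_code (φ : Fml) : decode (code φ) = φ := by
  induction φ <;> simp_all only [code, decode_mem, decode_eq, decode_bot, decode_and, decode_or,
    decode_imp, decode_all, decode_ex]

end Fml

/-- The code of a context. It agrees with the standard code of the list of the codes of its
formulas. -/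
def codeCtx : List Fml → ℕ
  | [] => 0
  | φ :: Γ => Nat.pair (code φ) (codeCtx Γ) + 1

/-- The context with a given code. -/
def decodeCtx (n : ℕ) : List Fml := (Denumerable.ofNat (List ℕ) n).map decode

theorem decodeCtx_zero : decodeCtx 0 = [] := by simp [decodeCtx]

theorem decodeCtx_cons (a b : ℕ) :
    decodeCtx (Nat.pair a b + 1) = decode a :: decodeCtx b := by
  simp [decodeCtx, Denumerable.list_ofNat_succ]

/-- The renamings that occur in the rules of deduction, pushed under `k` quantifiers: the shift
(for `s = 0`) and the instantiation by the variable `t` (for `s = t + 1`). -/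
def codedRen : ℕ → ℕ → ℕ → ℕ
  | 0, 0 => Nat.succ
  | 0, t + 1 => instRen t
  | k + 1, s => liftRen (codedRen k s)

/-! ### The calculus on codes -/

namespace Pat

/-- The judgement that the formula `a` is derivable in the context `g`. -/
def deriv (g a : Pat) : Pat := pair (num 0) (pair g a)

/-- The judgement `codedRen k s i = j`. -/
def renVar (k s i j : Pat) : Pat := pair (num 1) (pair (pair k s) (pair i j))

/-- The judgement that the renaming `codedRen k s` takes the formula `a` to `b`. -/
def ren (k s a b : Pat) : Pat := pair (num 2) (pair (pair k s) (pair a b))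

/-- The judgement that shifting all formulas of the context `g` gives `h`. -/
def shiftCtx (g h : Pat) : Pat := pair (num 3) (pair g h)

/-- The judgement that `a` is an axiom. -/
def axm (a : Pat) : Pat := pair (num 4) a

/-- The context `g` extended by the formula `a`. -/
def ctx (a g : Pat) : Pat := succ (pair a g)

/-- The formula `mem i j`; this and the following patterns mirror `Fml.code`. -/
def mem (i j : Pat) : Pat := pair (num 0) (pair i j)
def eq (i j : Pat) : Pat := pair (num 1) (pair i j)
def bot : Pat := pair (num 2) (num 0)
def and (a b : Pat) : Pat := pair (num 3) (pair a b)
def or (a b : Pat) : Pat := pair (num 4) (pair a b)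
def imp (a b : Pat) : Pat := pair (num 5) (pair a b)
def all (a : Pat) : Pat := pair (num 6) a
def ex (a : Pat) : Pat := pair (num 7) a

end Pat

/-- The rules of deduction as rules on codes, with auxiliary rules that compute renamings. -/
def rules : List Rule :=
  let v := Pat.var
  let n := Pat.num
  let s := Pat.succ
  -- axioms, assumptions and weakening
  [([.axm (v 0)], .deriv (v 1) (v 0)),
   ([], .deriv (.ctx (v 0) (v 1)) (v 0)),
   ([.deriv (v 1) (v 0)], .deriv (.ctx (v 2) (v 1)) (v 0)),
   -- propositional connectives
   ([.deriv (v 0) .bot], .deriv (v 0) (v 1)),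
   ([.deriv (v 0) (v 1), .deriv (v 0) (v 2)], .deriv (v 0) (.and (v 1) (v 2))),
   ([.deriv (v 0) (.and (v 1) (v 2))], .deriv (v 0) (v 1)),
   ([.deriv (v 0) (.and (v 1) (v 2))], .deriv (v 0) (v 2)),
   ([.deriv (v 0) (v 1)], .deriv (v 0) (.or (v 1) (v 2))),
   ([.deriv (v 0) (v 2)], .deriv (v 0) (.or (v 1) (v 2))),
   ([.deriv (v 0) (.or (v 1) (v 2)), .deriv (.ctx (v 1) (v 0)) (v 3),
     .deriv (.ctx (v 2) (v 0)) (v 3)], .deriv (v 0) (v 3)),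
   ([.deriv (.ctx (v 1) (v 0)) (v 2)], .deriv (v 0) (.imp (v 1) (v 2))),
   ([.deriv (v 0) (.imp (v 1) (v 2)), .deriv (v 0) (v 1)], .deriv (v 0) (v 2)),
   -- quantifiers
   ([.shiftCtx (v 0) (v 1), .deriv (v 1) (v 2)], .deriv (v 0) (.all (v 2))),
   ([.deriv (v 0) (.all (v 1)), .ren (n 0) (s (v 2)) (v 1) (v 3)], .deriv (v 0) (v 3)),
   ([.ren (n 0) (s (v 2)) (v 1) (v 3), .deriv (v 0) (v 3)], .deriv (v 0) (.ex (v 1))),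
   ([.deriv (v 0) (.ex (v 1)), .shiftCtx (v 0) (v 2), .ren (n 0) (n 0) (v 3) (v 4),
     .deriv (.ctx (v 1) (v 2)) (v 4)], .deriv (v 0) (v 3)),
   -- equality
   ([], .deriv (v 0) (.eq (v 1) (v 1))),
   ([.deriv (v 0) (.eq (v 1) (v 2)), .ren (n 0) (s (v 1)) (v 3) (v 4),
     .ren (n 0) (s (v 2)) (v 3) (v 5), .deriv (v 0) (v 4)], .deriv (v 0) (v 5)),
   -- renaming of variables
   ([], .renVar (n 0) (n 0) (v 0) (s (v 0))),
   ([], .renVar (n 0) (s (v 0)) (n 0) (v 0)),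
   ([], .renVar (n 0) (s (v 0)) (s (v 1)) (v 1)),
   ([], .renVar (s (v 0)) (v 1) (n 0) (n 0)),
   ([.renVar (v 0) (v 1) (v 2) (v 3)], .renVar (s (v 0)) (v 1) (s (v 2)) (s (v 3))),
   -- renaming of formulas
   ([.renVar (v 0) (v 1) (v 2) (v 3), .renVar (v 0) (v 1) (v 4) (v 5)],
     .ren (v 0) (v 1) (.mem (v 2) (v 4)) (.mem (v 3) (v 5))),
   ([.renVar (v 0) (v 1) (v 2) (v 3), .renVar (v 0) (v 1) (v 4) (v 5)],
     .ren (v 0) (v 1) (.eq (v 2) (v 4)) (.eq (v 3) (v 5))),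
   ([], .ren (v 0) (v 1) .bot .bot),
   ([.ren (v 0) (v 1) (v 2) (v 3), .ren (v 0) (v 1) (v 4) (v 5)],
     .ren (v 0) (v 1) (.and (v 2) (v 4)) (.and (v 3) (v 5))),
   ([.ren (v 0) (v 1) (v 2) (v 3), .ren (v 0) (v 1) (v 4) (v 5)],
     .ren (v 0) (v 1) (.or (v 2) (v 4)) (.or (v 3) (v 5))),
   ([.ren (v 0) (v 1) (v 2) (v 3), .ren (v 0) (v 1) (v 4) (v 5)],
     .ren (v 0) (v 1) (.imp (v 2) (v 4)) (.imp (v 3) (v 5))),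
   ([.ren (s (v 0)) (v 1) (v 2) (v 3)], .ren (v 0) (v 1) (.all (v 2)) (.all (v 3))),
   ([.ren (s (v 0)) (v 1) (v 2) (v 3)], .ren (v 0) (v 1) (.ex (v 2)) (.ex (v 3))),
   -- shift of contexts
   ([], .shiftCtx (n 0) (n 0)),
   ([.ren (n 0) (n 0) (v 0) (v 1), .shiftCtx (v 2) (v 3)],
     .shiftCtx (.ctx (v 0) (v 2)) (.ctx (v 1) (v 3)))]

/-- The meaning of the judgements of the calculus on codes. As decoding is total, it applies to all
numbers, and the soundness of the rules does not require that the parameters are codes. -/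
def Holds (A : Set Fml) (n : ℕ) : Prop :=
  match n.unpair.1, n.unpair.2.unpair with
  | 0, (g, a) => Deriv A (decodeCtx g) (decode a)
  | 1, (r, x) => codedRen r.unpair.1 r.unpair.2 x.unpair.1 = x.unpair.2
  | 2, (r, x) => rename (codedRen r.unpair.1 r.unpair.2) (decode x.unpair.1) = decode x.unpair.2
  | 3, (g, h) => (decodeCtx g).map shift = decodeCtx h
  | _, _ => ∃ φ ∈ A, code φ = n.unpair.2

theorem holds_rule {A : Set Fml} : ∀ R ∈ rules, ∀ L : List ℕ,
    (∀ p ∈ R.1, Holds A (p.eval L)) → Holds A (R.2.eval L) := by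
  have hd : ∀ g a, Holds A (Nat.pair 0 (Nat.pair g a)) ↔
    Deriv A (decodeCtx g) (decode a) := by intro g a; simp [Holds]
  have hv : ∀ k s i j, Holds A (Nat.pair 1 (Nat.pair (Nat.pair k s) (Nat.pair i j))) ↔
    codedRen k s i = j := by intro k s i j; simp [Holds]
  have hr : ∀ k s i j, Holds A (Nat.pair 2 (Nat.pair (Nat.pair k s) (Nat.pair i j))) ↔
    rename (codedRen k s) (decode i) = decode j := by intro k s i j; simp [Holds]
  have hs : ∀ g h, Holds A (Nat.pair 3 (Nat.pair g h)) ↔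
    (decodeCtx g).map shift = decodeCtx h := by intro g a; simp [Holds]
  have ha : ∀ n, Holds A (Nat.pair 4 n) ↔ ∃ φ ∈ A, code φ = n := by intro n; simp [Holds]
  have hi : ∀ (φ : Fml) t, rename (codedRen 0 (t + 1)) φ = φ.inst t := fun φ t =>
    (inst_eq φ t).symm
  have hsh : ∀ φ : Fml, rename (codedRen 0 0) φ = φ.shift := fun _ => rfl
  simp only [rules, List.forall_mem_cons, List.not_mem_nil, IsEmpty.forall_iff,
    implies_true, forall_const, and_true, Pat.eval, Pat.deriv, Pat.renVar,
    Pat.ren, Pat.shiftCtx, Pat.axm, Pat.ctx, Pat.mem, Pat.eq, Pat.bot, Pat.and, Pat.or, Pat.imp,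
    Pat.all, Pat.ex, hd, hv, hr, hs, ha, decodeCtx_zero, decodeCtx_cons, decode_mem, decode_eq,
    decode_bot, decode_and, decode_or, decode_imp, decode_all, decode_ex, hi, hsh, rename]
  refine ⟨?_, ?_, ?_, ?_, ?_, ?_, ?_, ?_, ?_, ?_, ?_, ?_, ?_, ?_, ?_, ?_, ?_, ?_, ?_, ?_, ?_, ?_,
    ?_, ?_, ?_, ?_, ?_, ?_, ?_, ?_, ?_, ?_, ?_⟩
  · rintro L ⟨φ, hφ, e⟩
    rw [← e, decode_code]
    exact .ax hφ
  · exact fun L => .hyp (List.mem_cons_self ..)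
  · exact fun L h => h.weaken (List.subset_cons_self ..)
  · exact fun L => .botE
  · exact fun L h => .andI h.1 h.2
  · exact fun L => .andE₁
  · exact fun L => .andE₂
  · exact fun L => .orI₁
  · exact fun L => .orI₂
  · exact fun L h => .orE h.1 h.2.1 h.2.2
  · exact fun L => .impI
  · exact fun L h => .impE h.1 h.2
  · rintro L ⟨e, h⟩
    exact .allI (e ▸ h)
  · rintro L ⟨h, e⟩
    exact e ▸ h.allE _
  · rintro L ⟨e, h⟩
    exact .exI _ (e ▸ h)
  · rintro L ⟨h₁, e₁, e₂, h₂⟩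
    rw [← e₁, ← e₂] at h₂
    exact .exE h₁ h₂
  · exact fun L => .eqI _
  · rintro L ⟨h, e₁, e₂, h₂⟩
    rw [← e₁] at h₂
    rw [← e₂]
    exact .eqE h h₂
  · exact fun L => rfl
  · exact fun L => rfl
  · exact fun L => rfl
  · exact fun L => rfl
  · exact fun L e => congrArg Nat.succ e
  · rintro L ⟨e₁, e₂⟩
    rw [e₁, e₂]
  · rintro L ⟨e₁, e₂⟩
    rw [e₁, e₂]
  · exact trivial
  · rintro L ⟨e₁, e₂⟩
    rw [e₁, e₂]
  · rintro L ⟨e₁, e₂⟩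
    rw [e₁, e₂]
  · rintro L ⟨e₁, e₂⟩
    rw [e₁, e₂]
  · exact fun L e => congrArg Fml.all e
  · exact fun L e => congrArg Fml.ex e
  · rfl
  · rintro L ⟨e₁, e₂⟩
    rw [List.map_cons, e₁, e₂]

/-- Soundness of the calculus on codes. -/
theorem holds_of_closure {A : Set Fml} {n : ℕ}
    (h : Closure rules 4 (fun n => ∃ φ ∈ A, code φ = n) n) : Holds A n := by
  induction h with
  | base h => simpa [Holds] using h
  | rule R hR L _ ih => exact holds_rule R hR L ih

/-- Completeness of the calculus on codes. -/
theorem closure_of_deriv {A : Set Fml} {Γ : List Fml} {φ : Fml} (h : Deriv A Γ φ) :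
    Closure rules 4 (fun n => ∃ φ ∈ A, code φ = n)
      (Nat.pair 0 (Nat.pair (codeCtx Γ) (code φ))) := by
  have key : ∀ R ∈ rules, ∀ L, (∀ p ∈ R.1, Closure rules 4 (fun n => ∃ φ ∈ A, code φ = n)
    (p.eval L)) → Closure rules 4 (fun n => ∃ φ ∈ A, code φ = n) (R.2.eval L) := .rule
  have hax : ∀ φ ∈ A, Closure rules 4 (fun n => ∃ φ ∈ A, code φ = n) (Nat.pair 4 (code φ)) :=
    fun φ hφ => .base ⟨φ, hφ, rfl⟩
  generalize Closure rules 4 (fun n => ∃ φ ∈ A, code φ = n) = C at key hax ⊢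
  simp only [rules, List.forall_mem_cons, List.not_mem_nil, IsEmpty.forall_iff,
    implies_true, forall_const, and_true, Pat.eval, Pat.deriv, Pat.renVar,
    Pat.ren, Pat.shiftCtx, Pat.axm, Pat.ctx, Pat.mem, Pat.eq, Pat.bot, Pat.and, Pat.or, Pat.imp,
    Pat.all, Pat.ex] at key
  obtain ⟨ax, hyp, weak, botE, andI, andE₁, andE₂, orI₁, orI₂, orE, impI, impE, allI, allE, exI,
    exE, eqI, eqE, v₁, v₂, v₃, v₄, v₅, r_mem, r_eq, r_bot, r_and, r_or, r_imp, r_all, r_ex,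
    s_nil, s_cons⟩ := key
  have hv : ∀ k s i, C (Nat.pair 1 (Nat.pair (Nat.pair k s) (Nat.pair i (codedRen k s i)))) := by
    intro k s
    induction k with
    | zero =>
      cases s with
      | zero => exact fun i => v₁ [i]
      | succ t =>
        intro i
        cases i with
        | zero => exact v₂ [t]
        | succ i => exact v₃ [t, i]
    | succ k ih =>
      intro i
      cases i with
      | zero => exact v₄ [k, s]
      | succ i => exact v₅ [k, s, i, _] (ih i)
  have hr : ∀ (φ : Fml) k s, C (Nat.pair 2 (Nat.pair (Nat.pair k s)
      (Nat.pair (code φ) (code (rename (codedRen k s) φ))))) := by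
    intro φ
    induction φ with
    | mem i j => exact fun k s => r_mem [k, s, i, _, j, _] ⟨hv k s i, hv k s j⟩
    | eq i j => exact fun k s => r_eq [k, s, i, _, j, _] ⟨hv k s i, hv k s j⟩
    | bot => exact fun k s => r_bot [k, s]
    | and φ ψ h₁ h₂ => exact fun k s => r_and [k, s, _, _, _, _] ⟨h₁ k s, h₂ k s⟩
    | or φ ψ h₁ h₂ => exact fun k s => r_or [k, s, _, _, _, _] ⟨h₁ k s, h₂ k s⟩
    | imp φ ψ h₁ h₂ => exact fun k s => r_imp [k, s, _, _, _, _] ⟨h₁ k s, h₂ k s⟩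
    | all φ h => exact fun k s => r_all [k, s, _, _] (h (k + 1) s)
    | ex φ h => exact fun k s => r_ex [k, s, _, _] (h (k + 1) s)
  have hs : ∀ Γ : List Fml, C (Nat.pair 3 (Nat.pair (codeCtx Γ) (codeCtx (Γ.map shift)))) := by
    intro Γ
    induction Γ with
    | nil => exact s_nil
    | cons φ Γ ih => exact s_cons [_, _, _, _] ⟨hr φ 0 0, ih⟩
  have hi : ∀ (φ : Fml) t, C (Nat.pair 2 (Nat.pair (Nat.pair 0 (t + 1))
      (Nat.pair (code φ) (code (φ.inst t))))) := by
    intro φ t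
    rw [inst_eq]
    exact hr φ 0 (t + 1)
  induction h with
  | ax h => exact ax [_, _] (hax _ h)
  | @hyp Γ φ h =>
    induction Γ with
    | nil => simp at h
    | cons ψ Γ ih =>
      rcases List.mem_cons.1 h with rfl | h
      · exact hyp [_, _]
      · exact weak [_, _, _] (ih h)
  | botE _ ih => exact botE [_, _] ih
  | andI _ _ h₁ h₂ => exact andI [_, _, _] ⟨h₁, h₂⟩
  | andE₁ _ ih => exact andE₁ [_, _, _] ih
  | andE₂ _ ih => exact andE₂ [_, _, _] ih
  | orI₁ _ ih => exact orI₁ [_, _, _] ih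
  | orI₂ _ ih => exact orI₂ [_, _, _] ih
  | orE _ _ _ h₁ h₂ h₃ => exact orE [_, _, _, _] ⟨h₁, h₂, h₃⟩
  | impI _ ih => exact impI [_, _, _] ih
  | impE _ _ h₁ h₂ => exact impE [_, _, _] ⟨h₁, h₂⟩
  | allI _ ih => exact allI [_, _, _] ⟨hs _, ih⟩
  | allE t _ ih => exact allE [_, _, t, _] ⟨ih, hi _ t⟩
  | exI t _ ih => exact exI [_, _, t, _] ⟨hi _ t, ih⟩
  | @exE Γ φ ψ _ _ h₁ h₂ => exact exE [_, _, _, _, _] ⟨h₁, hs Γ, hr ψ 0 0, h₂⟩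
  | eqI t => exact eqI [_, t]
  | @eqE Γ φ s t _ _ h₁ h₂ => exact eqE [_, s, t, _, _, _] ⟨h₁, hi φ s, hi φ t, h₂⟩

/-- The theorems of a recursive set of axioms are recursively enumerable: `check m (code φ)` asks
whether `m` witnesses a derivation of `φ`. -/
theorem exists_enumeration_provable {A : Set Fml}
    (hA : ComputablePred fun n => ∃ φ ∈ A, code φ = n) :
    ∃ check : ℕ → ℕ → Bool, Primrec₂ check ∧
      ∀ φ, Provable A φ ↔ ∃ m, check m (code φ) = true := by
  obtain ⟨check, hc, h⟩ := exists_enumeration_closure rules 4 hA.to_re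
  refine ⟨fun m n => check m (Nat.pair 0 (Nat.pair 0 n)),
    hc.comp .fst (Primrec₂.natPair.comp (.const 0) (Primrec₂.natPair.comp (.const 0) .snd)),
    fun φ => ?_⟩
  rw [← h]
  refine ⟨closure_of_deriv, fun h => ?_⟩
  simpa [Holds, decodeCtx_zero, decode_code, Provable] using holds_of_closure h

/-! ### The statement that a number is not the output of a program -/

/-- For the function `U` represented by `Θ`: the number `k` is not the first positive value of
`fun n => U ⟨x, n⟩`, diminished by one. In this formula `x` and `k` have the indices `0`, `1`. -/
def noHit (Θ : Fml) : Fml :=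
  ex (and (isOmega 0) (ball 0 (neg (app₄ (firstHit Θ) 3 0 2 2))))

/-- The instance of `noHit` where `x` is the numeral of `e`; the index of `k` is `0`. -/
def noHitAt (Θ : Fml) (e : ℕ) : Fml := ex (and (isNumeral e 0) (app₂ (noHit Θ) 0 1))

theorem f₂_noHit {W X : Type} [Preorder W] {K : KFrame W X} {Θ : Fml} {w : W} {x k : X} :
    K.F₂ (noHit Θ) w x k ↔ ∃ o, K.D w o ∧ K.Om w o ∧ ∀ v, w ≤ v → ∀ n, K.E v n o →
      ∀ u, v ≤ u → ¬ K.F₄ (firstHit Θ) u k n x x := by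
  simp only [KFrame.F₂, noHit, KFrame.Forces, KFrame.forces_ball, KFrame.forces_neg,
    KFrame.forces_isOmega, KFrame.forces_app₄]
  exact Iff.rfl

theorem occ_isNumeral {n : ℕ} : ∀ {m i : ℕ}, Occ m (isNumeral n i) → m = i := by
  induction n with
  | zero =>
    intro m i h
    simp only [isNumeral, isEmpty, neg, Occ, or_false] at h
    omega
  | succ n ih =>
    intro m i h
    rcases h with h | h
    · exact absurd (ih h) (Nat.succ_ne_zero m)
    · simp only [isSucc, Fml.iff, Occ] at h
      omega

theorem freeBelow_noHitAt (Θ : Fml) (e : ℕ) : FreeBelow 1 (noHitAt Θ e) := by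
  rw [freeBelow_iff_occ]
  rintro m (h | h)
  · exact absurd (occ_isNumeral h) (Nat.succ_ne_zero m)
  · obtain ⟨n, -, hn⟩ := occ_rename.1 h
    cases n <;> simp only [cons] at hn <;> omega

theorem freeBelow_exNat {φ : Fml} (h : FreeBelow 1 φ) : FreeBelow 0 (exNat φ) := by
  refine ⟨?_, h⟩
  simp [isOmega, isEmpty, isSucc, bex, Fml.iff, neg, FreeBelow]

variable {T : Set Fml} (hext : Extends T (CZF ∪ {LLPOInfty})) {Θ : Fml} {U : ℕ → ℕ}
  (hΘ : Represents Θ U)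

include hext

theorem isModel_canonical : (canonical T).IsModel := fun φ hφ w _ hρ =>
  forces_of_provable (hext φ (.ax (Or.inl hφ))) w hρ

include hΘ

/-- Extensions of `CZF + LLPO_∞` prove for each `e` that some number is not the first positive value
of `fun n => U ⟨e, n⟩`, diminished by one. -/
theorem provable_exNat_noHitAt (e : ℕ) : Provable T (exNat (noHitAt Θ e)) := by
  refine provable_of_forces (freeBelow_exNat (freeBelow_noHitAt Θ e)) fun w ρ hρ => ?_
  have hK := isModel_canonical hext
  obtain ⟨o, ho, hω⟩ := hK.exists_omega (hρ 0)
  obtain ⟨x, hx, hxe⟩ := hK.num_exists ho e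
  obtain ⟨k, hk, h⟩ := hK.exists_no_firstHit ho hω hΘ
    (forces_of_provable (hext _ (.ax (Or.inr rfl))) w hρ) (KFrame.IsModel.num_mem hω hx hxe)
  refine ⟨k, (canonical T).E_left hk, ⟨o, ho, KFrame.forces_isOmega.2 hω, hk⟩, x, hx,
    KFrame.forces_isNumeral.2 hxe, KFrame.forces_app₂.2 (f₂_noHit.2 ⟨o, ho, hω, ?_⟩)⟩
  exact fun v hv n hn u hu => h u (hv.trans hu) n ((canonical T).E_mono hu hn)

/-- If `n` is the first number with `U ⟨e, n⟩ ≠ 0` and `U ⟨e, n⟩ = k + 1`, then a consistent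
extension of `CZF + LLPO_∞` does not prove `noHitAt Θ e` of `k`, as it proves the true
computation. -/
theorem not_provable_noHitAt (hcons : Consistent T) {e k n : ℕ}
    (hval : U (Nat.pair e n) = k + 1) (hzero : ∀ m < n, U (Nat.pair e m) = 0) :
    ¬ Provable T (atNumeral (noHitAt Θ e) k) := by
  refine fun h => hcons (provable_of_forces trivial fun w ρ hρ => ?_)
  have hK := isModel_canonical hext
  obtain ⟨i, hi, hik, x, hx, hxe, h⟩ := forces_of_provable h w hρ
  obtain ⟨o, ho, hω, h⟩ := f₂_noHit.1 (KFrame.forces_app₂.1 h)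
  obtain ⟨j, hj, hjn⟩ := hK.num_exists ho n
  exact h w le_rfl j (KFrame.IsModel.num_mem hω hj hjn) w le_rfl (hK.firstHit_num ho hω hΘ hval
    hzero hx hi hj (KFrame.forces_isNumeral.1 hxe) (KFrame.forces_isNumeral (i := 0).1 hik) hjn)

omit hext hΘ

/-! ### Diagonalisation -/

theorem primrec_code_isNumeral : Primrec fun n => code (isNumeral n 0) := by
  have h : Primrec₂ fun (_ r : ℕ) => Nat.pair 7 (Nat.pair 3 (Nat.pair r (code (isSucc 1 0)))) :=
    Primrec₂.natPair.comp (.const 7) (Primrec₂.natPair.comp (.const 3)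
      (Primrec₂.natPair.comp .snd (.const _)))
  refine (Primrec.nat_rec₁ (code (isEmpty 0)) h).of_eq fun n => ?_
  induction n with
  | zero => rfl
  | succ n ih => exact congrArg (fun r => Nat.pair 7 (Nat.pair 3 (Nat.pair r _))) ih

theorem primrec_code_atNumeral_noHitAt (Θ : Fml) :
    Primrec₂ fun e k => code (atNumeral (noHitAt Θ e) k) := by
  have h : Primrec₂ fun a b : ℕ => Nat.pair 7 (Nat.pair 3 (Nat.pair a b)) :=
    Primrec₂.natPair.comp (.const 7) (Primrec₂.natPair.comp (.const 3)
      (Primrec₂.natPair.comp .fst .snd))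
  exact h.comp (primrec_code_isNumeral.comp .snd)
    (h.comp (primrec_code_isNumeral.comp .fst) (.const (code (app₂ (noHit Θ) 0 1))))

/-- The universal function: `selfEval ⟨e, n⟩` is `k + 1` if the program number `e` outputs `k` on
input `e` within `n` steps, and `0` if there is no output within `n` steps. -/
def selfEval (t : ℕ) : ℕ :=
  Encodable.encode (Code.evaln t.unpair.2 (Denumerable.ofNat Code t.unpair.1) t.unpair.1)

theorem primrec_selfEval : Nat.Primrec selfEval := by
  have h₁ : Primrec fun t : ℕ => t.unpair.1 := Primrec.fst.comp Primrec.unpair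
  have h₂ : Primrec fun t : ℕ => t.unpair.2 := Primrec.snd.comp Primrec.unpair
  exact Primrec.nat_iff.1 (Primrec.encode.comp (Code.primrec_evaln.comp
    ((h₂.pair ((Primrec.ofNat Code).comp h₁)).pair h₁)))

theorem exists_first_selfEval {c : Code} {k : ℕ} (h : k ∈ c.eval (Encodable.encode c)) :
    ∃ n, selfEval (Nat.pair (Encodable.encode c) n) = k + 1 ∧
      ∀ m < n, selfEval (Nat.pair (Encodable.encode c) m) = 0 := by
  have hU : ∀ n, selfEval (Nat.pair (Encodable.encode c) n) =
      Encodable.encode (Code.evaln n c (Encodable.encode c)) := fun n => by simp [selfEval]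
  classical
  have hex : ∃ n, Code.evaln n c (Encodable.encode c) ≠ none := by
    obtain ⟨n, hn⟩ := Code.evaln_complete.1 h
    exact ⟨n, by rw [Option.mem_def.1 hn]; simp⟩
  refine ⟨Nat.find hex, ?_, fun m hm => ?_⟩
  · obtain ⟨r, hr⟩ := Option.ne_none_iff_exists'.1 (Nat.find_spec hex)
    rw [hU, hr, Part.mem_unique (Code.evaln_sound (Option.mem_def.2 hr)) h]
    rfl
  · rw [hU, not_not.1 (Nat.find_min hex hm)]
    rfl

end SetTheory

theorem mainTheorem7 (T : Set SetTheory.Fml)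
    (hext : SetTheory.Extends T (SetTheory.CZF ∪ {SetTheory.LLPOInfty}))
    (hrec : SetTheory.RecursivelyAxiomatisable T)
    (hcons : SetTheory.Consistent T) :
    ¬ SetTheory.NumericalExistenceProperty T := by
  intro hnep
  obtain ⟨A, hA, hTA⟩ := hrec
  obtain ⟨check, hcheck, hcheck'⟩ := SetTheory.exists_enumeration_provable hA
  obtain ⟨Θ, hΘ⟩ := SetTheory.exists_represents SetTheory.primrec_selfEval
  -- the search for a `k` and a proof that `k` is not the output of the program number `e` on `e`
  let F : ℕ → ℕ → Option ℕ := fun e t =>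
    bif check t.unpair.2 (SetTheory.Fml.code (SetTheory.atNumeral (SetTheory.noHitAt Θ e)
      t.unpair.1)) then some t.unpair.1 else none
  have hF : Primrec₂ F := by
    have h₁ : Primrec₂ fun _ t : ℕ => t.unpair.1 := Primrec.fst.comp (Primrec.unpair.comp .snd)
    have h₂ : Primrec₂ fun _ t : ℕ => t.unpair.2 := Primrec.snd.comp (Primrec.unpair.comp .snd)
    exact Primrec.cond
      (hcheck.comp h₂ ((SetTheory.primrec_code_atNumeral_noHitAt Θ).comp .fst h₁))
      (Primrec.option_some.comp h₁) (.const none)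
  have hFmem : ∀ {e t k}, k ∈ F e t →
      SetTheory.Provable T (SetTheory.atNumeral (SetTheory.noHitAt Θ e) k) := by
    intro e t k h
    simp only [F, Bool.cond_eq_ite, Option.mem_def, Option.ite_none_right_eq_some,
      Option.some.injEq] at h
    obtain ⟨h, rfl⟩ := h
    exact (hTA _).2 ((hcheck' _).2 ⟨_, h⟩)
  obtain ⟨c, hc⟩ := Nat.Partrec.Code.exists_code.1
    (Partrec.nat_iff.1 (Partrec.rfindOpt hF.to_comp))
  -- the numerical existence property makes this search succeed on the number of the searching
  -- program `c` itself, so `T` proves of the output of `c` on this number that it is not the output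
  obtain ⟨k, hk⟩ := hnep _ (SetTheory.freeBelow_noHitAt Θ (Encodable.encode c))
    (SetTheory.provable_exNat_noHitAt hext hΘ _)
  obtain ⟨m, hm⟩ := (hcheck' _).1 ((hTA _).1 hk)
  have hdom : (Nat.rfindOpt (F (Encodable.encode c))).Dom := Nat.rfindOpt_dom.2
    ⟨Nat.pair k m, k, by simp [F, hm]⟩
  obtain ⟨r, hr⟩ := Part.dom_iff_mem.1 hdom
  obtain ⟨t, ht⟩ := Nat.rfindOpt_spec hr
  obtain ⟨n, hval, hzero⟩ := SetTheory.exists_first_selfEval (c := c) (k := r)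
    (by rw [hc]; exact hr)
  exact SetTheory.not_provable_noHitAt hext hΘ hcons hval hzero (hFmem ht)
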